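/- Let $d\ge 2$ be an integer and $\rho=(d-1)/2$. On $\mathbb R^{d+1}$ put $[x,y]=x^0y^0-x^1y^1-\dots-x^dy^d$, and let $\mathbb H^d=\{x\in\mathbb R^{d+1}:[x,x]=1,\ x^0>0\}$ be the hyperbolic space. For $\lambda\in\mathbb R$ and $x\in\mathbb H^d$ let $$\Phi_\lambda(x)=\int_{\mathbb S^{d-1}}[x,(1,\omega)]^{-i\lambda-\rho}\,d\omega$$ be the elementary spherical function, where $d\omega$ is the rotation-invariant measure of total mass $1$ on the unit sphere $\mathbb S^{d-1}\subset\mathbb R^d$, and for $r\ge 0$ write $\Phi_\lambda(r)=\Phi_\lambda\big((\cosh r,\sinh r,0,\dots,0)\big)$. Let $$\mathbf c(\lambda)=\kappa\,\frac{\Gamma(i\lambda)}{\Gamma(\rho+i\lambda)}$$ be the Harish-Chandra $\mathbf c$-function, where $\kappa\neq 0$ is a normalizing constant (with $|\mathbf c(0)|^{-2}=0$). Lemma 3.2. There is a constant $C>0$, depending only on $d$ and $\kappa$, such that for all $\varepsilon>0$, all $r\ge 0$ and all $t\in\mathbb R$ the function $\lambda\mapsto e^{-(it+\varepsilon^2)\lambda^2}\,\Phi_\lambda(r)\,|\mathbf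 c(\lambda)|^{-2}$ is integrable on $\mathbb R$ and, if $t\ne 0$, $$\Big|\int_{\mathbb R}e^{-(it+\varepsilon^2)\lambda^2}\,\Phi_\lambda(r)\,|\mathbf c(\lambda)|^{-2}\,d\lambda\Big|\le C\big(|t|^{-d/2}+|t|^{-1}\big)e^{-\rho r}(1+r)^{\rho+1}.$$ -/

import Mathlib

noncomputable section

namespace Hyp

/-- The Minkowski bilinear form `[x, y] = x⁰y⁰ - x¹y¹ - ⋯ - xᵈyᵈ` on `ℝ^{d+1}`. -/
def mink {d : ℕ} (x y : Fin (d + 1) → ℝ) : ℝ :=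
  x 0 * y 0 - ∑ i : Fin d, x i.succ * y i.succ

/-- The hyperbolic space `ℍᵈ = {x ∈ ℝ^{d+1} : [x, x] = 1, x⁰ > 0}`. -/
abbrev Space (d : ℕ) : Type :=
  {x : Fin (d + 1) → ℝ // mink x x = 1 ∧ 0 < x 0}

/-- `b(ω) = (1, ω)` for `ω` in the unit sphere of `ℝᵈ`. -/
def bdry {d : ℕ} (ω : Metric.sphere (0 : EuclideanSpace ℝ (Fin d)) 1) : Fin (d + 1) → ℝ :=
  Fin.cons 1 (fun i => (ω : EuclideanSpace ℝ (Fin d)) i)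

/-- `ρ = (d - 1) / 2`. -/
def rho (d : ℕ) : ℝ := ((d : ℝ) - 1) / 2

/-- The elementary spherical function
`Φ_lam(x) = ∫_{S^{d-1}} [x, b(ω)]^{- i lam - ρ} dω`, `x ∈ ℍᵈ`, where `dω` is the invariant measure
of the sphere, normalized to have total mass one (whence the average `⨍`). -/
def spherical {d : ℕ} (lam : ℝ) (x : Space d) : ℂ :=
  ⨍ ω : Metric.sphere (0 : EuclideanSpace ℝ (Fin d)) 1,
    ((mink x.1 (bdry ω) : ℝ) : ℂ) ^ (-Complex.I * (lam : ℂ) - (rho d : ℂ))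
    ∂((MeasureTheory.volume : MeasureTheory.Measure (EuclideanSpace ℝ (Fin d))).toSphere)

/-- The coordinates of `a_r · 0 = (cosh r, sinh r, 0, …, 0)`, in dimension `n + 1`. -/
def geodesicCoord (n : ℕ) (r : ℝ) : Fin (n + 1 + 1) → ℝ :=
  Fin.cons (Real.cosh r) (Fin.cons (Real.sinh r) (fun _ => 0))

lemma geodesicCoord_mem (n : ℕ) (r : ℝ) :
    mink (geodesicCoord n r) (geodesicCoord n r) = 1 ∧ 0 < geodesicCoord n r 0 := by
  refine ⟨?_, by simpa [geodesicCoord] using Real.cosh_pos r⟩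
  simp only [mink, geodesicCoord, Fin.cons_zero, Fin.cons_succ, Fin.sum_univ_succ, mul_zero,
    Finset.sum_const_zero, add_zero]
  nlinarith [Real.cosh_sq r]

/-- The point `a_r · 0 = (cosh r, sinh r, 0, …, 0)` of `ℍᵈ`, at distance `|r|` from the origin
`0 = (1, 0, …, 0)` (in dimension zero, `ℍ⁰` is reduced to its origin). -/
def geodesicPoint : (d : ℕ) → ℝ → Space d
  | 0, _ => ⟨fun _ => 1, by simp [mink], one_pos⟩
  | n + 1, r => ⟨geodesicCoord n r, geodesicCoord_mem n r⟩

/-- The radial profile `Φ_lam(r) = Φ_lam(a_r · 0)` of the elementary spherical function. -/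
def sphericalRadial (d : ℕ) (lam r : ℝ) : ℂ :=
  spherical lam (geodesicPoint d r)

/-- The Harish-Chandra function `c(lam) = κ Γ(i lam) / Γ(ρ + i lam)` of `ℍᵈ`, with normalizing
constant `κ`. -/
def harishChandraC (d : ℕ) (κ : ℂ) (lam : ℝ) : ℂ :=
  κ * Complex.Gamma (Complex.I * (lam : ℂ)) /
    Complex.Gamma ((rho d : ℂ) + Complex.I * (lam : ℂ))

/-- The integrand `e^{-(it + ε²) lam²} Φ_lam(r) |c(lam)|^{-2}`. At `lam = 0`, where `c` has a pole,
the value is `0`. -/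
def kernelIntegrand (d : ℕ) (κ : ℂ) (ε t r lam : ℝ) : ℂ :=
  Complex.exp (-(Complex.I * (t : ℂ) + (ε : ℂ) ^ 2) * (lam : ℂ) ^ 2) *
    sphericalRadial d lam r * (((‖harishChandraC d κ lam‖ ^ 2)⁻¹ : ℝ) : ℂ)

end Hyp

end

noncomputable section

open MeasureTheory Set Filter Topology
open scoped ENNReal

namespace Hyp

/-! Put `d = n + 2`, `z = it + ε²`, `a = ‖z‖⁻¹` and `u = cosh r`. The estimate is proved for all `z`
with positive real part, with a constant independent of `z` and with `a` in place of `|t|⁻¹`; as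
`|t| ≤ ‖z‖`, it is uniform in `ε`.

Going from `d` to `d + 2` is a differentiation in `u`. Integrating by parts in the angle gives `Φ' =
-(ρ² + λ²) sinh r / (n + 2)` times the spherical function of dimension `d + 2`
(`hasDerivAt_sphericalAngle`), while `|c|⁻²` gets multiplied by `ρ² + λ²`. Hence the kernel in
dimension `d + 2` is `-(n + 2)` times the `u`-derivative of the kernel in dimension `d`
(`kernel_add_two_of_eq`), and only `d = 3` and `d = 2` must be computed.

Let `G(u) = exp(-arcosh² u / 4z)`. For `d = 3`, `Φ = sin(λr) / (λ sinh r)` and the density is `λ²`,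
so the kernel is a multiple of `z^{-1/2} G'(u)`. For `d = 2`, `Φ` is a cosine integral over `(0, r)`
(`sphericalAngle_zero`), and moving a contour by `2πi` turns its product with `tanh πλ` into a sine
integral over `(r, ∞)` (`outerSine_eq`); the kernel is then `z^{-1/2}` times a half-integral of
`G'`. In general one gets `G^{(m+1)}(u)` for `d = 2m + 3` (`kernel_odd_eq`) and `∫ G^{(m+1)}(u + w)
w^{-1/2} dw` for `d = 2m + 2` (`kernel_even_eq`).

The derivative of `arcosh²` is `∫ dy / (u + cosh y)`, whose own derivatives are again integrals of
one sign, bounded by powers of `(1 + r) e^{-r}` with no singularity at `r = 0`. Since `‖G‖ ≤ 1`,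
Leibniz' rule gives `‖G^{(k)}‖ ≲ ((1 + r) e^{-r})^k (a + a^k)` for `k ≥ 1`
(`norm_iteratedDeriv_gaussianCosh_le`). This settles odd `d`. For even `d` the half-integral is cut
at `w = ‖z‖ cosh r`: near the singularity the bound for order `m + 1` is used, beyond it an
integration by parts leaves order `m`. The result behaves like a derivative of order `m + 1/2 = ρ`.
-/

/-! ### The law of one coordinate on the sphere -/

/-- Integration in polar coordinates, for functions with values in `[0, ∞]`. -/
lemma lintegral_polar {E : Type*} [NormedAddCommGroup E] [NormedSpace ℝ E] [MeasurableSpace E]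
    [BorelSpace E] [FiniteDimensional ℝ E] [Nontrivial E] (μ : Measure E) [μ.IsAddHaarMeasure]
    {g : E → ℝ≥0∞} (hg : Measurable g) :
    ∫⁻ x, g x ∂μ = ∫⁻ ω : Metric.sphere (0 : E) 1, ∫⁻ s in Ioi (0 : ℝ),
      ENNReal.ofReal (s ^ (Module.finrank ℝ E - 1)) * g (s • (ω : E)) ∂volume ∂μ.toSphere := by
  have hmul : Measurable fun p : Metric.sphere (0 : E) 1 × Ioi (0 : ℝ) =>
      g ((p.2 : ℝ) • (p.1 : E)) := by
    apply hg.comp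
    fun_prop
  calc ∫⁻ x, g x ∂μ = ∫⁻ x in ({0} : Set E)ᶜ, g x ∂μ := by
        rw [restrict_compl_singleton]
    _ = ∫⁻ x : ({(0)}ᶜ : Set E), g x.1 ∂(μ.comap (↑)) := by
        rw [lintegral_subtype_comap (measurableSet_singleton _).compl]
    _ = ∫⁻ p : Metric.sphere (0 : E) 1 × Ioi (0 : ℝ), g ((p.2 : ℝ) • (p.1 : E))
          ∂(μ.toSphere.prod (.volumeIoiPow (Module.finrank ℝ E - 1))) := by
        rw [← μ.measurePreserving_homeomorphUnitSphereProd.lintegral_comp hmul]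
        refine lintegral_congr fun x => ?_
        congr 1
        have h0 : ‖(x : E)‖ ≠ 0 := norm_ne_zero_iff.mpr x.2
        simp [smul_smul, h0]
    _ = _ := by
        rw [lintegral_prod _ hmul.aemeasurable]
        refine lintegral_congr fun ω => ?_
        rw [Measure.volumeIoiPow, lintegral_withDensity_eq_lintegral_mul _ (by fun_prop)]
        · rw [← lintegral_subtype_comap measurableSet_Ioi]
          rfl
        · exact hmul.comp measurable_prodMk_left

/-- This radial factor occurs on both sides of the comparison below; it can be cancelled because it
is neither `0` nor `∞`. -/
lemma lintegral_Ioi_pow_indicator_ne_zero (n : ℕ) :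
    ∫⁻ s in Ioi (0 : ℝ), ENNReal.ofReal (s ^ n) * (Iio (1 : ℝ)).indicator 1 s ≠ 0 := by
  have hm : Measurable fun s : ℝ => ENNReal.ofReal (s ^ n) * (Iio (1 : ℝ)).indicator 1 s :=
    (by fun_prop : Measurable fun s : ℝ => ENNReal.ofReal (s ^ n)).mul
      (measurable_one.indicator measurableSet_Iio)
  refine (setLIntegral_pos_iff hm).mpr ?_ |>.ne'
  refine lt_of_lt_of_le (?_ : 0 < volume (Ioo (0 : ℝ) 1)) (measure_mono fun s hs => ?_)
  · simp
  · refine ⟨?_, hs.1⟩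
    simp [hs.2, pow_pos hs.1]

lemma lintegral_Ioi_pow_indicator_ne_top (n : ℕ) :
    ∫⁻ s in Ioi (0 : ℝ), ENNReal.ofReal (s ^ n) * (Iio (1 : ℝ)).indicator 1 s ≠ ⊤ := by
  refine ne_top_of_le_ne_top (b := volume (Ioo (0 : ℝ) 1)) (by simp) ?_
  rw [← lintegral_indicator_one measurableSet_Ioo, ← lintegral_indicator measurableSet_Ioi]
  refine lintegral_mono fun s => ?_
  by_cases h0 : 0 < s <;> by_cases h1 : s < 1 <;> simp [h0, h1, indicator]
  exact pow_le_one₀ h0.le h1.le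

/-- A function of the first coordinate and of the norm of the others. -/
lemma lintegral_euclidean_succ (n : ℕ) {g : ℝ → ℝ → ℝ≥0∞} (hg : Measurable (Function.uncurry g)) :
    ∫⁻ x : EuclideanSpace ℝ (Fin (n + 1)), g (x 0) ‖x‖ =
      ∫⁻ a : ℝ, ∫⁻ y : EuclideanSpace ℝ (Fin n), g a (√(a ^ 2 + ‖y‖ ^ 2)) := by
  have h1 := (PiLp.volume_preserving_toLp (Fin (n + 1))).lintegral_comp
    (f := fun x : EuclideanSpace ℝ (Fin (n + 1)) => g (x 0) ‖x‖)
    (hg.comp (by fun_prop : Measurable fun x : EuclideanSpace ℝ (Fin (n + 1)) => (x 0, ‖x‖)))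
  have hm2 : Measurable fun p : ℝ × (Fin n → ℝ) => g p.1 (√(p.1 ^ 2 + ∑ i, p.2 i ^ 2)) :=
    hg.comp (by fun_prop : Measurable fun p : ℝ × (Fin n → ℝ) => (p.1, √(p.1 ^ 2 + ∑ i, p.2 i ^ 2)))
  have h2 := (volume_preserving_piFinSuccAbove (fun _ : Fin (n + 1) => ℝ) 0).lintegral_comp hm2
  rw [← h1]
  have : ∀ x : Fin (n + 1) → ℝ, g ((WithLp.toLp 2 x : EuclideanSpace ℝ (Fin (n + 1))) 0)
      ‖(WithLp.toLp 2 x : EuclideanSpace ℝ (Fin (n + 1)))‖ =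
      g ((MeasurableEquiv.piFinSuccAbove (fun _ : Fin (n + 1) => ℝ) 0 x).1)
       (√((MeasurableEquiv.piFinSuccAbove (fun _ : Fin (n + 1) => ℝ) 0 x).1 ^ 2 +
        ∑ i, (MeasurableEquiv.piFinSuccAbove (fun _ : Fin (n + 1) => ℝ) 0 x).2 i ^ 2)) := by
    intro x
    simp [EuclideanSpace.norm_eq, Fin.sum_univ_succ, MeasurableEquiv.piFinSuccAbove, Fin.tail]
  simp_rw [this]
  rw [h2, Measure.volume_eq_prod, lintegral_prod _ hm2.aemeasurable]
  refine lintegral_congr fun a => ?_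
  rw [← (PiLp.volume_preserving_toLp (Fin n)).lintegral_comp
    (f := fun y : EuclideanSpace ℝ (Fin n) => g a (√(a ^ 2 + ‖y‖ ^ 2)))]
  · refine lintegral_congr fun y => ?_
    simp [EuclideanSpace.real_norm_sq_eq]
  · exact hg.comp (by fun_prop : Measurable fun y : EuclideanSpace ℝ (Fin n) =>
      (a, √(a ^ 2 + ‖y‖ ^ 2)))

/-- The first coordinate of a uniform point of `S^{n+1}` has the law of `cos θ`, with density
proportional to `sin^n θ`. -/
lemma lintegral_toSphere_first_coord (n : ℕ) {h : ℝ → ℝ≥0∞} (hh : Measurable h) :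
    ∫⁻ ω : Metric.sphere (0 : EuclideanSpace ℝ (Fin (n + 2))) 1, h ((ω : EuclideanSpace ℝ (Fin (n + 2))) 0)
      ∂(volume : Measure (EuclideanSpace ℝ (Fin (n + 2)))).toSphere =
    (volume : Measure (EuclideanSpace ℝ (Fin (n + 1)))).toSphere univ *
      ∫⁻ θ in Ioo 0 Real.pi, ENNReal.ofReal (Real.sin θ ^ n) * h (Real.cos θ) := by
  set ψ : ℝ → ℝ≥0∞ := (Iio (1 : ℝ)).indicator 1 with hψ
  have hψm : Measurable ψ := measurable_one.indicator measurableSet_Iio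
  set c := ∫⁻ s in Ioi (0 : ℝ), ENNReal.ofReal (s ^ (n + 1)) * ψ s with hc
  set σ := (volume : Measure (EuclideanSpace ℝ (Fin (n + 1)))).toSphere univ
  have hgm : Measurable (Function.uncurry fun a s : ℝ => h (a / s) * ψ s) :=
    (hh.comp (by fun_prop : Measurable fun p : ℝ × ℝ => p.1 / p.2)).mul
      (hψm.comp measurable_snd)
  -- The integral of `h (x 0 / ‖x‖)` over the unit ball is computed twice: here in polar coordinates
  -- of the whole space, and in `hright` in polar coordinates of the last `n + 1` variables, then of
  -- the resulting half plane, whose angle is `θ`.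
  have hleft : ∫⁻ x : EuclideanSpace ℝ (Fin (n + 2)), h (x 0 / ‖x‖) * ψ ‖x‖ =
      (∫⁻ ω : Metric.sphere (0 : EuclideanSpace ℝ (Fin (n + 2))) 1,
        h ((ω : EuclideanSpace ℝ (Fin (n + 2))) 0)
        ∂(volume : Measure (EuclideanSpace ℝ (Fin (n + 2)))).toSphere) * c := by
    rw [lintegral_polar, ← lintegral_mul_const]
    · refine lintegral_congr fun ω => ?_
      rw [hc, ← lintegral_const_mul]
      · refine setLIntegral_congr_fun measurableSet_Ioi fun s hs => ?_
        have hs' : 0 < s := hs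
        have hω : ‖(ω : EuclideanSpace ℝ (Fin (n + 2)))‖ = 1 := norm_eq_of_mem_sphere ω
        simp only [norm_smul, hω, Real.norm_eq_abs, abs_of_pos hs', PiLp.smul_apply, smul_eq_mul,
          mul_one, finrank_euclideanSpace, Fintype.card_fin]
        rw [mul_div_cancel_left₀ _ hs'.ne']
        simp only [Nat.add_one_sub_one]
        ring
      · exact (by fun_prop : Measurable fun s : ℝ => ENNReal.ofReal (s ^ (n + 1))).mul hψm
    · exact hh.comp (by fun_prop)
    · exact hgm.comp (by fun_prop : Measurable fun x : EuclideanSpace ℝ (Fin (n + 2)) => (x 0, ‖x‖))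
  have hright : ∫⁻ x : EuclideanSpace ℝ (Fin (n + 2)), h (x 0 / ‖x‖) * ψ ‖x‖ =
      σ * (∫⁻ θ in Ioo 0 Real.pi, ENNReal.ofReal (Real.sin θ ^ n) * h (Real.cos θ)) * c := by
    rw [lintegral_euclidean_succ (n + 1) hgm]
    set F : ℝ × ℝ → ℝ≥0∞ := fun p => (Ioi (0 : ℝ)).indicator 1 p.2 * (ENNReal.ofReal (p.2 ^ n) *
      (h (p.1 / √(p.1 ^ 2 + p.2 ^ 2)) * ψ (√(p.1 ^ 2 + p.2 ^ 2)))) with hF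
    have hFm : Measurable F := by
      refine ((measurable_one.indicator measurableSet_Ioi).comp measurable_snd).mul ?_
      refine (by fun_prop : Measurable fun p : ℝ × ℝ => ENNReal.ofReal (p.2 ^ n)).mul ?_
      exact hgm.comp (by fun_prop : Measurable fun p : ℝ × ℝ => (p.1, √(p.1 ^ 2 + p.2 ^ 2)))
    have hF1 : ∀ a, ∫⁻ y : EuclideanSpace ℝ (Fin (n + 1)),
        h (a / √(a ^ 2 + ‖y‖ ^ 2)) * ψ (√(a ^ 2 + ‖y‖ ^ 2)) = σ * ∫⁻ b, F (a, b) := by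
      intro a
      rw [lintegral_polar]
      · have : ∀ ω : Metric.sphere (0 : EuclideanSpace ℝ (Fin (n + 1))) 1,
            ∫⁻ s in Ioi (0 : ℝ),
              ENNReal.ofReal (s ^ (Module.finrank ℝ (EuclideanSpace ℝ (Fin (n + 1))) - 1)) *
              (h (a / √(a ^ 2 + ‖s • (ω : EuclideanSpace ℝ (Fin (n + 1)))‖ ^ 2)) *
                ψ (√(a ^ 2 + ‖s • (ω : EuclideanSpace ℝ (Fin (n + 1)))‖ ^ 2))) =
            ∫⁻ b, F (a, b) := by
          intro ω
          rw [← lintegral_indicator measurableSet_Ioi]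
          refine lintegral_congr fun s => ?_
          have hω : ‖(ω : EuclideanSpace ℝ (Fin (n + 1)))‖ = 1 := norm_eq_of_mem_sphere ω
          simp only [hF, norm_smul, hω, mul_one, Real.norm_eq_abs, sq_abs, finrank_euclideanSpace,
            Fintype.card_fin, Nat.add_one_sub_one]
          by_cases hs : 0 < s <;> simp [indicator, hs]
        simp_rw [this]
        rw [lintegral_const, mul_comm]
      · exact hgm.comp (by fun_prop : Measurable fun y : EuclideanSpace ℝ (Fin (n + 1)) =>
          (a, √(a ^ 2 + ‖y‖ ^ 2)))
    simp_rw [hF1]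
    rw [lintegral_const_mul _ hFm.lintegral_prod_right', ← lintegral_prod _ hFm.aemeasurable,
      ← Measure.volume_eq_prod, ← lintegral_comp_polarCoord_symm, mul_assoc]
    congr 1
    have hsin : ∫⁻ θ in Ioo 0 Real.pi, ENNReal.ofReal (Real.sin θ ^ n) * h (Real.cos θ) =
        ∫⁻ θ in Ioo (-Real.pi) Real.pi, (Ioi (0 : ℝ)).indicator 1 (Real.sin θ) *
          (ENNReal.ofReal (Real.sin θ ^ n) * h (Real.cos θ)) := by
      rw [← lintegral_indicator measurableSet_Ioo, ← lintegral_indicator measurableSet_Ioo]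
      refine lintegral_congr fun θ => ?_
      by_cases h1 : θ ∈ Ioo 0 Real.pi
      · have h2 : θ ∈ Ioo (-Real.pi) Real.pi := ⟨by linarith [h1.1, Real.pi_pos], h1.2⟩
        simp [indicator_of_mem h1, indicator_of_mem h2, indicator_of_mem
          (show Real.sin θ ∈ Ioi 0 from Real.sin_pos_of_mem_Ioo h1)]
      · rw [indicator_of_notMem h1]
        by_cases h2 : θ ∈ Ioo (-Real.pi) Real.pi
        · have h3 : Real.sin θ ∉ Ioi 0 := by
            have h0 : θ ≤ 0 := by
              by_contra hc
              exact h1 ⟨not_le.mp hc, h2.2⟩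
            simpa using Real.sin_nonpos_of_nonpos_of_neg_pi_le h0 h2.1.le
          simp [indicator_of_mem h2, indicator_of_notMem h3]
        · rw [indicator_of_notMem h2]
    have hm1 : Measurable fun θ : ℝ => (Ioi (0 : ℝ)).indicator 1 (Real.sin θ) *
          (ENNReal.ofReal (Real.sin θ ^ n) * h (Real.cos θ)) :=
      ((measurable_one.indicator measurableSet_Ioi).comp Real.measurable_sin).mul
        ((by fun_prop : Measurable fun θ : ℝ => ENNReal.ofReal (Real.sin θ ^ n)).mul
          (hh.comp Real.measurable_cos))
    have hm2 : Measurable fun s : ℝ => ENNReal.ofReal (s ^ (n + 1)) * ψ s :=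
      (by fun_prop : Measurable fun s : ℝ => ENNReal.ofReal (s ^ (n + 1))).mul hψm
    rw [hsin, mul_comm _ c, hc, ← lintegral_prod_mul hm2.aemeasurable hm1.aemeasurable,
      Measure.prod_restrict, ← Measure.volume_eq_prod]
    refine setLIntegral_congr_fun polarCoord.open_target.measurableSet fun p hp => ?_
    have hp1 : 0 < p.1 := hp.1
    have hnorm : √((p.1 * Real.cos p.2) ^ 2 + (p.1 * Real.sin p.2) ^ 2) = p.1 := by
      rw [show (p.1 * Real.cos p.2) ^ 2 + (p.1 * Real.sin p.2) ^ 2 = p.1 ^ 2 by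
        nlinarith [Real.sin_sq_add_cos_sq p.2], Real.sqrt_sq hp1.le]
    simp only [polarCoord_symm_apply, hF, smul_eq_mul, hnorm]
    rw [mul_div_cancel_left₀ _ hp1.ne', mul_pow]
    by_cases hsn : 0 < Real.sin p.2
    · have : 0 < p.1 * Real.sin p.2 := mul_pos hp1 hsn
      rw [indicator_of_mem (show _ ∈ Ioi (0 : ℝ) from this),
        indicator_of_mem (show _ ∈ Ioi (0 : ℝ) from hsn), pow_succ',
        ENNReal.ofReal_mul (by positivity), ENNReal.ofReal_mul (by positivity)]
      simp only [Pi.one_apply]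
      ring
    · have : ¬ 0 < p.1 * Real.sin p.2 := by
        intro hlt
        exact hsn ((mul_pos_iff_of_pos_left hp1).mp hlt)
      rw [indicator_of_notMem (show _ ∉ Ioi (0 : ℝ) from this),
        indicator_of_notMem (show _ ∉ Ioi (0 : ℝ) from hsn)]
      simp
  exact (ENNReal.mul_left_inj (lintegral_Ioi_pow_indicator_ne_zero _)
    (lintegral_Ioi_pow_indicator_ne_top _)).mp (hleft.symm.trans hright)

lemma integral_toSphere_first_coord (n : ℕ) {f : ℝ → ℂ} (hf : StronglyMeasurable f) :
    ∫ ω : Metric.sphere (0 : EuclideanSpace ℝ (Fin (n + 2))) 1,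
      f ((ω : EuclideanSpace ℝ (Fin (n + 2))) 0)
      ∂(volume : Measure (EuclideanSpace ℝ (Fin (n + 2)))).toSphere =
    (volume : Measure (EuclideanSpace ℝ (Fin (n + 1)))).toSphere.real univ *
      ∫ θ in 0..Real.pi, ((Real.sin θ ^ n : ℝ) : ℂ) * f (Real.cos θ) := by
  set σ := (volume : Measure (EuclideanSpace ℝ (Fin (n + 1)))).toSphere univ
  have hdens : Measurable fun θ : ℝ => (Real.sin θ ^ n).toNNReal := by fun_prop
  have hmap : (volume : Measure (EuclideanSpace ℝ (Fin (n + 2)))).toSphere.map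
      (fun ω : Metric.sphere (0 : EuclideanSpace ℝ (Fin (n + 2))) 1 =>
        (ω : EuclideanSpace ℝ (Fin (n + 2))) 0) =
      σ • ((volume.restrict (Ioo 0 Real.pi)).withDensity
        fun θ => ((Real.sin θ ^ n).toNNReal : ℝ≥0∞)).map Real.cos := by
    refine Measure.ext_of_lintegral _ fun h hh => ?_
    rw [lintegral_map hh (by fun_prop), lintegral_toSphere_first_coord n hh, lintegral_smul_measure,
      lintegral_map hh Real.measurable_cos,
      lintegral_withDensity_eq_lintegral_mul _ hdens.coe_nnreal_ennreal
        (g := fun θ => h (Real.cos θ)) (hh.comp Real.measurable_cos)]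
    rfl
  rw [← integral_map (φ := fun ω : Metric.sphere (0 : EuclideanSpace ℝ (Fin (n + 2))) 1 =>
    (ω : EuclideanSpace ℝ (Fin (n + 2))) 0) (by fun_prop) hf.aestronglyMeasurable, hmap,
    integral_smul_measure, integral_map (by fun_prop) hf.aestronglyMeasurable,
    integral_withDensity_eq_integral_smul hdens,
    intervalIntegral.integral_of_le Real.pi_pos.le, integral_Ioc_eq_integral_Ioo]
  rw [Complex.real_smul]
  congr 1
  refine setIntegral_congr_fun measurableSet_Ioo fun θ hθ => ?_
  have : 0 ≤ Real.sin θ ^ n := pow_nonneg (Real.sin_pos_of_mem_Ioo hθ).le n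
  simp [NNReal.smul_def, Real.coe_toNNReal _ this]

/-- `∫_0^π sin^n`. -/
def sinMass (n : ℕ) : ℝ := ∫ θ in 0..Real.pi, Real.sin θ ^ n

lemma sinMass_pos (n : ℕ) : 0 < sinMass n := integral_sin_pow_pos n

lemma sinMass_add_two (n : ℕ) : sinMass (n + 2) = (n + 1) / (n + 2) * sinMass n := by
  simp [sinMass, integral_sin_pow]

/-- The case `f = 1` of the unnormalized formula gives the total mass, so the area of the smaller
sphere cancels and never has to be evaluated. -/
lemma average_toSphere_first_coord (n : ℕ) {f : ℝ → ℂ} (hf : StronglyMeasurable f) :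
    ⨍ ω : Metric.sphere (0 : EuclideanSpace ℝ (Fin (n + 2))) 1,
      f ((ω : EuclideanSpace ℝ (Fin (n + 2))) 0)
      ∂(volume : Measure (EuclideanSpace ℝ (Fin (n + 2)))).toSphere =
    (sinMass n : ℂ)⁻¹ * ∫ θ in 0..Real.pi, ((Real.sin θ ^ n : ℝ) : ℂ) * f (Real.cos θ) := by
  have h1 := integral_toSphere_first_coord n (f := fun _ => 1) stronglyMeasurable_const
  rw [integral_const] at h1
  simp only [mul_one, Complex.real_smul] at h1
  rw [intervalIntegral.integral_ofReal] at h1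
  change _ = _ * ((sinMass n : ℝ) : ℂ) at h1
  have hne : ((volume : Measure (EuclideanSpace ℝ (Fin (n + 1)))).toSphere.real univ : ℂ) ≠ 0 := by
    rw [Complex.ofReal_ne_zero, measureReal_ne_zero_iff, Ne, Measure.measure_univ_eq_zero]
    exact Measure.toSphere_ne_zero _
  have hne2 : (sinMass n : ℂ) ≠ 0 := Complex.ofReal_ne_zero.mpr (sinMass_pos n).ne'
  rw [average_eq, integral_toSphere_first_coord n hf, Complex.real_smul, Complex.ofReal_inv, h1]
  field_simp

/-! ### The spherical function as an integral over the angle -/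

/-- `[a_r · 0, (1, ω)]` as a function of the angle between `ω` and the first axis. -/
def minkAngle (r θ : ℝ) : ℝ := Real.cosh r - Real.sinh r * Real.cos θ

lemma exp_neg_abs_le_minkAngle (r θ : ℝ) : Real.exp (-|r|) ≤ minkAngle r θ := by
  have h1 : Real.sinh r * Real.cos θ ≤ |Real.sinh r| := by
    calc _ ≤ |Real.sinh r * Real.cos θ| := le_abs_self _
      _ = |Real.sinh r| * |Real.cos θ| := abs_mul _ _
      _ ≤ |Real.sinh r| * 1 := by gcongr; exact Real.abs_cos_le_one θ
      _ = _ := mul_one _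
  rw [minkAngle, ← Real.cosh_sub_sinh, Real.cosh_abs, ← Real.abs_sinh]
  linarith

lemma minkAngle_le_exp_abs (r θ : ℝ) : minkAngle r θ ≤ Real.exp |r| := by
  have h1 : -(Real.sinh r * Real.cos θ) ≤ |Real.sinh r| := by
    calc _ ≤ |Real.sinh r * Real.cos θ| := neg_le_abs _
      _ = |Real.sinh r| * |Real.cos θ| := abs_mul _ _
      _ ≤ |Real.sinh r| * 1 := by gcongr; exact Real.abs_cos_le_one θ
      _ = _ := mul_one _
  rw [minkAngle, ← Real.cosh_add_sinh, Real.cosh_abs, ← Real.abs_sinh]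
  linarith

lemma minkAngle_pos (r θ : ℝ) : 0 < minkAngle r θ :=
  (Real.exp_pos _).trans_le (exp_neg_abs_le_minkAngle r θ)

lemma abs_log_minkAngle_le (r θ : ℝ) : |Real.log (minkAngle r θ)| ≤ |r| := by
  rw [abs_le]
  constructor
  · simpa using Real.log_le_log (Real.exp_pos _) (exp_neg_abs_le_minkAngle r θ)
  · simpa using Real.log_le_log (minkAngle_pos r θ) (minkAngle_le_exp_abs r θ)

/-- `[a_r · 0, (1, ω)]^{-σ}` as a function of the angle. -/
def minkPow (σ : ℂ) (r θ : ℝ) : ℂ := Complex.exp (-σ * (Real.log (minkAngle r θ) : ℝ))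

lemma continuous_minkPow (σ : ℂ) : Continuous fun p : ℝ × ℝ => minkPow σ p.1 p.2 := by
  unfold minkPow
  have h : Continuous fun p : ℝ × ℝ => Real.log (minkAngle p.1 p.2) := by
    refine Continuous.log ?_ fun p => (minkAngle_pos _ _).ne'
    unfold minkAngle
    have := Real.continuous_cosh
    have := Real.continuous_sinh
    fun_prop
  fun_prop

lemma norm_minkPow_le (σ : ℂ) (r θ : ℝ) : ‖minkPow σ r θ‖ ≤ Real.exp (|σ.re| * |r|) := by
  rw [minkPow, Complex.norm_exp, Real.exp_le_exp]
  calc (-σ * (Real.log (minkAngle r θ) : ℝ)).re ≤ |σ.re * Real.log (minkAngle r θ)| := by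
        rw [Complex.re_mul_ofReal, Complex.neg_re, neg_mul]; exact neg_le_abs _
    _ = |σ.re| * |Real.log (minkAngle r θ)| := abs_mul _ _
    _ ≤ _ := mul_le_mul_of_nonneg_left (abs_log_minkAngle_le r θ) (abs_nonneg _)

lemma minkPow_add_one (σ : ℂ) (r θ : ℝ) :
    minkPow (σ + 1) r θ * (minkAngle r θ : ℂ) = minkPow σ r θ := by
  unfold minkPow
  have : ((minkAngle r θ : ℝ) : ℂ) = Complex.exp (Real.log (minkAngle r θ) : ℝ) := by
    rw [← Complex.ofReal_exp, Real.exp_log (minkAngle_pos r θ)]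
  rw [this, ← Complex.exp_add]
  congr 1
  ring

lemma hasDerivAt_minkPow {σ : ℂ} {p : ℝ → ℝ × ℝ} {x b' : ℝ}
    (h : HasDerivAt (fun y => minkAngle (p y).1 (p y).2) b' x) :
    HasDerivAt (fun y => minkPow σ (p y).1 (p y).2)
      (-σ * minkPow (σ + 1) (p x).1 (p x).2 * b') x := by
  have h1 := (h.log (minkAngle_pos _ _).ne').ofReal_comp
  have h2 := (h1.const_mul (-σ)).cexp
  refine h2.congr_deriv ?_
  change minkPow σ _ _ * _ = _
  rw [← minkPow_add_one σ]
  have : ((minkAngle (p x).1 (p x).2 : ℝ) : ℂ) ≠ 0 :=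
    Complex.ofReal_ne_zero.mpr (minkAngle_pos _ _).ne'
  push_cast
  field_simp

lemma hasDerivAt_minkPow_radial (σ : ℂ) (r θ : ℝ) :
    HasDerivAt (fun y => minkPow σ y θ)
      (-σ * minkPow (σ + 1) r θ * ((Real.sinh r - Real.cosh r * Real.cos θ : ℝ) : ℂ)) r :=
  hasDerivAt_minkPow (p := fun y => (y, θ))
    ((Real.hasDerivAt_cosh r).sub ((Real.hasDerivAt_sinh r).mul_const (Real.cos θ)))

lemma hasDerivAt_minkPow_angle (σ : ℂ) (r θ : ℝ) :
    HasDerivAt (fun y => minkPow σ r y)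
      (-σ * minkPow (σ + 1) r θ * ((Real.sinh r * Real.sin θ : ℝ) : ℂ)) θ :=
  hasDerivAt_minkPow (p := fun y => (r, y))
    ((((Real.hasDerivAt_cos θ).const_mul (Real.sinh r)).const_sub (Real.cosh r)).congr_deriv
      (by ring))

/-- The spherical function in dimension `n + 2`, as an integral over the angle; the spectral
parameter is `σ = i lam + ρ`. -/
def sphericalAngle (n : ℕ) (σ : ℂ) (r : ℝ) : ℂ :=
  (sinMass n : ℂ)⁻¹ * ∫ θ in 0..Real.pi, ((Real.sin θ ^ n : ℝ) : ℂ) * minkPow σ r θ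

/-- The bracket of `a_r · 0` with `(1, ω)` is `cosh r - sinh r ω₀`, so only the first coordinate of
`ω` enters. -/
lemma sphericalRadial_eq (n : ℕ) (lam r : ℝ) :
    sphericalRadial (n + 2) lam r = sphericalAngle n (rho (n + 2) + Complex.I * lam) r := by
  have hm : StronglyMeasurable fun x : ℝ => ((Real.cosh r - Real.sinh r * x : ℝ) : ℂ) ^
      (-Complex.I * (lam : ℂ) - (rho (n + 2) : ℂ)) := by
    apply Measurable.stronglyMeasurable
    fun_prop
  rw [sphericalAngle, sphericalRadial, spherical]
  convert average_toSphere_first_coord n hm using 2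
  · ext ω
    congr 2
    simp [geodesicPoint, mink, bdry, geodesicCoord, Fin.sum_univ_succ]
  · refine intervalIntegral.integral_congr fun θ _ => ?_
    change _ = _ * ((minkAngle r θ : ℝ) : ℂ) ^ _
    rw [minkPow, Complex.cpow_def_of_ne_zero
      (Complex.ofReal_ne_zero.mpr (minkAngle_pos r θ).ne' : ((minkAngle r θ : ℝ) : ℂ) ≠ 0),
      ← Complex.ofReal_log (minkAngle_pos r θ).le]
    ring_nf

lemma intervalIntegrable_sin_mul_minkPow (n : ℕ) (σ : ℂ) (r a b : ℝ) :
    IntervalIntegrable (fun θ => ((Real.sin θ ^ n : ℝ) : ℂ) * minkPow σ r θ) volume a b := by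
  have := (continuous_minkPow σ).comp (by fun_prop : Continuous fun θ : ℝ => (r, θ))
  exact (by fun_prop : Continuous fun θ => ((Real.sin θ ^ n : ℝ) : ℂ) * minkPow σ r θ).intervalIntegrable _ _

/-- Integration by parts in the angle. -/
lemma integral_sin_mul_minkPow_radial (n : ℕ) (σ : ℂ) (r : ℝ) :
    (n + 1) * ∫ θ in 0..Real.pi, ((Real.sin θ ^ n : ℝ) : ℂ) * (minkPow (σ + 1) r θ *
      ((Real.sinh r - Real.cosh r * Real.cos θ : ℝ) : ℂ)) =
    (n + 1 - σ) * Real.sinh r *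
      ∫ θ in 0..Real.pi, ((Real.sin θ ^ (n + 2) : ℝ) : ℂ) * minkPow (σ + 1) r θ := by
  have hc := (continuous_minkPow (σ + 1)).comp (by fun_prop : Continuous fun θ : ℝ => (r, θ))
  have hc1 := (continuous_minkPow σ).comp (by fun_prop : Continuous fun θ : ℝ => (r, θ))
  simp only [Function.comp_def] at hc hc1
  -- `D` is the derivative of `sin^{n+1} θ · minkPow σ r θ`, which vanishes at `0` and `π`.
  -- Rewriting `minkPow σ` as `minkPow (σ + 1)` times `minkAngle`, the two integrands differ by `-D`
  -- because `sin² + cos² = 1`.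
  set D : ℝ → ℂ := fun θ => (((n + 1 : ℕ) : ℝ) * Real.sin θ ^ n * Real.cos θ : ℝ) * minkPow σ r θ +
    ((Real.sin θ ^ (n + 1) : ℝ) : ℂ) *
      (-σ * minkPow (σ + 1) r θ * ((Real.sinh r * Real.sin θ : ℝ) : ℂ)) with hD
  have hderiv : ∀ θ : ℝ, HasDerivAt
      (fun θ => ((Real.sin θ ^ (n + 1) : ℝ) : ℂ) * minkPow σ r θ) (D θ) θ := by
    intro θ
    exact (((Real.hasDerivAt_sin θ).pow (n + 1)).ofReal_comp.congr_deriv (by simp)).mul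
      (hasDerivAt_minkPow_angle σ r θ)
  have hint : ∫ θ in 0..Real.pi, D θ = 0 := by
    rw [intervalIntegral.integral_eq_sub_of_hasDerivAt (fun θ _ => hderiv θ)]
    · simp
    · exact (by fun_prop : Continuous D).intervalIntegrable _ _
  have hsub : ∫ θ in 0..Real.pi, ((n + 1) * (((Real.sin θ ^ n : ℝ) : ℂ) * (minkPow (σ + 1) r θ *
      ((Real.sinh r - Real.cosh r * Real.cos θ : ℝ) : ℂ))) -
    (n + 1 - σ) * Real.sinh r * (((Real.sin θ ^ (n + 2) : ℝ) : ℂ) * minkPow (σ + 1) r θ)) =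
      ∫ θ in 0..Real.pi, -D θ := by
    refine intervalIntegral.integral_congr fun θ _ => ?_
    simp only [hD]
    rw [← minkPow_add_one σ r θ, minkAngle]
    have hs : (Real.sin θ : ℂ) ^ 2 = 1 - (Real.cos θ : ℂ) ^ 2 := by
      exact_mod_cast Real.sin_sq θ
    push_cast at hs ⊢
    simp only [pow_succ (Complex.sin (θ : ℂ)) (n + 1), pow_succ (Complex.sin (θ : ℂ)) n]
    linear_combination (-(n + 1 : ℂ)) * Complex.sin θ ^ n * minkPow (σ + 1) r θ *
      Complex.sinh r * hs
  rw [intervalIntegral.integral_neg, hint, neg_zero, intervalIntegral.integral_sub,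
    intervalIntegral.integral_const_mul, intervalIntegral.integral_const_mul, sub_eq_zero] at hsub
  · exact hsub
  all_goals exact Continuous.intervalIntegrable (by fun_prop) _ _

/-- Differentiation under the integral produces `sinh r - cosh r cos θ`; the integration by parts
trades it for `sin² θ`, which is the weight of the sphere two dimensions higher. The quotient of
`sinMass (n + 2)` by `sinMass n` turns the denominator `n + 1` into `n + 2`. -/
lemma hasDerivAt_sphericalAngle (n : ℕ) (σ : ℂ) (r : ℝ) :
    HasDerivAt (sphericalAngle n σ)
      (-(σ * (n + 1 - σ) / (n + 2)) * Real.sinh r * sphericalAngle (n + 2) (σ + 1) r) r := by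
  have hder : HasDerivAt (fun r => ∫ θ in 0..Real.pi, ((Real.sin θ ^ n : ℝ) : ℂ) * minkPow σ r θ)
      (∫ θ in 0..Real.pi, ((Real.sin θ ^ n : ℝ) : ℂ) * (-σ * minkPow (σ + 1) r θ *
        ((Real.sinh r - Real.cosh r * Real.cos θ : ℝ) : ℂ))) r := by
    have hc := (continuous_minkPow (σ + 1)).comp (by fun_prop : Continuous fun θ : ℝ => (r, θ))
    simp only [Function.comp_def] at hc
    refine (intervalIntegral.hasDerivAt_integral_of_dominated_loc_of_deriv_le (𝕜 := ℝ)
      (F := fun r θ => ((Real.sin θ ^ n : ℝ) : ℂ) * minkPow σ r θ)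
      (F' := fun r θ => ((Real.sin θ ^ n : ℝ) : ℂ) * (-σ * minkPow (σ + 1) r θ *
        ((Real.sinh r - Real.cosh r * Real.cos θ : ℝ) : ℂ)))
      (bound := fun _ => ‖σ‖ * Real.exp (|(σ + 1).re| * (|r| + 1)) *
        (2 * Real.cosh (|r| + 1)))
      (s := Metric.ball r 1) (Metric.ball_mem_nhds r one_pos) ?_ ?_ ?_ ?_ ?_ ?_).2
    · refine Eventually.of_forall fun x => ?_
      exact (intervalIntegrable_sin_mul_minkPow n σ x 0 Real.pi).def'.aestronglyMeasurable
    · exact intervalIntegrable_sin_mul_minkPow n σ r 0 Real.pi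
    · exact (by fun_prop : Continuous fun θ : ℝ => ((Real.sin θ ^ n : ℝ) : ℂ) *
        (-σ * minkPow (σ + 1) r θ * ((Real.sinh r - Real.cosh r * Real.cos θ : ℝ) : ℂ))
        ).aestronglyMeasurable
    · refine Eventually.of_forall fun θ _ x hx => ?_
      have hx1 : |x| ≤ |r| + 1 := by
        have : |x - r| < 1 := by simpa [Real.dist_eq] using hx
        have := abs_sub_abs_le_abs_sub x r
        linarith
      have hcosh : Real.cosh x ≤ Real.cosh (|r| + 1) := by
        rw [Real.cosh_le_cosh, abs_of_nonneg (by positivity : 0 ≤ |r| + 1)]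
        exact hx1
      have hs1 : ‖((Real.sin θ ^ n : ℝ) : ℂ)‖ ≤ 1 := by
        rw [Complex.norm_real, norm_pow]
        exact pow_le_one₀ (norm_nonneg _) (Real.abs_sin_le_one θ)
      have hs2 : ‖((Real.sinh x - Real.cosh x * Real.cos θ : ℝ) : ℂ)‖ ≤
          2 * Real.cosh (|r| + 1) := by
        rw [Complex.norm_real, Real.norm_eq_abs]
        have h1 : |Real.sinh x| ≤ Real.cosh x := by
          rw [abs_le]
          constructor <;> linarith [Real.sinh_lt_cosh x, Real.cosh_add_sinh x, Real.exp_pos x]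
        have h2 : |Real.cosh x * Real.cos θ| ≤ Real.cosh x := by
          rw [abs_mul, abs_of_pos (Real.cosh_pos x)]
          exact mul_le_of_le_one_right (Real.cosh_pos x).le (Real.abs_cos_le_one θ)
        linarith [abs_sub (Real.sinh x) (Real.cosh x * Real.cos θ)]
      have hs3 : ‖minkPow (σ + 1) x θ‖ ≤ Real.exp (|(σ + 1).re| * (|r| + 1)) :=
        (norm_minkPow_le _ _ _).trans (Real.exp_le_exp.mpr (by gcongr))
      rw [norm_mul, norm_mul, norm_mul, norm_neg]
      calc _ ≤ 1 * (‖σ‖ * Real.exp (|(σ + 1).re| * (|r| + 1)) * (2 * Real.cosh (|r| + 1))) := by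
            gcongr
        _ = _ := one_mul _
    · exact intervalIntegrable_const
    · refine Eventually.of_forall fun θ _ x _ => ?_
      exact (hasDerivAt_minkPow_radial σ x θ).const_mul _
  refine (hder.const_mul ((sinMass n : ℂ)⁻¹)).congr_deriv ?_
  have hibp := integral_sin_mul_minkPow_radial n σ r
  have hswap : ∫ θ in 0..Real.pi, ((Real.sin θ ^ n : ℝ) : ℂ) * (-σ * minkPow (σ + 1) r θ *
        ((Real.sinh r - Real.cosh r * Real.cos θ : ℝ) : ℂ)) =
      -σ * ∫ θ in 0..Real.pi, ((Real.sin θ ^ n : ℝ) : ℂ) * (minkPow (σ + 1) r θ *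
        ((Real.sinh r - Real.cosh r * Real.cos θ : ℝ) : ℂ)) := by
    rw [← intervalIntegral.integral_const_mul]
    refine intervalIntegral.integral_congr fun θ _ => ?_
    ring
  rw [hswap, sphericalAngle, sinMass_add_two]
  have h1 : (n + 1 : ℂ) ≠ 0 := by exact_mod_cast n.succ_ne_zero
  have h2 : (n + 2 : ℂ) ≠ 0 := by exact_mod_cast (n + 1).succ_ne_zero
  have h3 : (sinMass n : ℂ) ≠ 0 := Complex.ofReal_ne_zero.mpr (sinMass_pos n).ne'
  generalize (∫ θ in 0..Real.pi, ((Real.sin θ ^ n : ℝ) : ℂ) * (minkPow (σ + 1) r θ *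
        ((Real.sinh r - Real.cosh r * Real.cos θ : ℝ) : ℂ))) = X at *
  generalize (∫ θ in 0..Real.pi, ((Real.sin θ ^ (n + 2) : ℝ) : ℂ) * minkPow (σ + 1) r θ) = Y at *
  push_cast at hibp ⊢
  field_simp
  linear_combination (-σ) * hibp

lemma rho_add_two (d : ℕ) : rho (d + 2) = rho d + 1 := by
  simp only [rho]
  push_cast
  ring

/-! ### The spectral density -/

/-- The spectral density `|c(lam)|^{-2}` in dimension `n + 2`, for `κ = 1`. -/
def density : ℕ → ℝ → ℝ
  | 0, l => l * Real.tanh (Real.pi * l)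
  | 1, l => l ^ 2
  | n + 2, l => (rho (n + 2) ^ 2 + l ^ 2) * density n l

lemma continuous_density : ∀ n, Continuous (density n)
  | 0 => by
    have : Continuous Real.tanh := by
      simp_rw [funext Real.tanh_eq_sinh_div_cosh]
      exact Real.continuous_sinh.div Real.continuous_cosh fun x => (Real.cosh_pos x).ne'
    change Continuous fun l => l * Real.tanh (Real.pi * l)
    fun_prop
  | 1 => continuous_pow 2
  | n + 2 => by
    have := continuous_density n
    change Continuous fun l => (rho (n + 2) ^ 2 + l ^ 2) * density n l
    fun_prop

lemma abs_density_le : ∀ n, ∃ C N, ∀ l, |density n l| ≤ C * (1 + l ^ 2) ^ (N : ℕ)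
  | 0 => ⟨1, 1, fun l => by
    have h : |Real.tanh (Real.pi * l)| ≤ 1 := (Real.abs_tanh_lt_one _).le
    rw [density, abs_mul, one_mul, pow_one]
    calc |l| * |Real.tanh (Real.pi * l)| ≤ |l| * 1 := by gcongr
      _ ≤ 1 + l ^ 2 := by nlinarith [sq_nonneg (|l| - 1), sq_abs l]⟩
  | 1 => ⟨1, 1, fun l => by rw [density, abs_of_nonneg (sq_nonneg l)]; linarith⟩
  | n + 2 => by
    obtain ⟨C, N, h⟩ := abs_density_le n
    refine ⟨(1 + rho (n + 2) ^ 2) * C, N + 1, fun l => ?_⟩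
    rw [density, abs_mul, abs_of_nonneg (by positivity)]
    have h1 : rho (n + 2) ^ 2 + l ^ 2 ≤ (1 + rho (n + 2) ^ 2) * (1 + l ^ 2) := by
      nlinarith [mul_nonneg (sq_nonneg (rho (n + 2))) (sq_nonneg l)]
    calc _ ≤ ((1 + rho (n + 2) ^ 2) * (1 + l ^ 2)) * (C * (1 + l ^ 2) ^ N) := by
          gcongr
          exact h l
      _ = _ := by ring

lemma density_mul_gaussian_le (n : ℕ) {b : ℝ} (hb : 0 < b) :
    ∃ C, ∀ l, |density n l| * Real.exp (-b * l ^ 2) ≤ C * Real.exp (-(b / 2) * l ^ 2) := by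
  obtain ⟨C, N, h⟩ := abs_density_le n
  have hC : 0 ≤ C := by simpa using (abs_nonneg _).trans (h 0)
  refine ⟨C * (N.factorial * (b / 2)⁻¹ ^ N * Real.exp (b / 2)), fun l => ?_⟩
  -- Half of the Gaussian absorbs the polynomial, through `x^N / N! ≤ e^x`.
  have h1 := Real.pow_div_factorial_le_exp (b / 2 * (1 + l ^ 2)) (by positivity) N
  have h2 : (1 + l ^ 2) ^ N ≤ N.factorial * (b / 2)⁻¹ ^ N * Real.exp (b / 2 * (1 + l ^ 2)) := by
    rw [div_le_iff₀ (by positivity), mul_pow] at h1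
    calc (1 + l ^ 2) ^ N = (b / 2)⁻¹ ^ N * ((b / 2) ^ N * (1 + l ^ 2) ^ N) := by
          rw [← mul_assoc, ← mul_pow, inv_mul_cancel₀ (by positivity), one_pow, one_mul]
      _ ≤ (b / 2)⁻¹ ^ N * (Real.exp (b / 2 * (1 + l ^ 2)) * N.factorial) := by gcongr
      _ = _ := by ring
  calc |density n l| * Real.exp (-b * l ^ 2)
      ≤ (C * (N.factorial * (b / 2)⁻¹ ^ N * Real.exp (b / 2 * (1 + l ^ 2)))) *
        Real.exp (-b * l ^ 2) := by
        gcongr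
        exact (h l).trans (by gcongr)
    _ = C * (N.factorial * (b / 2)⁻¹ ^ N) *
        (Real.exp (b / 2 * (1 + l ^ 2)) * Real.exp (-b * l ^ 2)) := by ring
    _ = C * (N.factorial * (b / 2)⁻¹ ^ N) *
        (Real.exp (b / 2) * Real.exp (-(b / 2) * l ^ 2)) := by
        rw [← Real.exp_add, ← Real.exp_add]
        ring_nf
    _ = _ := by ring

lemma norm_gamma_sq (s : ℂ) :
    ((‖Complex.Gamma s‖ ^ 2 : ℝ) : ℂ) = Complex.Gamma s * Complex.Gamma (starRingEnd ℂ s) := by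
  rw [Complex.Gamma_conj, Complex.mul_conj, Complex.normSq_eq_norm_sq]

/-- The reflection formula at `il`, with `Γ(1 - il) = -il Γ(-il)` and `Γ(-il)` the conjugate of
`Γ(il)`. -/
lemma norm_gamma_I_mul_sq {l : ℝ} (hl : l ≠ 0) :
    ‖Complex.Gamma (Complex.I * l)‖ ^ 2 = Real.pi / (l * Real.sinh (Real.pi * l)) := by
  have hs : Real.sinh (Real.pi * l) ≠ 0 := by
    rw [Ne, Real.sinh_eq_zero]
    exact mul_ne_zero Real.pi_ne_zero hl
  have hl' : (l : ℂ) ≠ 0 := Complex.ofReal_ne_zero.mpr hl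
  have hs' : Complex.sinh (Real.pi * l) ≠ 0 := by exact_mod_cast hs
  have h1 := Complex.Gamma_mul_Gamma_one_sub (Complex.I * l)
  rw [show (1 : ℂ) - Complex.I * l = -(Complex.I * l) + 1 by ring,
    Complex.Gamma_add_one _ (by simpa using hl), show (Real.pi : ℂ) * (Complex.I * l) =
      (Real.pi * l) * Complex.I by ring, Complex.sin_mul_I] at h1
  rw [← Complex.ofReal_inj, norm_gamma_sq]
  simp only [map_mul, Complex.conj_I, Complex.conj_ofReal, neg_mul]
  push_cast
  have h2 : (l : ℂ) * (Complex.Gamma (Complex.I * l) * Complex.Gamma (-(Complex.I * l))) *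
      Complex.sinh (Real.pi * l) = Real.pi := by
    rw [eq_div_iff (mul_ne_zero hs' Complex.I_ne_zero)] at h1
    linear_combination h1 + ((l : ℂ) * (Complex.Gamma (Complex.I * l) * Complex.Gamma (-(Complex.I * l))) *
      Complex.sinh (Real.pi * l)) * Complex.I_sq
  rw [eq_div_iff (mul_ne_zero hl' hs')]
  linear_combination h2

/-- On the line `Re s = 1/2` the reflection `1 - s` is the conjugate of `s`, so the reflection
formula gives the modulus. -/
lemma norm_gamma_half_add_sq (l : ℝ) :
    ‖Complex.Gamma ((1 / 2 : ℂ) + Complex.I * l)‖ ^ 2 = Real.pi / Real.cosh (Real.pi * l) := by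
  have h1 := Complex.Gamma_mul_Gamma_one_sub ((1 / 2 : ℂ) + Complex.I * l)
  rw [← Complex.ofReal_inj, norm_gamma_sq]
  have hc : starRingEnd ℂ ((1 / 2 : ℂ) + Complex.I * l) = 1 - ((1 / 2 : ℂ) + Complex.I * l) := by
    simp only [map_add, map_mul, map_div₀, map_one, map_ofNat, Complex.conj_I, Complex.conj_ofReal]
    ring
  rw [hc, h1]
  push_cast
  congr 1
  rw [show (Real.pi : ℂ) * (1 / 2 + Complex.I * l) = (Real.pi * l) * Complex.I + Real.pi / 2 by ring,
    Complex.sin_add_pi_div_two, Complex.cos_mul_I]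

/-- Raising the dimension by two raises `ρ` by one, and `Γ(s + 1) = s Γ(s)` at `s = ρ + il` gives
the factor `|s|² = ρ² + l²`. -/
lemma density_eq : ∀ (n : ℕ) (l : ℝ),
    (‖harishChandraC (n + 2) 1 l‖ ^ 2)⁻¹ = density n l
  | 0, l => by
    rcases eq_or_ne l 0 with rfl | hl
    -- The default values `Complex.Gamma 0 = 0` and `0⁻¹ = 0` realize the convention `|c(0)|⁻² = 0`.
    · simp [harishChandraC, density]
    have hr : ((rho (0 + 2) : ℝ) : ℂ) = 1 / 2 := by norm_num [rho]
    rw [harishChandraC, one_mul, norm_div, div_pow, hr, norm_gamma_I_mul_sq hl,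
      norm_gamma_half_add_sq, density, Real.tanh_eq_sinh_div_cosh]
    have hs : Real.sinh (Real.pi * l) ≠ 0 := by
      rw [Ne, Real.sinh_eq_zero]
      exact mul_ne_zero Real.pi_ne_zero hl
    have := (Real.cosh_pos (Real.pi * l)).ne'
    field_simp
  | 1, l => by
    rcases eq_or_ne l 0 with rfl | hl
    · simp [harishChandraC, density]
    have hr : ((rho (1 + 2) : ℝ) : ℂ) = 1 := by norm_num [rho]
    have h0 : Complex.I * (l : ℂ) ≠ 0 := by simpa using hl
    have hg : Complex.Gamma (Complex.I * l) ≠ 0 := by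
      intro h
      have := norm_gamma_I_mul_sq hl
      rw [h, norm_zero, zero_pow two_ne_zero, eq_comm, div_eq_zero_iff] at this
      rcases this with h | h
      · exact Real.pi_ne_zero h
      · rcases mul_eq_zero.mp h with h | h
        · exact hl h
        · rw [Real.sinh_eq_zero] at h
          exact mul_ne_zero Real.pi_ne_zero hl h
    have hg' : ‖Complex.Gamma (Complex.I * l)‖ ≠ 0 := norm_ne_zero_iff.mpr hg
    rw [harishChandraC, one_mul, hr, add_comm (1 : ℂ), Complex.Gamma_add_one _ h0, norm_div,
      norm_mul, norm_mul, Complex.norm_I, Complex.norm_real, Real.norm_eq_abs, density, one_mul]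
    have := abs_ne_zero.mpr hl
    field_simp
    exact sq_abs l
  | n + 2, l => by
    rw [density, ← density_eq n l]
    have hr : 0 < rho (n + 2) := by
      simp only [rho]
      push_cast
      have : (0 : ℝ) ≤ n := n.cast_nonneg
      linarith
    have h0 : (rho (n + 2) : ℂ) + Complex.I * l ≠ 0 := by
      intro h
      have := congrArg Complex.re h
      simp at this
      exact hr.ne' this
    have hn : ‖(rho (n + 2) : ℂ) + Complex.I * l‖ ^ 2 = rho (n + 2) ^ 2 + l ^ 2 := by
      rw [← Complex.normSq_eq_norm_sq, Complex.normSq_apply]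
      simp
      ring
    rw [harishChandraC, harishChandraC, one_mul, rho_add_two (n + 2),
      show ((rho (n + 2) + 1 : ℝ) : ℂ) + Complex.I * l = (rho (n + 2) + Complex.I * l) + 1 by
        push_cast; ring,
      Complex.Gamma_add_one _ h0, ← hn]
    simp only [norm_div, norm_mul, div_pow, mul_pow, inv_div]
    ring

/-! ### The kernel at complex time and its radial derivative -/

/-- The spectral parameter `ρ + i lam` in dimension `n + 2`. -/
def specParam (n : ℕ) (l : ℝ) : ℂ := rho (n + 2) + Complex.I * l

lemma specParam_add_two (n : ℕ) (l : ℝ) : specParam (n + 2) l = specParam n l + 1 := by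
  rw [specParam, specParam, rho_add_two (n + 2)]
  push_cast
  ring

lemma rho_nonneg (n : ℕ) : 0 ≤ rho (n + 2) := by
  simp only [rho]
  push_cast
  have : (0 : ℝ) ≤ n := n.cast_nonneg
  linarith

lemma specParam_re (n : ℕ) (l : ℝ) : (specParam n l).re = rho (n + 2) := by simp [specParam]

/-- A crude bound, growing with `r`: it serves only for integrability and for differentiating under
the integral, not for the final estimate. -/
lemma norm_sphericalAngle_le (n : ℕ) (σ : ℂ) (r : ℝ) :
    ‖sphericalAngle n σ r‖ ≤ Real.exp (|σ.re| * |r|) := by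
  have h : ‖∫ θ in 0..Real.pi, ((Real.sin θ ^ n : ℝ) : ℂ) * minkPow σ r θ‖ ≤
      ∫ θ in 0..Real.pi, Real.sin θ ^ n * Real.exp (|σ.re| * |r|) := by
    refine intervalIntegral.norm_integral_le_of_norm_le Real.pi_pos.le ?_ ?_
    · refine Eventually.of_forall fun θ hθ => ?_
      have : 0 ≤ Real.sin θ ^ n :=
        pow_nonneg (Real.sin_nonneg_of_nonneg_of_le_pi hθ.1.le hθ.2) n
      rw [norm_mul, Complex.norm_real, Real.norm_of_nonneg this]
      exact mul_le_mul_of_nonneg_left (norm_minkPow_le σ r θ) this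
    · exact Continuous.intervalIntegrable (by fun_prop) _ _
  rw [intervalIntegral.integral_mul_const] at h
  have hp := sinMass_pos n
  rw [sphericalAngle, norm_mul, norm_inv, Complex.norm_real, Real.norm_of_nonneg hp.le,
    inv_mul_le_iff₀ hp]
  exact h

lemma continuous_sphericalAngle (n : ℕ) :
    Continuous fun p : ℝ × ℝ => sphericalAngle n (specParam n p.1) p.2 := by
  unfold sphericalAngle
  refine continuous_const.mul ?_
  refine intervalIntegral.continuous_parametric_intervalIntegral_of_continuous'
    (f := fun (p : ℝ × ℝ) θ => ((Real.sin θ ^ n : ℝ) : ℂ) * minkPow (specParam n p.1) p.2 θ) ?_ 0 Real.pi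
  have h : Continuous fun q : (ℝ × ℝ) × ℝ => Real.log (minkAngle q.1.2 q.2) := by
    refine Continuous.log ?_ fun p => (minkAngle_pos _ _).ne'
    unfold minkAngle
    have := Real.continuous_cosh
    have := Real.continuous_sinh
    fun_prop
  simp only [minkPow, specParam, Function.uncurry_def]
  fun_prop

/-- The integrand of the kernel in dimension `n + 2`, at complex time `z`, for `κ = 1`. -/
def kernelFun (n : ℕ) (z : ℂ) (r l : ℝ) : ℂ :=
  Complex.exp (-z * (l : ℂ) ^ 2) * sphericalAngle n (specParam n l) r * (density n l : ℂ)

lemma kernelIntegrand_eq (n : ℕ) (κ : ℂ) (ε t r l : ℝ) :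
    kernelIntegrand (n + 2) κ ε t r l =
      ((‖κ‖ ^ 2)⁻¹ : ℝ) * kernelFun n (Complex.I * t + (ε : ℂ) ^ 2) r l := by
  have h : (‖harishChandraC (n + 2) κ l‖ ^ 2)⁻¹ = (‖κ‖ ^ 2)⁻¹ * density n l := by
    rw [← density_eq, harishChandraC, harishChandraC, one_mul, mul_div_assoc, norm_mul, mul_pow,
      mul_inv]
  rw [kernelIntegrand, kernelFun, h, sphericalRadial_eq, specParam]
  push_cast
  ring

lemma norm_cexp_neg_mul_sq (z : ℂ) (l : ℝ) :
    ‖Complex.exp (-z * (l : ℂ) ^ 2)‖ = Real.exp (-z.re * l ^ 2) := by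
  rw [Complex.norm_exp, ← Complex.ofReal_pow, Complex.re_mul_ofReal, Complex.neg_re]

lemma norm_kernelFun_le (n : ℕ) {z : ℂ} (hz : 0 < z.re) :
    ∃ C, 0 ≤ C ∧ ∀ r l, ‖kernelFun n z r l‖ ≤
      C * Real.exp (rho (n + 2) * |r|) * Real.exp (-(z.re / 2) * l ^ 2) := by
  obtain ⟨C, hC⟩ := density_mul_gaussian_le n hz
  have hC0 : 0 ≤ C := by
    have := (mul_nonneg (abs_nonneg _) (Real.exp_pos _).le).trans (hC 0)
    simpa using this
  refine ⟨C, hC0, fun r l => ?_⟩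
  have h1 := norm_sphericalAngle_le n (specParam n l) r
  rw [specParam_re, abs_of_nonneg (rho_nonneg n)] at h1
  rw [kernelFun, norm_mul, norm_mul, norm_cexp_neg_mul_sq, Complex.norm_real, Real.norm_eq_abs]
  calc _ = (|density n l| * Real.exp (-z.re * l ^ 2)) * ‖sphericalAngle n (specParam n l) r‖ := by
        ring
    _ ≤ (C * Real.exp (-(z.re / 2) * l ^ 2)) * Real.exp (rho (n + 2) * |r|) := by
        exact mul_le_mul (hC l) h1 (norm_nonneg _) ((by positivity : (0 : ℝ) ≤ _).trans (hC l))
    _ = _ := by ring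

lemma continuous_kernelFun (n : ℕ) (z : ℂ) :
    Continuous fun p : ℝ × ℝ => kernelFun n z p.2 p.1 := by
  have := continuous_sphericalAngle n
  have := continuous_density n
  unfold kernelFun
  fun_prop

lemma integrable_kernelFun (n : ℕ) {z : ℂ} (hz : 0 < z.re) (r : ℝ) :
    Integrable (kernelFun n z r) := by
  obtain ⟨C, -, hC⟩ := norm_kernelFun_le n hz
  refine Integrable.mono' (((integrable_exp_neg_mul_sq (half_pos hz))).const_mul
    (C * Real.exp (rho (n + 2) * |r|))) ?_ (Eventually.of_forall fun l => hC r l)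
  exact ((continuous_kernelFun n z).comp
    (by fun_prop : Continuous fun l : ℝ => (l, r))).aestronglyMeasurable

/-- The kernel in dimension `n + 2`, at complex time `z`, for `κ = 1`. -/
def kernel (n : ℕ) (z : ℂ) (r : ℝ) : ℂ := ∫ l, kernelFun n z r l

/-- Since `n + 1 = 2ρ`, the factor `σ (n + 1 - σ)` at `σ = ρ + il` equals `ρ² + l²`, exactly the
quotient of the densities of the two dimensions. -/
lemma hasDerivAt_kernelFun (n : ℕ) (z : ℂ) (r l : ℝ) :
    HasDerivAt (fun r => kernelFun n z r l)
      (-(Real.sinh r / (n + 2)) * kernelFun (n + 2) z r l) r := by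
  have h := (((hasDerivAt_sphericalAngle n (specParam n l) r).const_mul
    (Complex.exp (-z * (l : ℂ) ^ 2))).mul_const (density n l : ℂ))
  refine h.congr_deriv ?_
  have hs : specParam n l * (n + 1 - specParam n l) = ((rho (n + 2) ^ 2 + l ^ 2 : ℝ) : ℂ) := by
    have : (n + 1 : ℂ) = 2 * (rho (n + 2) : ℝ) := by
      simp only [rho]
      push_cast
      ring
    rw [this, specParam]
    push_cast
    linear_combination (-(l : ℂ) ^ 2) * Complex.I_sq
  rw [kernelFun, specParam_add_two, density, hs]
  push_cast
  ring

lemma hasDerivAt_kernel (n : ℕ) {z : ℂ} (hz : 0 < z.re) (r : ℝ) :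
    HasDerivAt (kernel n z) (-(Real.sinh r / (n + 2)) * kernel (n + 2) z r) r := by
  obtain ⟨C, hC0, hC⟩ := norm_kernelFun_le (n + 2) hz
  rw [kernel, ← integral_const_mul]
  refine (hasDerivAt_integral_of_dominated_loc_of_deriv_le (𝕜 := ℝ)
    (F := fun r l => kernelFun n z r l)
    (F' := fun r l => -(Real.sinh r / (n + 2)) * kernelFun (n + 2) z r l)
    (bound := fun l => Real.cosh (|r| + 1) * (C * Real.exp (rho (n + 2 + 2) * (|r| + 1))) *
      Real.exp (-(z.re / 2) * l ^ 2))
    (Metric.ball_mem_nhds r one_pos) ?_ (integrable_kernelFun n hz r) ?_ ?_ ?_ ?_).2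
  · exact Eventually.of_forall fun x => (integrable_kernelFun n hz x).aestronglyMeasurable
  · exact ((integrable_kernelFun (n + 2) hz r).const_mul _).aestronglyMeasurable
  · refine Eventually.of_forall fun l x hx => ?_
    have hx1 : |x| ≤ |r| + 1 := by
      have : |x - r| < 1 := by simpa [Real.dist_eq] using hx
      have := abs_sub_abs_le_abs_sub x r
      linarith
    have hcosh : Real.cosh x ≤ Real.cosh (|r| + 1) := by
      rw [Real.cosh_le_cosh, abs_of_nonneg (by positivity : 0 ≤ |r| + 1)]
      exact hx1
    have hsinh : ‖-((Real.sinh x : ℂ) / (n + 2))‖ ≤ Real.cosh (|r| + 1) := by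
      have h2 : ‖(n + 2 : ℂ)‖ = n + 2 := by exact_mod_cast Complex.norm_natCast (n + 2)
      rw [norm_neg, norm_div, h2, Complex.norm_real, Real.norm_eq_abs]
      have h3 : |Real.sinh x| ≤ Real.cosh x := by
        rw [abs_le]
        constructor <;> linarith [Real.sinh_lt_cosh x, Real.cosh_add_sinh x, Real.exp_pos x]
      have hn : (0 : ℝ) ≤ n := n.cast_nonneg
      exact (div_le_self (abs_nonneg _) (by linarith)).trans (h3.trans hcosh)
    rw [norm_mul, mul_assoc]
    have := rho_nonneg (n + 2)
    refine mul_le_mul hsinh ((hC x l).trans ?_) (norm_nonneg _) (Real.cosh_pos _).le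
    gcongr
  · exact (integrable_exp_neg_mul_sq (half_pos hz)).const_mul _
  · exact Eventually.of_forall fun l x _ => hasDerivAt_kernelFun n z x l

lemma continuous_kernel (n : ℕ) {z : ℂ} (hz : 0 < z.re) : Continuous (kernel n z) :=
  continuous_iff_continuousAt.mpr fun r => (hasDerivAt_kernel n hz r).continuousAt

/-! ### Dimension three -/

/-- The sine transform of a Gaussian of complex variance. -/
lemma integral_gaussian_mul_sin {z : ℂ} (hz : 0 < z.re) (s : ℝ) :
    ∫ l : ℝ, Complex.exp (-z * (l : ℂ) ^ 2) * (l * (Real.sin (l * s) : ℂ)) =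
      s / (2 * z) * ((Real.pi / z) ^ (1 / 2 : ℂ) * Complex.exp (-(s : ℂ) ^ 2 / (4 * z))) := by
  have hz0 : z ≠ 0 := by
    rintro rfl
    simp at hz
  have hnorm : ∀ (c l : ℝ), ‖Complex.exp (Complex.I * c * l)‖ = 1 := by
    intro c l
    rw [show Complex.I * (c : ℂ) * l = ((c * l : ℝ) : ℂ) * Complex.I by push_cast; ring]
    exact Complex.norm_exp_ofReal_mul_I _
  have hint1 : ∀ c : ℝ, Integrable fun l : ℝ =>
      Complex.exp (Complex.I * c * l) * Complex.exp (-z * (l : ℂ) ^ 2) := fun c =>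
    (integrable_cexp_neg_mul_sq hz).bdd_mul (c := 1) (by fun_prop)
      (Eventually.of_forall fun l => (hnorm c l).le)
  have hint2 : ∀ c : ℝ, Integrable fun l : ℝ =>
      Complex.exp (Complex.I * c * l) * ((l : ℂ) * Complex.exp (-z * (l : ℂ) ^ 2)) := fun c =>
    (integrable_mul_cexp_neg_mul_sq hz).bdd_mul (c := 1) (by fun_prop)
      (Eventually.of_forall fun l => (hnorm c l).le)
  -- The derivative of `e^{icl} e^{-zl²}` has integral zero, which expresses this first moment
  -- through the Fourier transform of the Gaussian.
  have key : ∀ c : ℝ, ∫ l : ℝ,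
      Complex.exp (Complex.I * c * l) * ((l : ℂ) * Complex.exp (-z * (l : ℂ) ^ 2)) =
      Complex.I * c / (2 * z) *
        ((Real.pi / z) ^ (1 / 2 : ℂ) * Complex.exp (-(c : ℂ) ^ 2 / (4 * z))) := by
    intro c
    have hderiv : ∀ l : ℝ, HasDerivAt
        (fun l : ℝ => Complex.exp (Complex.I * c * l) * Complex.exp (-z * (l : ℂ) ^ 2))
        (Complex.I * c * (Complex.exp (Complex.I * c * l) * Complex.exp (-z * (l : ℂ) ^ 2)) -
          2 * z * (Complex.exp (Complex.I * c * l) * ((l : ℂ) * Complex.exp (-z * (l : ℂ) ^ 2)))) l := by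
      intro l
      have h0 : HasDerivAt (fun l : ℝ => (l : ℂ)) 1 l := Complex.ofRealCLM.hasDerivAt
      have h1 := (h0.const_mul (Complex.I * c)).cexp.mul ((h0.pow 2).const_mul (-z)).cexp
      refine h1.congr_deriv ?_
      simp
      ring
    have h := integral_eq_zero_of_hasDerivAt_of_integrable hderiv
      (((hint1 c).const_mul _).sub ((hint2 c).const_mul _)) (hint1 c)
    rw [integral_sub ((hint1 c).const_mul _) ((hint2 c).const_mul _), integral_const_mul,
      integral_const_mul, fourierIntegral_gaussian hz, sub_eq_zero] at h
    rw [div_mul_eq_mul_div, eq_div_iff (by simpa using hz0)]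
    linear_combination -h
  have hrew : ∀ l : ℝ, Complex.exp (-z * (l : ℂ) ^ 2) * (l * (Real.sin (l * s) : ℂ)) =
      (1 / (2 * Complex.I)) * (Complex.exp (Complex.I * s * l) * ((l : ℂ) * Complex.exp (-z * (l : ℂ) ^ 2))) -
      (1 / (2 * Complex.I)) * (Complex.exp (Complex.I * (-s : ℝ) * l) * ((l : ℂ) * Complex.exp (-z * (l : ℂ) ^ 2))) := by
    intro l
    rw [Complex.ofReal_sin, Complex.sin]
    have hI := Complex.I_ne_zero
    have e1 : Complex.I * s * l = ((l * s : ℝ) : ℂ) * Complex.I := by push_cast; ring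
    have e2 : Complex.I * (-s : ℝ) * l = -((l * s : ℝ) : ℂ) * Complex.I := by push_cast; ring
    rw [e1, e2]
    field_simp
    rw [Complex.I_sq]
    ring
  simp_rw [hrew]
  rw [integral_sub ((hint2 s).const_mul _) ((hint2 (-s)).const_mul _), integral_const_mul,
    integral_const_mul, key, key]
  have hI := Complex.I_ne_zero
  push_cast
  rw [neg_sq]
  field_simp
  ring

lemma log_minkAngle_zero (r : ℝ) : Real.log (minkAngle r 0) = -r := by
  rw [minkAngle, Real.cos_zero, mul_one, Real.cosh_sub_sinh, Real.log_exp]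

lemma log_minkAngle_pi (r : ℝ) : Real.log (minkAngle r Real.pi) = r := by
  rw [minkAngle, Real.cos_pi, mul_neg_one, sub_neg_eq_add, Real.cosh_add_sinh, Real.log_exp]

/-- With the weight `sin θ` the integrand is, up to a constant, the exact derivative of `minkPow
(il) r θ`, whose values at `0` and `π` are `e^{ilr}` and `e^{-ilr}`. -/
lemma sphericalAngle_one {r l : ℝ} (hr : 0 < r) (hl : l ≠ 0) :
    sphericalAngle 1 (specParam 1 l) r = Real.sin (l * r) / (l * Real.sinh r) := by
  have hs : Real.sinh r ≠ 0 := (Real.sinh_pos_iff.mpr hr).ne'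
  have hs' : (Real.sinh r : ℂ) ≠ 0 := Complex.ofReal_ne_zero.mpr hs
  have hl' : (l : ℂ) ≠ 0 := Complex.ofReal_ne_zero.mpr hl
  have hσ : specParam 1 l = Complex.I * l + 1 := by
    rw [specParam, show rho (1 + 2) = 1 by norm_num [rho]]
    push_cast
    ring
  have hmass : sinMass 1 = 2 := by
    simp only [sinMass, pow_one, integral_sin, Real.cos_zero, Real.cos_pi]
    norm_num
  have hFTC : ∫ θ in 0..Real.pi, (-(Complex.I * l)) * minkPow (Complex.I * l + 1) r θ *
      ((Real.sinh r * Real.sin θ : ℝ) : ℂ) =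
      minkPow (Complex.I * l) r Real.pi - minkPow (Complex.I * l) r 0 := by
    refine intervalIntegral.integral_eq_sub_of_hasDerivAt
      (fun θ _ => hasDerivAt_minkPow_angle (Complex.I * l) r θ) ?_
    have hc := (continuous_minkPow (Complex.I * l + 1)).comp
      (by fun_prop : Continuous fun θ : ℝ => (r, θ))
    simp only [Function.comp_def] at hc
    exact Continuous.intervalIntegrable (by fun_prop) _ _
  have h2 : ∫ θ in 0..Real.pi, (-(Complex.I * l)) * minkPow (Complex.I * l + 1) r θ *
      ((Real.sinh r * Real.sin θ : ℝ) : ℂ) = -(Complex.I * l) * Real.sinh r *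
      ∫ θ in 0..Real.pi, ((Real.sin θ ^ 1 : ℝ) : ℂ) * minkPow (Complex.I * l + 1) r θ := by
    rw [← intervalIntegral.integral_const_mul]
    refine intervalIntegral.integral_congr fun θ _ => ?_
    push_cast
    ring
  rw [h2] at hFTC
  have h3 : minkPow (Complex.I * l) r Real.pi - minkPow (Complex.I * l) r 0 =
      -2 * Complex.I * Real.sin (l * r) := by
    rw [minkPow, minkPow, log_minkAngle_pi, log_minkAngle_zero, Complex.ofReal_sin, Complex.sin,
      show -(Complex.I * (l : ℂ)) * (r : ℝ) = -((l * r : ℝ) : ℂ) * Complex.I by push_cast; ring,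
      show -(Complex.I * (l : ℂ)) * (-r : ℝ) = ((l * r : ℝ) : ℂ) * Complex.I by push_cast; ring]
    linear_combination (Complex.exp (-((l * r : ℝ) : ℂ) * Complex.I) -
      Complex.exp (((l * r : ℝ) : ℂ) * Complex.I)) * Complex.I_sq
  rw [h3] at hFTC
  rw [sphericalAngle, hσ, hmass, eq_div_iff (mul_ne_zero hl' hs')]
  have hI := Complex.I_ne_zero
  refine mul_left_cancel₀ (mul_ne_zero (by norm_num : (-2 : ℂ) ≠ 0) hI) ?_
  push_cast at hFTC ⊢
  rw [← hFTC]
  ring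

lemma kernel_one {z : ℂ} (hz : 0 < z.re) {r : ℝ} (hr : 0 < r) :
    kernel 1 z r = (Real.sinh r : ℂ)⁻¹ *
      (r / (2 * z) * ((Real.pi / z) ^ (1 / 2 : ℂ) * Complex.exp (-(r : ℂ) ^ 2 / (4 * z)))) := by
  have hs : (Real.sinh r : ℂ) ≠ 0 :=
    Complex.ofReal_ne_zero.mpr (Real.sinh_pos_iff.mpr hr).ne'
  rw [kernel, ← integral_gaussian_mul_sin hz, ← integral_const_mul]
  refine integral_congr_ae (Eventually.of_forall fun l => ?_)
  simp only [kernelFun, density]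
  rcases eq_or_ne l 0 with rfl | hl
  · simp
  have hl' : (l : ℂ) ≠ 0 := Complex.ofReal_ne_zero.mpr hl
  rw [sphericalAngle_one hr hl]
  push_cast
  field_simp

/-! ### Dimension two: the contour integral -/

/-- Both factors matter for the power `-1/2`: the linear one controls the singularity at `0`, the
exponential one the decay at infinity. -/
lemma abs_sinh_ge (x : ℝ) : |x| / 2 * Real.exp (|x| / 2) ≤ |Real.sinh x| := by
  rw [Real.abs_sinh]
  have h0 : 0 ≤ |x| := abs_nonneg x
  have h1 : |x| / 2 ≤ Real.sinh (|x| / 2) := Real.self_le_sinh_iff.mpr (by positivity)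
  have h2 : Real.exp (|x| / 2) ≤ 2 * Real.cosh (|x| / 2) := by
    rw [Real.cosh_eq]
    linarith [Real.exp_pos (-(|x| / 2))]
  have h3 : Real.sinh |x| = 2 * Real.sinh (|x| / 2) * Real.cosh (|x| / 2) := by
    rw [← Real.sinh_two_mul]
    ring_nf
  rw [h3]
  calc _ ≤ Real.sinh (|x| / 2) * (2 * Real.cosh (|x| / 2)) := by gcongr
    _ = _ := by ring

lemma abs_sinh_rpow_le (x : ℝ) :
    |Real.sinh x| ^ (-(1 / 2) : ℝ) ≤ (|x| / 2 * Real.exp (|x| / 2)) ^ (-(1 / 2) : ℝ) := by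
  rcases eq_or_ne x 0 with rfl | hx
  · simp
  · exact Real.rpow_le_rpow_of_nonpos (by positivity) (abs_sinh_ge x) (by norm_num)

lemma integrable_abs_sinh_rpow : Integrable fun x : ℝ => |Real.sinh x| ^ (-(1 / 2) : ℝ) := by
  have hm : Measurable fun x : ℝ => |Real.sinh x| ^ (-(1 / 2) : ℝ) := by
    have := Real.measurable_sinh
    fun_prop
  have h1 : IntegrableOn (fun x : ℝ => |Real.sinh x| ^ (-(1 / 2) : ℝ)) (Ioi 0) := by
    have h := (integrableOn_rpow_mul_exp_neg_mul_rpow (p := 1) (s := -(1 / 2)) (b := 1 / 4)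
      (by norm_num) one_pos (by norm_num)).const_mul ((1 / 2 : ℝ) ^ (-(1 / 2) : ℝ))
    refine Integrable.mono' h hm.aestronglyMeasurable ?_
    refine (ae_restrict_iff' measurableSet_Ioi).mpr (Eventually.of_forall fun x hx => ?_)
    have hx' : 0 < x := hx
    rw [Real.norm_of_nonneg (by positivity)]
    refine (abs_sinh_rpow_le x).trans (le_of_eq ?_)
    rw [abs_of_pos hx', Real.mul_rpow (by positivity) (by positivity), ← Real.exp_mul,
      div_eq_mul_one_div, Real.mul_rpow hx'.le (by norm_num), Real.rpow_one]
    ring_nf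
  have h2 : IntegrableOn (fun x : ℝ => |Real.sinh x| ^ (-(1 / 2) : ℝ)) (Iic 0) := by
    have h := (integrableOn_Ici_iff_integrableOn_Ioi enorm_ne_top).mpr h1
    rw [← neg_zero] at h
    simpa using h.comp_neg_Iic
  rw [← integrableOn_univ, ← Iic_union_Ioi (a := (0 : ℝ))]
  exact h2.union h1

/-- `(|cosh x - cosh r| / 2)^{-1/2}`, in factored form. -/
def gapWeight (r x : ℝ) : ℝ :=
  |Real.sinh ((x - r) / 2)| ^ (-(1 / 2) : ℝ) * |Real.sinh ((x + r) / 2)| ^ (-(1 / 2) : ℝ)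

lemma sinh_half_mul_sinh_half (r x : ℝ) :
    Real.sinh ((x - r) / 2) * Real.sinh ((x + r) / 2) = (Real.cosh x - Real.cosh r) / 2 := by
  have h1 := Real.cosh_add ((x + r) / 2) ((x - r) / 2)
  have h2 := Real.cosh_sub ((x + r) / 2) ((x - r) / 2)
  rw [show (x + r) / 2 + (x - r) / 2 = x by ring] at h1
  rw [show (x + r) / 2 - (x - r) / 2 = r by ring] at h2
  linarith

lemma gapWeight_eq (r x : ℝ) :
    gapWeight r x = (|Real.cosh x - Real.cosh r| / 2) ^ (-(1 / 2) : ℝ) := by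
  rw [gapWeight, ← Real.mul_rpow (abs_nonneg _) (abs_nonneg _), ← abs_mul,
    sinh_half_mul_sinh_half, abs_div, abs_two]

lemma gapWeight_nonneg (r x : ℝ) : 0 ≤ gapWeight r x := by
  unfold gapWeight
  positivity

lemma measurable_gapWeight (r : ℝ) : Measurable (gapWeight r) := by
  have := Real.measurable_sinh
  unfold gapWeight
  fun_prop

lemma gapWeight_neg (r x : ℝ) : gapWeight r (-x) = gapWeight r x := by
  rw [gapWeight_eq, gapWeight_eq, Real.cosh_neg]

/-- The singularities `r` and `-r` are distinct: on each half line one factor is at most `sinh (r /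
2) ^ (-1/2)`, and the other is integrable. -/
lemma integrable_gapWeight {r : ℝ} (hr : 0 < r) : Integrable (gapWeight r) := by
  have hs : 0 < Real.sinh (r / 2) := Real.sinh_pos_iff.mpr (by linarith)
  have e1 : Integrable fun x : ℝ => |Real.sinh ((x - r) / 2)| ^ (-(1 / 2) : ℝ) :=
    (integrable_abs_sinh_rpow.comp_div two_ne_zero).comp_sub_right r
  have e2 : Integrable fun x : ℝ => |Real.sinh ((x + r) / 2)| ^ (-(1 / 2) : ℝ) :=
    (integrable_abs_sinh_rpow.comp_div two_ne_zero).comp_add_right r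
  refine Integrable.mono' ((e1.add e2).const_mul (Real.sinh (r / 2) ^ (-(1 / 2) : ℝ)))
    (measurable_gapWeight r).aestronglyMeasurable (Eventually.of_forall fun x => ?_)
  rw [Real.norm_of_nonneg (gapWeight_nonneg r x), gapWeight]
  set a := |Real.sinh ((x - r) / 2)| ^ (-(1 / 2) : ℝ) with ha
  set b := |Real.sinh ((x + r) / 2)| ^ (-(1 / 2) : ℝ) with hb
  have ha0 : 0 ≤ a := by positivity
  have hb0 : 0 ≤ b := by positivity
  have hcase : ∀ y : ℝ, r / 2 ≤ |y| → |Real.sinh y| ^ (-(1 / 2) : ℝ) ≤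
      Real.sinh (r / 2) ^ (-(1 / 2) : ℝ) := by
    intro y hy
    refine Real.rpow_le_rpow_of_nonpos hs ?_ (by norm_num)
    rw [Real.abs_sinh]
    exact Real.sinh_le_sinh.mpr hy
  set c := Real.sinh (r / 2) ^ (-(1 / 2) : ℝ) with hc
  have hc0 : 0 ≤ c := by positivity
  simp only [Pi.add_apply]
  rcases le_total 0 x with h | h
  · have : b ≤ c := hcase _ (by rw [abs_of_nonneg (by linarith)]; linarith)
    nlinarith [mul_le_mul_of_nonneg_left this ha0, mul_nonneg hc0 hb0]
  · have : a ≤ c := hcase _ (by rw [abs_of_nonpos (by linarith)]; linarith)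
    nlinarith [mul_le_mul_of_nonneg_right this hb0, mul_nonneg hc0 ha0]

lemma tendsto_gapWeight (r : ℝ) : Tendsto (gapWeight r) atTop (𝓝 0) := by
  simp_rw [funext (gapWeight_eq r)]
  refine (tendsto_rpow_neg_atTop (by norm_num : (0 : ℝ) < 1 / 2)).comp ?_
  refine Tendsto.atTop_div_const two_pos ?_
  refine tendsto_abs_atTop_atTop.comp (tendsto_atTop_add_const_right _ _ ?_)
  refine tendsto_atTop_mono (fun x => ?_) (Real.tendsto_exp_atTop.atTop_div_const two_pos)
  rw [Real.cosh_eq]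
  linarith [Real.exp_pos (-x)]

lemma neg_I_mul_sinh (a b : ℝ) :
    -Complex.I * Complex.sinh (a + b * Complex.I) =
      ((Real.cosh a * Real.sin b : ℝ) : ℂ) + ((-(Real.sinh a * Real.cos b) : ℝ) : ℂ) * Complex.I := by
  rw [Complex.sinh_add, Complex.cosh_mul_I, Complex.sinh_mul_I]
  push_cast
  linear_combination (-Complex.cosh a * Complex.sin b) * Complex.I_sq

/-- In fact `|sinh (a + ib)|² = sinh² a + sin² b`. Hence negative powers on a horizontal line are
dominated by those on the real line, at every height. -/
lemma abs_sinh_le_norm (a b : ℝ) :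
    |Real.sinh a| ≤ ‖-Complex.I * Complex.sinh (a + b * Complex.I)‖ := by
  rw [neg_I_mul_sinh, Complex.norm_add_mul_I]
  refine Real.abs_le_sqrt ?_
  nlinarith [Real.sin_sq_add_cos_sq b, Real.cosh_sq a, sq_nonneg (Real.sin b), mul_pow (Real.sinh a) (Real.cos b) 2]

/-- `(-i sinh ((w - c) / 2))^{-1/2}`, holomorphic on the strip `0 < Im w < 2π`. -/
def rootSinh (c : ℝ) (w : ℂ) : ℂ :=
  (-Complex.I * Complex.sinh ((w - c) / 2)) ^ ((-(1 / 2) : ℝ) : ℂ)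

lemma half_sub (c x y : ℝ) : ((x + y * Complex.I - c) / 2 : ℂ) =
    (((x - c) / 2 : ℝ) : ℂ) + ((y / 2 : ℝ) : ℂ) * Complex.I := by
  push_cast
  ring

/-- The factor `-i` maps the open strip into the right half plane: the real part is `cosh ((x - c) /
2) sin (y / 2)`. On the boundary lines the value is imaginary, and nonzero away from the branch
point, so the principal power stays continuous there. -/
lemma mem_slitPlane_of_strip {c x y : ℝ} (h : 0 < Real.sin (y / 2) ∨ x ≠ c ∧ Real.cos (y / 2) ≠ 0) :
    -Complex.I * Complex.sinh ((x + y * Complex.I - c) / 2) ∈ Complex.slitPlane := by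
  have hmem : ∀ A B : ℝ, 0 < A ∨ B ≠ 0 → (A : ℂ) + B * Complex.I ∈ Complex.slitPlane := by
    intro A B hAB
    rw [Complex.mem_slitPlane_iff]
    simpa using hAB
  rw [half_sub, neg_I_mul_sinh]
  refine hmem _ _ (h.imp (fun h => mul_pos (Real.cosh_pos _) h) fun h => ?_)
  have : Real.sinh ((x - c) / 2) ≠ 0 := by
    rw [Ne, Real.sinh_eq_zero]
    intro h0
    exact h.1 (by linarith)
  exact neg_ne_zero.mpr (mul_ne_zero this h.2)

lemma differentiableAt_rootSinh {c x y : ℝ}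
    (h : 0 < Real.sin (y / 2) ∨ x ≠ c ∧ Real.cos (y / 2) ≠ 0) :
    DifferentiableAt ℂ (rootSinh c) (x + y * Complex.I) := by
  unfold rootSinh
  refine DifferentiableAt.cpow_const ?_ (mem_slitPlane_of_strip h)
  fun_prop

lemma norm_rootSinh_le {c x : ℝ} (y : ℝ) (h : x ≠ c) :
    ‖rootSinh c (x + y * Complex.I)‖ ≤ |Real.sinh ((x - c) / 2)| ^ (-(1 / 2) : ℝ) := by
  rw [rootSinh, Complex.norm_cpow_real, half_sub]
  refine Real.rpow_le_rpow_of_nonpos (abs_pos.mpr ?_) (abs_sinh_le_norm _ _) (by norm_num)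
  rw [Ne, Real.sinh_eq_zero]
  intro h0
  exact h (by linarith)

/-- The integrand of the contour integral. -/
def contourFun (l r : ℝ) (w : ℂ) : ℂ :=
  Complex.exp (Complex.I * l * w) * (rootSinh r w * rootSinh (-r) w)

lemma differentiableAt_contourFun {l r x y : ℝ}
    (h : 0 < Real.sin (y / 2) ∨ (x ≠ r ∧ x ≠ -r) ∧ Real.cos (y / 2) ≠ 0) :
    DifferentiableAt ℂ (contourFun l r) (x + y * Complex.I) := by
  unfold contourFun
  refine DifferentiableAt.mul (by fun_prop) (DifferentiableAt.mul ?_ ?_)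
  · exact differentiableAt_rootSinh (h.imp_right fun h => ⟨h.1.1, h.2⟩)
  · exact differentiableAt_rootSinh (h.imp_right fun h => ⟨h.1.2, h.2⟩)

lemma norm_contourFun_le {l r x y : ℝ} (hx : x ≠ r) (hx' : x ≠ -r) (hy : y ∈ Icc 0 (2 * Real.pi)) :
    ‖contourFun l r (x + y * Complex.I)‖ ≤ Real.exp (2 * Real.pi * |l|) * gapWeight r x := by
  rw [contourFun, norm_mul, norm_mul, gapWeight]
  refine mul_le_mul ?_ (mul_le_mul (norm_rootSinh_le y hx) ?_ (norm_nonneg _) (by positivity))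
    (by positivity) (by positivity)
  · rw [Complex.norm_exp, Real.exp_le_exp]
    have : (Complex.I * l * (x + y * Complex.I)).re = -(l * y) := by simp
    rw [this]
    calc -(l * y) ≤ |l * y| := neg_le_abs _
      _ = |l| * y := by rw [abs_mul, abs_of_nonneg hy.1]
      _ ≤ |l| * (2 * Real.pi) := by gcongr; exact hy.2
      _ = _ := by ring
  · simpa using norm_rootSinh_le y hx'

lemma ae_ne_and_ne (r : ℝ) : ∀ᵐ x : ℝ, x ≠ r ∧ x ≠ -r :=
  (Measure.ae_ne volume r).and (Measure.ae_ne volume (-r))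

/-- Dominated convergence lets the height tend to a boundary line while the truncation grows:
`gapWeight` dominates at all heights, and the hypothesis on the cosine gives continuity up to that
line for almost every `x`. -/
lemma tendsto_integral_contourFun {r : ℝ} (hr : 0 < r) (l : ℝ) {y : ℕ → ℝ} {y₀ : ℝ}
    (hy : ∀ n, y n ∈ Ioo 0 (2 * Real.pi)) (hlim : Tendsto y atTop (𝓝 y₀))
    (hc : Real.cos (y₀ / 2) ≠ 0) :
    Tendsto (fun n : ℕ => ∫ x in (-(n : ℝ))..n, contourFun l r (x + y n * Complex.I)) atTop
      (𝓝 (∫ x : ℝ, contourFun l r (x + y₀ * Complex.I))) := by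
  have hcont : ∀ n, Continuous fun x : ℝ => contourFun l r (x + y n * Complex.I) := by
    intro n
    rw [continuous_iff_continuousAt]
    intro x
    have hs : 0 < Real.sin (y n / 2) := Real.sin_pos_of_pos_of_lt_pi (by linarith [(hy n).1])
      (by linarith [(hy n).2])
    have h1 : ContinuousAt (contourFun l r) (x + y n * Complex.I) :=
      (differentiableAt_contourFun (Or.inl hs)).continuousAt
    exact ContinuousAt.comp (f := fun x : ℝ => (x + y n * Complex.I : ℂ)) h1 (by fun_prop)
  have heq : ∀ n : ℕ, ∫ x in (-(n : ℝ))..n, contourFun l r (x + y n * Complex.I) =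
      ∫ x, (Ioc (-(n : ℝ)) n).indicator (fun x : ℝ => contourFun l r (x + y n * Complex.I)) x := by
    intro n
    rw [integral_indicator measurableSet_Ioc, intervalIntegral.integral_of_le]
    have : (0 : ℝ) ≤ n := n.cast_nonneg
    linarith
  simp_rw [heq]
  refine tendsto_integral_of_dominated_convergence
    (fun x => Real.exp (2 * Real.pi * |l|) * gapWeight r x) ?_
    ((integrable_gapWeight hr).const_mul _) ?_ ?_
  · exact fun n => ((hcont n).stronglyMeasurable.indicator measurableSet_Ioc).aestronglyMeasurable
  · intro n
    filter_upwards [ae_ne_and_ne r] with x hx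
    exact (norm_indicator_le_norm_self _ _).trans
      (norm_contourFun_le hx.1 hx.2 ⟨(hy n).1.le, (hy n).2.le⟩)
  · filter_upwards [ae_ne_and_ne r] with x hx
    have h1 : ContinuousAt (contourFun l r) (x + y₀ * Complex.I) :=
      (differentiableAt_contourFun (Or.inr ⟨hx, hc⟩)).continuousAt
    have h2 : Tendsto (fun n => (x + y n * Complex.I : ℂ)) atTop (𝓝 (x + y₀ * Complex.I)) :=
      ((Complex.continuous_ofReal.tendsto _).comp hlim).mul_const _ |>.const_add _
    refine (h1.tendsto.comp h2).congr' ?_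
    obtain ⟨N, hN⟩ := exists_nat_gt |x|
    filter_upwards [eventually_ge_atTop N] with n hn
    have hn' : |x| < n := hN.trans_le (by exact_mod_cast hn)
    rw [indicator_of_mem]
    · rfl
    · exact ⟨(abs_lt.mp hn').1, (abs_lt.mp hn').2.le⟩

/-- Cauchy's theorem on the strip `0 < Im w < 2π`. -/
lemma integral_contourFun_bottom_eq_top {r : ℝ} (hr : 0 < r) (l : ℝ) :
    ∫ x : ℝ, contourFun l r (x + (0 : ℝ) * Complex.I) =
      ∫ x : ℝ, contourFun l r (x + (2 * Real.pi : ℝ) * Complex.I) := by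
  -- Cauchy's theorem is applied to `[-n, n] × [δ n, 2π - δ n]`, which avoids the branch points on
  -- the two boundary lines; the vertical sides vanish in the limit since `gapWeight r n → 0`.
  set δ : ℕ → ℝ := fun n => 1 / ((n : ℝ) + 1) with hδ
  have hπ := Real.pi_gt_three
  have hδ0 : ∀ n, 0 < δ n := fun n => by positivity
  have hδ1 : ∀ n, δ n ≤ 1 := fun n => by
    rw [hδ]
    exact (div_le_one (by positivity)).mpr (by linarith [(n.cast_nonneg : (0 : ℝ) ≤ n)])
  have hδlim : Tendsto δ atTop (𝓝 0) := tendsto_one_div_add_atTop_nhds_zero_nat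
  have hbot := tendsto_integral_contourFun hr l (y := δ)
    (fun n => ⟨hδ0 n, by linarith [hδ1 n]⟩) hδlim (by simp)
  have htop := tendsto_integral_contourFun hr l (y := fun n => 2 * Real.pi - δ n)
    (y₀ := 2 * Real.pi) (fun n => ⟨by linarith [hδ1 n], by linarith [hδ0 n]⟩)
    (by simpa using hδlim.const_sub (2 * Real.pi)) (by
      rw [mul_div_cancel_left₀ _ two_ne_zero, Real.cos_pi]; norm_num)
  have hside : ∀ τ : ℝ, |τ| = 1 → Tendsto (fun n : ℕ => ∫ y in δ n..(2 * Real.pi - δ n),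
      contourFun l r ((τ * n : ℝ) + y * Complex.I)) atTop (𝓝 0) := by
    intro τ hτ
    have hlim : Tendsto (fun n : ℕ => Real.exp (2 * Real.pi * |l|) * gapWeight r n *
        (2 * Real.pi)) atTop (𝓝 0) := by
      have := (((tendsto_gapWeight r).comp tendsto_natCast_atTop_atTop).const_mul
        (Real.exp (2 * Real.pi * |l|))).mul_const (2 * Real.pi)
      simpa using this
    refine squeeze_zero_norm' ?_ hlim
    obtain ⟨N, hN⟩ := exists_nat_gt r
    filter_upwards [eventually_ge_atTop N] with n hn
    have hn' : r < n := hN.trans_le (by exact_mod_cast hn)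
    have habs : |τ * n| = n := by rw [abs_mul, hτ, one_mul, abs_of_nonneg n.cast_nonneg]
    have hne1 : τ * n ≠ r := by
      intro h
      rw [h, abs_of_pos hr] at habs
      linarith
    have hne2 : τ * n ≠ -r := by
      intro h
      rw [h, abs_neg, abs_of_pos hr] at habs
      linarith
    have hgap : gapWeight r (τ * n) = gapWeight r n := by
      rw [gapWeight_eq, gapWeight_eq, ← Real.cosh_abs, habs]
    refine (intervalIntegral.norm_integral_le_of_norm_le_const
      (C := Real.exp (2 * Real.pi * |l|) * gapWeight r n) fun y hy => ?_).trans ?_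
    · rw [uIoc_of_le (by linarith [hδ1 n])] at hy
      rw [← hgap]
      exact norm_contourFun_le hne1 hne2 ⟨by linarith [hy.1, hδ0 n], by linarith [hy.2, hδ0 n]⟩
    · have := gapWeight_nonneg r n
      refine mul_le_mul_of_nonneg_left ?_ (by positivity)
      rw [abs_of_nonneg (by linarith [hδ1 n])]
      linarith [hδ0 n]
  have hrect : ∀ n : ℕ,
      (∫ x in (-(n : ℝ))..n, contourFun l r (x + δ n * Complex.I)) -
      (∫ x in (-(n : ℝ))..n, contourFun l r (x + (2 * Real.pi - δ n : ℝ) * Complex.I)) +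
      Complex.I * (∫ y in δ n..(2 * Real.pi - δ n), contourFun l r ((1 * n : ℝ) + y * Complex.I)) -
      Complex.I * (∫ y in δ n..(2 * Real.pi - δ n),
        contourFun l r ((-1 * n : ℝ) + y * Complex.I)) = 0 := by
    intro n
    have h := Complex.integral_boundary_rect_eq_zero_of_differentiableOn (contourFun l r)
      ⟨-(n : ℝ), δ n⟩ ⟨n, 2 * Real.pi - δ n⟩ ?_
    · simpa using h
    · intro w hw
      have him := hw.2
      simp only [mem_preimage] at him
      rw [uIcc_of_le (by linarith [hδ1 n])] at him
      rw [← Complex.re_add_im w]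
      refine (differentiableAt_contourFun (Or.inl ?_)).differentiableWithinAt
      exact Real.sin_pos_of_pos_of_lt_pi (by linarith [him.1, hδ0 n]) (by linarith [him.2, hδ0 n])
  have hlim := ((hbot.sub htop).add ((hside 1 (by simp)).const_mul Complex.I)).sub
    ((hside (-1) (by simp)).const_mul Complex.I)
  have h0 := tendsto_nhds_unique hlim ((tendsto_const_nhds (x := (0 : ℂ))).congr
    fun n => (hrect n).symm)
  simp only [mul_zero, add_zero, sub_zero] at h0
  exact sub_eq_zero.mp h0

lemma neg_I_mul_cpow {t : ℝ} (ht : 0 < t) :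
    (-Complex.I * t) ^ ((-(1 / 2) : ℝ) : ℂ) =
      (t ^ (-(1 / 2) : ℝ) : ℝ) * Complex.exp (Real.pi / 4 * Complex.I) := by
  have h0 : -Complex.I * (t : ℂ) ≠ 0 := by simp [ht.ne']
  rw [Complex.cpow_def_of_ne_zero h0, mul_comm (-Complex.I),
    Complex.log_ofReal_mul ht (by simp), Complex.log_neg_I, Real.rpow_def_of_pos ht,
    Complex.ofReal_exp, ← Complex.exp_add]
  congr 1
  push_cast
  ring

lemma I_mul_cpow {t : ℝ} (ht : 0 < t) :
    (Complex.I * t) ^ ((-(1 / 2) : ℝ) : ℂ) =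
      (t ^ (-(1 / 2) : ℝ) : ℝ) * Complex.exp (-(Real.pi / 4 * Complex.I)) := by
  have h0 : Complex.I * (t : ℂ) ≠ 0 := by simp [ht.ne']
  rw [Complex.cpow_def_of_ne_zero h0, mul_comm Complex.I,
    Complex.log_ofReal_mul ht (by simp), Complex.log_I, Real.rpow_def_of_pos ht,
    Complex.ofReal_exp, ← Complex.exp_add]
  congr 1
  push_cast
  ring

/-- The boundary values of `rootSinh`: `τ = 1` on the bottom side, `τ = -1` on the top side. -/
lemma rootSinh_boundary {c x y τ : ℝ} (hx : x ≠ c) (hs : Real.sin (y / 2) = 0)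
    (hc : Real.cos (y / 2) = τ) (hτ : τ = 1 ∨ τ = -1) :
    rootSinh c (x + y * Complex.I) = (|Real.sinh ((x - c) / 2)| ^ (-(1 / 2) : ℝ) : ℝ) *
      Complex.exp ((τ * SignType.sign (x - c) : ℝ) * (Real.pi / 4 * Complex.I)) := by
  rw [rootSinh, half_sub, neg_I_mul_sinh, hs, hc]
  have hrw : ((Real.cosh ((x - c) / 2) * 0 : ℝ) : ℂ) +
      ((-(Real.sinh ((x - c) / 2) * τ) : ℝ) : ℂ) * Complex.I =
      -Complex.I * ((τ * Real.sinh ((x - c) / 2) : ℝ) : ℂ) := by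
    push_cast
    ring
  rw [hrw]
  rcases lt_or_gt_of_ne hx with h | h
  · have hneg : Real.sinh ((x - c) / 2) < 0 := Real.sinh_neg_iff.mpr (by linarith)
    rw [sign_neg (sub_neg.mpr h), abs_of_neg hneg]
    rcases hτ with rfl | rfl
    · rw [show -Complex.I * ((1 * Real.sinh ((x - c) / 2) : ℝ) : ℂ) =
        Complex.I * ((-Real.sinh ((x - c) / 2) : ℝ) : ℂ) by push_cast; ring,
        I_mul_cpow (by linarith)]
      simp
    · rw [show (-1 * Real.sinh ((x - c) / 2) : ℝ) = -Real.sinh ((x - c) / 2) by ring,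
        neg_I_mul_cpow (by linarith)]
      simp
  · have hpos : 0 < Real.sinh ((x - c) / 2) := Real.sinh_pos_iff.mpr (by linarith)
    rw [sign_pos (sub_pos.mpr h), abs_of_pos hpos]
    rcases hτ with rfl | rfl
    · rw [one_mul, neg_I_mul_cpow hpos]
      simp
    · rw [show -Complex.I * ((-1 * Real.sinh ((x - c) / 2) : ℝ) : ℂ) =
        Complex.I * ((Real.sinh ((x - c) / 2) : ℝ) : ℂ) by push_cast; ring, I_mul_cpow hpos]
      simp

/-- The phases `e^{±iπ/4}` of the two roots cancel for `|x| < r` and combine to `±i` for `|x| > r`.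
Adding the values at `x` and `-x` thus yields a cosine inside and a sine outside, and `e^{-ly}`
compares the two lines. -/
lemma contourFun_boundary {l r x y τ : ℝ} (hx : x ≠ r) (hx' : x ≠ -r)
    (hs : Real.sin (y / 2) = 0) (hc : Real.cos (y / 2) = τ) (hτ : τ = 1 ∨ τ = -1) :
    contourFun l r (x + y * Complex.I) = Complex.exp (-(l * y)) *
      (Complex.exp (Complex.I * (l * x)) * (gapWeight r x * Complex.exp
        ((τ * (SignType.sign (x - r) + SignType.sign (x + r)) : ℝ) * (Real.pi / 4 * Complex.I)))) := by
  rw [contourFun, rootSinh_boundary hx hs hc hτ, rootSinh_boundary hx' hs hc hτ, gapWeight,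
    sub_neg_eq_add]
  have h1 : Complex.exp (Complex.I * l * (x + y * Complex.I)) =
      Complex.exp (-(l * y)) * Complex.exp (Complex.I * (l * x)) := by
    rw [← Complex.exp_add]
    congr 1
    linear_combination (l * y : ℂ) * Complex.I_sq
  have h2 : Complex.exp
        ((τ * (SignType.sign (x - r) + SignType.sign (x + r)) : ℝ) * (Real.pi / 4 * Complex.I)) =
      Complex.exp ((τ * SignType.sign (x - r) : ℝ) * (Real.pi / 4 * Complex.I)) *
      Complex.exp ((τ * SignType.sign (x + r) : ℝ) * (Real.pi / 4 * Complex.I)) := by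
    rw [← Complex.exp_add]
    congr 1
    push_cast
    ring
  rw [h1, h2]
  push_cast
  ring

lemma exp_two_mul_pi_div_four {τ : ℝ} (hτ : τ = 1 ∨ τ = -1) :
    Complex.exp (((τ * 2 : ℝ) : ℂ) * (Real.pi / 4 * Complex.I)) = τ * Complex.I := by
  rcases hτ with rfl | rfl
  · rw [show (((1 * 2 : ℝ) : ℂ) * (Real.pi / 4 * Complex.I)) = Real.pi / 2 * Complex.I by
      push_cast; ring, Complex.exp_pi_div_two_mul_I]
    simp
  · rw [show (((-1 * 2 : ℝ) : ℂ) * (Real.pi / 4 * Complex.I)) = -(Real.pi / 2 * Complex.I) by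
      push_cast; ring, Complex.exp_neg, Complex.exp_pi_div_two_mul_I, Complex.inv_I]
    simp

/-- The sine integral over the outer region. -/
def outerSine (l r : ℝ) : ℝ := ∫ x in Ioi r, Real.sin (l * x) * gapWeight r x

/-- The cosine integral over the inner region. -/
def innerCosine (l r : ℝ) : ℝ := ∫ x in Ioc 0 r, Real.cos (l * x) * gapWeight r x

lemma integral_eq_integral_Ioi_add_neg {H : ℝ → ℂ} (hH : Integrable H) :
    ∫ x, H x = ∫ x in Ioi (0 : ℝ), (H x + H (-x)) := by
  have h := integral_comp_neg_Ioi 0 H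
  rw [neg_zero] at h
  rw [integral_add hH.integrableOn hH.comp_neg.integrableOn, h, add_comm,
    ← setIntegral_union (Iic_disjoint_Ioi le_rfl) measurableSet_Ioi hH.integrableOn
    hH.integrableOn, Iic_union_Ioi, setIntegral_univ]

lemma integral_contourFun_boundary {l r y τ : ℝ} (hr : 0 < r)
    (hs : Real.sin (y / 2) = 0) (hc : Real.cos (y / 2) = τ) (hτ : τ = 1 ∨ τ = -1) :
    ∫ x : ℝ, contourFun l r (x + y * Complex.I) =
      Complex.exp (-(l * y)) * (2 * innerCosine l r - 2 * τ * outerSine l r) := by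
  set H : ℝ → ℂ := fun x => Complex.exp (Complex.I * (l * x)) * (gapWeight r x * Complex.exp
        ((τ * (SignType.sign (x - r) + SignType.sign (x + r)) : ℝ) * (Real.pi / 4 * Complex.I)))
    with hHdef
  have hae : (fun x : ℝ => contourFun l r (x + y * Complex.I)) =ᵐ[volume]
      fun x => Complex.exp (-(l * y)) * H x := by
    filter_upwards [ae_ne_and_ne r] with x hx
    exact contourFun_boundary hx.1 hx.2 hs hc hτ
  have hHm : Measurable H := by
    have h1 := measurable_gapWeight r
    have hsg : Measurable fun x : ℝ => ((SignType.sign x : SignType) : ℝ) := by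
      have : (fun x : ℝ => ((SignType.sign x : SignType) : ℝ)) =
          fun x => if 0 < x then 1 else if x < 0 then -1 else 0 := by
        ext x
        rw [sign_apply]
        split_ifs <;> simp
      rw [this]
      exact Measurable.ite measurableSet_Ioi measurable_const
        (Measurable.ite measurableSet_Iio measurable_const measurable_const)
    have h2 : Measurable fun x : ℝ => ((SignType.sign (x - r) : SignType) : ℝ) :=
      hsg.comp (measurable_id.sub_const r)
    have h3 : Measurable fun x : ℝ => ((SignType.sign (x + r) : SignType) : ℝ) :=
      hsg.comp (measurable_id.add_const r)
    fun_prop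
  have hH : Integrable H := by
    refine Integrable.mono' (integrable_gapWeight hr) hHm.aestronglyMeasurable
      (Eventually.of_forall fun x => ?_)
    have e1 : ‖Complex.exp (Complex.I * (l * x))‖ = 1 := by
      rw [show Complex.I * ((l : ℂ) * x) = ((l * x : ℝ) : ℂ) * Complex.I by push_cast; ring]
      exact Complex.norm_exp_ofReal_mul_I _
    have e2 : ∀ s : ℝ, ‖Complex.exp ((s : ℂ) * (Real.pi / 4 * Complex.I))‖ = 1 := fun s => by
      rw [show (s : ℂ) * (Real.pi / 4 * Complex.I) = ((s * (Real.pi / 4) : ℝ) : ℂ) * Complex.I by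
        push_cast; ring]
      exact Complex.norm_exp_ofReal_mul_I _
    rw [hHdef]
    simp only
    rw [norm_mul, norm_mul, e1, e2, one_mul, mul_one, Complex.norm_real,
      Real.norm_of_nonneg (gapWeight_nonneg r x)]
  have hsum : Integrable fun x => H x + H (-x) := hH.add hH.comp_neg
  have hin : ∫ x in Ioc 0 r, (H x + H (-x)) = 2 * innerCosine l r := by
    rw [innerCosine, ← integral_complex_ofReal, ← integral_const_mul, integral_Ioc_eq_integral_Ioo,
      integral_Ioc_eq_integral_Ioo]
    refine setIntegral_congr_fun measurableSet_Ioo fun x hx => ?_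
    rw [hHdef]
    simp only
    rw [sign_neg (by linarith [hx.2] : x - r < 0), sign_pos (by linarith [hx.1] : 0 < x + r),
      sign_neg (by linarith [hx.1] : -x - r < 0), sign_pos (by linarith [hx.2] : 0 < -x + r),
      gapWeight_neg]
    push_cast
    rw [Complex.cos]
    simp
    ring_nf
  have hout : ∫ x in Ioi r, (H x + H (-x)) = -2 * τ * outerSine l r := by
    rw [outerSine, ← integral_complex_ofReal, ← integral_const_mul]
    refine setIntegral_congr_fun measurableSet_Ioi fun x hx => ?_
    have hx' : r < x := hx
    rw [hHdef]
    simp only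
    rw [sign_pos (by linarith : 0 < x - r), sign_pos (by linarith : 0 < x + r),
      sign_neg (by linarith : -x - r < 0), sign_neg (by linarith : -x + r < 0), gapWeight_neg]
    have hτ' : -τ = 1 ∨ -τ = -1 := by
      rcases hτ with rfl | rfl
      · right; rfl
      · left; norm_num
    have p1 := exp_two_mul_pi_div_four hτ
    have p2 := exp_two_mul_pi_div_four hτ'
    rw [show ((τ * (((1 : SignType) : ℝ) + ((1 : SignType) : ℝ)) : ℝ)) = τ * 2 by norm_num,
      show ((τ * (((-1 : SignType) : ℝ) + ((-1 : SignType) : ℝ)) : ℝ)) = -τ * 2 by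
        norm_num, p1, p2]
    push_cast
    rw [Complex.sin]
    ring_nf
  rw [integral_congr_ae hae, integral_const_mul, integral_eq_integral_Ioi_add_neg hH,
    ← Ioc_union_Ioi_eq_Ioi hr.le, setIntegral_union (Ioc_disjoint_Ioi le_rfl) measurableSet_Ioi
    hsum.integrableOn hsum.integrableOn, hin, hout]
  ring

/-- With `I` the inner and `O` the outer integral, the contour identity reads `I - O = e^{-2πl} (I +
O)`, so `O / I = tanh πl` when `I ≠ 0`. This eliminates the hyperbolic tangent from the density in
dimension two. -/
lemma outerSine_eq {r : ℝ} (hr : 0 < r) (l : ℝ) :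
    outerSine l r = Real.tanh (Real.pi * l) * innerCosine l r := by
  have h := integral_contourFun_bottom_eq_top hr l
  rw [integral_contourFun_boundary (τ := 1) hr (by simp) (by simp) (Or.inl rfl),
    integral_contourFun_boundary (τ := -1) hr
      (by rw [mul_div_cancel_left₀ _ two_ne_zero, Real.sin_pi])
      (by rw [mul_div_cancel_left₀ _ two_ne_zero, Real.cos_pi]) (Or.inr rfl)] at h
  have h' : 2 * innerCosine l r - 2 * outerSine l r = Real.exp (-(2 * (Real.pi * l))) *
      (2 * innerCosine l r + 2 * outerSine l r) := by
    apply Complex.ofReal_injective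
    push_cast
    rw [show -(2 * ((Real.pi : ℂ) * l)) = -(l * (2 * Real.pi)) by ring]
    simpa using h
  rw [Real.tanh_eq, div_mul_eq_mul_div, eq_div_iff (by positivity)]
  have e : Real.exp (-(2 * (Real.pi * l))) * Real.exp (Real.pi * l) =
      Real.exp (-(Real.pi * l)) := by
    rw [← Real.exp_add]
    ring_nf
  linear_combination (-(Real.exp (Real.pi * l)) / 2) * h' + (-(innerCosine l r + outerSine l r)) * e

/-! ### Dimension two: the Mehler–Dirichlet formula and the kernel -/

lemma cosh_log_minkAngle (r θ : ℝ) : Real.cosh r - Real.cosh (Real.log (minkAngle r θ)) =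
    (Real.sinh r * Real.sin θ) ^ 2 / (2 * minkAngle r θ) := by
  have hB := minkAngle_pos r θ
  rw [Real.cosh_log hB, eq_div_iff (by positivity)]
  have h : minkAngle r θ * (minkAngle r θ)⁻¹ = 1 := mul_inv_cancel₀ hB.ne'
  have h2 : Real.cosh r * (2 * minkAngle r θ) - minkAngle r θ ^ 2 - 1 =
      (Real.sinh r * Real.sin θ) ^ 2 := by
    rw [minkAngle, mul_pow, Real.sin_sq]
    nlinarith [Real.cosh_sq r]
  linear_combination h2 - h

/-- The first factor is the Jacobian of `s = log B`, with `B = minkAngle r θ`; the identity says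
that `B^{-1/2} dθ` becomes `gapWeight r s ds / 2`. -/
lemma gapWeight_log_minkAngle {r θ : ℝ} (hr : 0 < r) (hθ : θ ∈ Ioo 0 Real.pi) :
    (Real.sinh r * Real.sin θ / minkAngle r θ) * gapWeight r (Real.log (minkAngle r θ)) =
      2 * Real.exp (-(1 / 2) * Real.log (minkAngle r θ)) := by
  have hB := minkAngle_pos r θ
  have hs : 0 < Real.sinh r * Real.sin θ :=
    mul_pos (Real.sinh_pos_iff.mpr hr) (Real.sin_pos_of_mem_Ioo hθ)
  set S := Real.sinh r * Real.sin θ with hS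
  set B := minkAngle r θ with hBdef
  rw [gapWeight_eq, abs_sub_comm, cosh_log_minkAngle, ← hS, ← hBdef, abs_of_nonneg (by positivity),
    mul_comm (-(1 / 2) : ℝ), ← Real.rpow_def_of_pos hB]
  have h1 : S ^ 2 / (2 * B) / 2 = (S / 2) ^ 2 / B := by
    field_simp
  have h2 : ((S / 2) ^ 2) ^ (-(1 / 2) : ℝ) = (S / 2)⁻¹ := by
    rw [← Real.rpow_natCast, ← Real.rpow_mul (by positivity), ← Real.rpow_neg_one]
    norm_num
  have h3 : B ^ (-(1 / 2) : ℝ) * B ^ (-(1 / 2) : ℝ) = B⁻¹ := by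
    rw [← Real.rpow_add hB, ← Real.rpow_neg_one]
    norm_num
  have h4 : 0 < B ^ (-(1 / 2) : ℝ) := by positivity
  rw [h1, Real.div_rpow (by positivity) hB.le, h2, div_eq_mul_inv S B, ← h3]
  field_simp

lemma log_minkAngle_image {r : ℝ} (hr : 0 < r) :
    (fun θ => Real.log (minkAngle r θ)) '' Ioo 0 Real.pi = Ioo (-r) r := by
  have hs : 0 < Real.sinh r := Real.sinh_pos_iff.mpr hr
  ext s
  constructor
  · rintro ⟨θ, hθ, rfl⟩
    have hsq : 0 < Real.sin θ := Real.sin_pos_of_mem_Ioo hθ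
    have hc : |Real.cos θ| < 1 := by
      rw [← sq_lt_one_iff_abs_lt_one]
      nlinarith [Real.sin_sq_add_cos_sq θ]
    have hc' := abs_lt.mp hc
    constructor
    · simp only
      rw [← log_minkAngle_zero r]
      refine Real.log_lt_log (minkAngle_pos r 0) ?_
      simp only [minkAngle, Real.cos_zero]
      nlinarith
    · simp only
      nth_rewrite 2 [← log_minkAngle_pi r]
      refine Real.log_lt_log (minkAngle_pos r θ) ?_
      simp only [minkAngle, Real.cos_pi]
      nlinarith
  · intro hs'
    have h1 : Real.exp s < Real.cosh r + Real.sinh r := by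
      rw [Real.cosh_add_sinh]
      exact Real.exp_lt_exp.mpr hs'.2
    have h2 : Real.cosh r - Real.sinh r < Real.exp s := by
      rw [Real.cosh_sub_sinh]
      exact Real.exp_lt_exp.mpr hs'.1
    have h3 : -1 < (Real.cosh r - Real.exp s) / Real.sinh r := by
      rw [lt_div_iff₀ hs]
      linarith
    have h4 : (Real.cosh r - Real.exp s) / Real.sinh r < 1 := by
      rw [div_lt_one hs]
      linarith
    refine ⟨Real.arccos ((Real.cosh r - Real.exp s) / Real.sinh r), ⟨Real.arccos_pos.mpr h4, ?_⟩, ?_⟩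
    · exact lt_of_le_of_ne (Real.arccos_le_pi _) fun h => by
        rw [Real.arccos_eq_pi] at h
        linarith
    · simp only [minkAngle]
      rw [Real.cos_arccos h3.le h4.le, mul_div_cancel₀ _ hs.ne', sub_sub_cancel, Real.log_exp]

/-- The substitution `s = log (minkAngle r θ)` carries `(0, π)` onto `(-r, r)`; the weight is even
in `s`, so only the cosine survives. -/
lemma sphericalAngle_zero {r : ℝ} (hr : 0 < r) (l : ℝ) :
    sphericalAngle 0 (specParam 0 l) r = innerCosine l r / Real.pi := by
  have hσ : specParam 0 l = 1 / 2 + Complex.I * l := by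
    rw [specParam, show rho (0 + 2) = 1 / 2 by norm_num [rho]]
    push_cast
    ring
  have hmass : sinMass 0 = Real.pi := by simp [sinMass]
  set g : ℝ → ℂ := fun s => (1 / 2 : ℂ) * (gapWeight r s * Complex.exp (-(Complex.I * l * s)))
    with hg
  have hgi : Integrable g := by
    refine Integrable.const_mul ?_ _
    refine ((integrable_gapWeight hr).ofReal.mul_bdd (c := 1) (by fun_prop)
      (Eventually.of_forall fun s => ?_))
    rw [show -(Complex.I * l * s) = ((-(l * s) : ℝ) : ℂ) * Complex.I by push_cast; ring]
    exact (Complex.norm_exp_ofReal_mul_I _).le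
  have h1 : ∫ θ in 0..Real.pi, ((Real.sin θ ^ 0 : ℝ) : ℂ) * minkPow (specParam 0 l) r θ =
      ∫ s in Ioo (-r) r, g s := by
    rw [intervalIntegral.integral_of_le Real.pi_pos.le, integral_Ioc_eq_integral_Ioo,
      ← log_minkAngle_image hr, integral_image_eq_integral_abs_deriv_smul measurableSet_Ioo
        (f' := fun θ => Real.sinh r * Real.sin θ / minkAngle r θ)]
    · refine setIntegral_congr_fun measurableSet_Ioo fun θ hθ => ?_
      have hpos : 0 < Real.sinh r * Real.sin θ / minkAngle r θ :=
        div_pos (mul_pos (Real.sinh_pos_iff.mpr hr) (Real.sin_pos_of_mem_Ioo hθ))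
          (minkAngle_pos r θ)
      simp only [hg]
      rw [abs_of_pos hpos, Complex.real_smul]
      have h := congrArg (fun x : ℝ => (x : ℂ)) (gapWeight_log_minkAngle hr hθ)
      rw [Complex.ofReal_mul _ (gapWeight r _)] at h
      have h5 : minkPow (specParam 0 l) r θ =
          ((Real.exp (-(1 / 2) * Real.log (minkAngle r θ)) : ℝ) : ℂ) *
          Complex.exp (-(Complex.I * l * (Real.log (minkAngle r θ) : ℝ))) := by
        rw [minkPow, hσ, Complex.ofReal_exp, ← Complex.exp_add]
        congr 1
        push_cast
        ring
      rw [h5]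
      push_cast at h ⊢
      linear_combination (-(1 / 2 : ℂ)) *
        Complex.exp (-(Complex.I * l * (Real.log (minkAngle r θ) : ℝ))) * h
    · intro θ _
      have h := (((Real.hasDerivAt_cos θ).const_mul (Real.sinh r)).const_sub (Real.cosh r)).log
        (minkAngle_pos r θ).ne'
      refine (h.congr_deriv ?_).hasDerivWithinAt
      rw [minkAngle]
      ring
    · intro a ha b hb hab
      have h := Real.log_injOn_pos (minkAngle_pos r a) (minkAngle_pos r b) hab
      simp only [minkAngle] at h
      have hs : Real.sinh r ≠ 0 := (Real.sinh_pos_iff.mpr hr).ne'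
      exact Real.injOn_cos ⟨ha.1.le, ha.2.le⟩ ⟨hb.1.le, hb.2.le⟩
        (mul_left_cancel₀ hs (by linarith))
  have h2 : ∫ s in Ioo (-r) r, g s = innerCosine l r := by
    rw [← integral_indicator measurableSet_Ioo, integral_eq_integral_Ioi_add_neg
      (hgi.indicator measurableSet_Ioo), innerCosine, ← integral_complex_ofReal,
      integral_Ioc_eq_integral_Ioo, ← integral_indicator measurableSet_Ioi,
      ← integral_indicator measurableSet_Ioo]
    congr 1
    ext x
    by_cases hx0 : 0 < x
    · by_cases hxr : x < r
      · rw [indicator_of_mem (show x ∈ Ioi 0 from hx0), indicator_of_mem (show x ∈ Ioo 0 r from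
          ⟨hx0, hxr⟩), indicator_of_mem (show x ∈ Ioo (-r) r from ⟨by linarith, hxr⟩),
          indicator_of_mem (show -x ∈ Ioo (-r) r from ⟨by linarith, by linarith⟩)]
        simp only [hg]
        rw [gapWeight_neg]
        push_cast
        rw [Complex.cos]
        ring_nf
      · rw [indicator_of_mem (show x ∈ Ioi 0 from hx0),
          indicator_of_notMem (show x ∉ Ioo 0 r from fun h => hxr h.2),
          indicator_of_notMem (show x ∉ Ioo (-r) r from fun h => hxr h.2),
          indicator_of_notMem (show -x ∉ Ioo (-r) r from fun h => hxr (by linarith [h.1])), add_zero]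
    · rw [indicator_of_notMem (show x ∉ Ioi 0 from hx0),
        indicator_of_notMem (show x ∉ Ioo 0 r from fun h => hx0 h.1)]
  rw [sphericalAngle, h1, h2, hmass]
  field_simp

/-- By `outerSine_eq` the product of `Φ` with the density `l tanh πl` is `l · outerSine l r / π`.
Fubini's theorem then leaves the sine transform of the Gaussian in `l`. -/
lemma kernel_zero {z : ℂ} (hz : 0 < z.re) {r : ℝ} (hr : 0 < r) :
    kernel 0 z r = (Real.pi : ℂ)⁻¹ * ∫ x in Ioi r, (gapWeight r x : ℂ) *
      (x / (2 * z) * ((Real.pi / z) ^ (1 / 2 : ℂ) * Complex.exp (-(x : ℂ) ^ 2 / (4 * z)))) := by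
  have h1 : ∀ l : ℝ, kernelFun 0 z r l = (Real.pi : ℂ)⁻¹ * ∫ x in Ioi r,
      (gapWeight r x : ℂ) * (Complex.exp (-z * (l : ℂ) ^ 2) * (l * (Real.sin (l * x) : ℂ))) := by
    intro l
    have h := congrArg (fun x : ℝ => (x : ℂ)) (outerSine_eq hr l)
    rw [outerSine, ← integral_complex_ofReal] at h
    rw [kernelFun, sphericalAngle_zero hr, density]
    have h2 : ∫ x in Ioi r, (gapWeight r x : ℂ) * (Complex.exp (-z * (l : ℂ) ^ 2) *
        (l * (Real.sin (l * x) : ℂ))) = Complex.exp (-z * (l : ℂ) ^ 2) * l *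
        ∫ x in Ioi r, ((Real.sin (l * x) * gapWeight r x : ℝ) : ℂ) := by
      rw [← integral_const_mul]
      refine setIntegral_congr_fun measurableSet_Ioi fun x _ => ?_
      push_cast
      ring
    rw [h2, h]
    push_cast
    ring
  rw [kernel, funext h1, integral_const_mul]
  congr 1
  rw [integral_integral_swap]
  · refine setIntegral_congr_fun measurableSet_Ioi fun x _ => ?_
    rw [integral_const_mul, integral_gaussian_mul_sin hz]
  · have hm : Measurable (Function.uncurry fun (l x : ℝ) => (gapWeight r x : ℂ) *
        (Complex.exp (-z * (l : ℂ) ^ 2) * (l * (Real.sin (l * x) : ℂ)))) := by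
      have := measurable_gapWeight r
      unfold Function.uncurry
      fun_prop
    have hdom : Integrable (fun p : ℝ × ℝ => ‖(p.1 : ℂ) * Complex.exp (-z * (p.1 : ℂ) ^ 2)‖ *
        gapWeight r p.2) (volume.prod (volume.restrict (Ioi r))) :=
      (integrable_mul_cexp_neg_mul_sq hz).norm.mul_prod (integrable_gapWeight hr).integrableOn
    refine Integrable.mono' hdom hm.aestronglyMeasurable (Eventually.of_forall fun p => ?_)
    have hsin : ‖(Real.sin (p.1 * p.2) : ℂ)‖ ≤ 1 := by
      rw [Complex.norm_real]
      exact Real.abs_sin_le_one _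
    simp only [Function.uncurry]
    rw [norm_mul, norm_mul, norm_mul, norm_mul, Complex.norm_real (gapWeight r p.2),
      Real.norm_of_nonneg (gapWeight_nonneg r p.2)]
    have h0 := gapWeight_nonneg r p.2
    calc _ ≤ gapWeight r p.2 * (‖Complex.exp (-z * (p.1 : ℂ) ^ 2)‖ * (‖(p.1 : ℂ)‖ * 1)) := by
          gcongr
      _ = _ := by ring

/-! ### Derivatives of `arcosh²` as integrals -/

/-- `∫ (u + cosh y)^{-k-1} dy`; up to sign and factorial, the derivative of order `k + 1` of
`arcosh²`. -/
def coshIntegral (k : ℕ) (u : ℝ) : ℝ := ∫ y : ℝ, ((u + Real.cosh y) ^ (k + 1))⁻¹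

lemma quarter_le_cosh (y : ℝ) : (1 + y ^ 2) / 4 ≤ Real.cosh y := by
  have h := Real.quadratic_le_exp_of_nonneg (abs_nonneg y)
  rw [← Real.cosh_abs, Real.cosh_eq, sq_abs] at *
  have := abs_nonneg y
  have := Real.exp_pos (-|y|)
  nlinarith [sq_nonneg y]

lemma integrable_inv_cosh : Integrable fun y : ℝ => (Real.cosh y)⁻¹ := by
  refine Integrable.mono' (integrable_inv_one_add_sq.const_mul 4)
    (Real.continuous_cosh.measurable.inv.aestronglyMeasurable) (Eventually.of_forall fun y => ?_)
  rw [Real.norm_of_nonneg (inv_nonneg.mpr (Real.cosh_pos y).le), ← inv_inv (4 : ℝ), ← mul_inv]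
  refine inv_anti₀ (by positivity) ?_
  linarith [quarter_le_cosh y]

lemma inv_pow_add_cosh_le {u : ℝ} (hu : 0 ≤ u) (k : ℕ) (y : ℝ) :
    ((u + Real.cosh y) ^ (k + 1))⁻¹ ≤ (Real.cosh y)⁻¹ := by
  have h1 := Real.one_le_cosh y
  refine inv_anti₀ (by linarith) ?_
  calc Real.cosh y ≤ u + Real.cosh y := by linarith
    _ ≤ (u + Real.cosh y) ^ (k + 1) := le_self_pow₀ (by linarith) k.succ_ne_zero

lemma integrable_inv_pow_add_cosh {u : ℝ} (hu : 0 ≤ u) (k : ℕ) :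
    Integrable fun y : ℝ => ((u + Real.cosh y) ^ (k + 1))⁻¹ := by
  refine Integrable.mono' integrable_inv_cosh ?_ (Eventually.of_forall fun y => ?_)
  · have := Real.measurable_cosh
    exact (by fun_prop : Measurable fun y : ℝ => ((u + Real.cosh y) ^ (k + 1))⁻¹).aestronglyMeasurable
  · have := Real.cosh_pos y
    rw [Real.norm_of_nonneg (by positivity)]
    exact inv_pow_add_cosh_le hu k y

lemma coshIntegral_nonneg {u : ℝ} (hu : 0 ≤ u) (k : ℕ) : 0 ≤ coshIntegral k u :=
  integral_nonneg fun y => by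
    have := Real.cosh_pos y
    positivity

lemma hasDerivAt_coshIntegral (k : ℕ) {u : ℝ} (hu : 0 < u) :
    HasDerivAt (coshIntegral k) (-((k + 1 : ℕ) : ℝ) * coshIntegral (k + 1) u) u := by
  rw [coshIntegral, ← integral_const_mul]
  refine (hasDerivAt_integral_of_dominated_loc_of_deriv_le (𝕜 := ℝ)
    (F := fun u y => ((u + Real.cosh y) ^ (k + 1))⁻¹)
    (F' := fun u y => -((k + 1 : ℕ) : ℝ) * ((u + Real.cosh y) ^ (k + 1 + 1))⁻¹)
    (bound := fun y => ((k + 1 : ℕ) : ℝ) * (Real.cosh y)⁻¹)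
    (Ioi_mem_nhds hu) ?_ (integrable_inv_pow_add_cosh hu.le k) ?_ ?_ ?_ ?_).2
  · filter_upwards [Ioi_mem_nhds hu] with x hx
    exact (integrable_inv_pow_add_cosh (le_of_lt hx) k).aestronglyMeasurable
  · exact ((integrable_inv_pow_add_cosh hu.le (k + 1)).const_mul _).aestronglyMeasurable
  · refine Eventually.of_forall fun y x hx => ?_
    have hx' : 0 < x := hx
    have := Real.cosh_pos y
    rw [norm_mul, norm_neg, Real.norm_of_nonneg (by positivity), Real.norm_of_nonneg (by positivity)]
    exact mul_le_mul_of_nonneg_left (inv_pow_add_cosh_le hx'.le (k + 1) y) (by positivity)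
  · exact integrable_inv_cosh.const_mul _
  · refine Eventually.of_forall fun y x hx => ?_
    have hx' : 0 < x := hx
    have hpos : 0 < x + Real.cosh y := by linarith [Real.cosh_pos y]
    have h := (((hasDerivAt_id x).add_const (Real.cosh y)).pow (k + 1)).inv (by
      simpa using hpos.ne')
    refine h.congr_deriv ?_
    simp only [id, Nat.add_sub_cancel, Pi.pow_apply]
    field_simp
    ring

/-- Because `(e^y + e^{-r}) (e^y + e^r) = 2 e^y (cosh r + cosh y)`, the integrand has the primitive
`log ((e^y + e^{-r}) / (e^y + e^r)) / sinh r`, whose logarithm rises from `-2r` to `0`. -/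
lemma coshIntegral_zero_cosh {r : ℝ} (hr : 0 < r) :
    coshIntegral 0 (Real.cosh r) = 2 * r / Real.sinh r := by
  have hs : 0 < Real.sinh r := Real.sinh_pos_iff.mpr hr
  set P : ℝ → ℝ := fun y => (Real.exp y + Real.exp (-r)) / (Real.exp y + Real.exp r) with hP
  have hPpos : ∀ y, 0 < P y := fun y => by positivity
  have hderiv : ∀ y : ℝ, HasDerivAt (fun y => (Real.sinh r)⁻¹ * Real.log (P y))
      ((Real.cosh r + Real.cosh y) ^ (0 + 1))⁻¹ y := by
    intro y
    have h1 := ((Real.hasDerivAt_exp y).add_const (Real.exp (-r))).div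
      ((Real.hasDerivAt_exp y).add_const (Real.exp r)) (by positivity)
    have h2 := (h1.log (hPpos y).ne').const_mul (Real.sinh r)⁻¹
    refine h2.congr_deriv ?_
    have e1 : Real.exp (-r) * Real.exp r = 1 := by rw [← Real.exp_add]; simp
    have e2 : Real.exp (-y) * Real.exp y = 1 := by rw [← Real.exp_add]; simp
    have hcc : Real.cosh r + Real.cosh y ≠ 0 := by
      linarith [Real.cosh_pos r, Real.cosh_pos y]
    have hne1 : Real.exp y + Real.exp (-r) ≠ 0 := by positivity
    have hne2 : Real.exp y + Real.exp r ≠ 0 := by positivity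
    have hprod : (Real.exp y + Real.exp (-r)) * (Real.exp y + Real.exp r) =
        2 * Real.exp y * (Real.cosh r + Real.cosh y) := by
      rw [Real.cosh_eq, Real.cosh_eq]
      linear_combination e1 - e2
    have hsinh : Real.exp r - Real.exp (-r) = 2 * Real.sinh r := by rw [Real.sinh_eq]; ring
    simp only [Pi.div_apply, zero_add, pow_one]
    have hnum : (Real.exp y * (Real.exp y + Real.exp r) - (Real.exp y + Real.exp (-r)) * Real.exp y) /
        (Real.exp y + Real.exp r) ^ 2 / ((Real.exp y + Real.exp (-r)) / (Real.exp y + Real.exp r)) =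
        Real.exp y * (Real.exp r - Real.exp (-r)) /
          ((Real.exp y + Real.exp (-r)) * (Real.exp y + Real.exp r)) := by
      field_simp
      ring
    rw [hnum, hprod, hsinh]
    have := (Real.exp_pos y).ne'
    field_simp
  have hbot : Tendsto (fun y => (Real.sinh r)⁻¹ * Real.log (P y)) atBot
      (𝓝 ((Real.sinh r)⁻¹ * Real.log ((0 + Real.exp (-r)) / (0 + Real.exp r)))) := by
    refine Tendsto.const_mul _ (Tendsto.log ?_ (by positivity))
    exact (Real.tendsto_exp_atBot.add_const _).div (Real.tendsto_exp_atBot.add_const _)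
      (by positivity)
  have htop : Tendsto (fun y => (Real.sinh r)⁻¹ * Real.log (P y)) atTop
      (𝓝 ((Real.sinh r)⁻¹ * Real.log ((1 + Real.exp (-r) * 0) / (1 + Real.exp r * 0)))) := by
    refine Tendsto.const_mul _ (Tendsto.log ?_ (by simp))
    have h0 : Tendsto (fun y : ℝ => Real.exp (-y)) atTop (𝓝 0) := Real.tendsto_exp_neg_atTop_nhds_zero
    have h1 := ((h0.const_mul (Real.exp (-r))).const_add 1).div
      ((h0.const_mul (Real.exp r)).const_add 1) (by simp)
    refine h1.congr fun y => ?_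
    rw [hP]
    simp only [Pi.div_apply, Real.exp_neg y]
    field_simp
  have h := integral_of_hasDerivAt_of_tendsto hderiv
    (integrable_inv_pow_add_cosh (Real.cosh_pos r).le 0) hbot htop
  rw [coshIntegral, h]
  simp only [mul_zero, add_zero, zero_add, div_one, Real.log_one]
  rw [← Real.exp_sub, Real.log_exp]
  ring

lemma coshIntegral_le {u : ℝ} (hu : 0 < u) (k : ℕ) :
    coshIntegral k u ≤ u⁻¹ ^ k * coshIntegral 0 u := by
  rw [coshIntegral, coshIntegral, ← integral_const_mul]
  refine integral_mono (integrable_inv_pow_add_cosh hu.le k)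
    ((integrable_inv_pow_add_cosh hu.le 0).const_mul _) fun y => ?_
  have h0 := Real.cosh_pos y
  simp only [zero_add, pow_one]
  rw [pow_succ, mul_inv, inv_pow]
  gcongr
  linarith

/-- The weight `(1 + r) e^{-r}`. -/
def decay (r : ℝ) : ℝ := (1 + r) * Real.exp (-r)

lemma decay_pos {r : ℝ} (hr : 0 ≤ r) : 0 < decay r := by
  unfold decay
  positivity

lemma decay_le_one (r : ℝ) : decay r ≤ 1 := by
  rw [decay, Real.exp_neg, ← div_eq_mul_inv, div_le_one (Real.exp_pos r)]
  linarith [Real.add_one_le_exp r]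

lemma decay_antitone {r s : ℝ} (hr : 0 ≤ r) (hrs : r ≤ s) : decay s ≤ decay r := by
  have h := Real.add_one_le_exp (s - r)
  have h1 : 1 + s ≤ (1 + r) * Real.exp (s - r) := by nlinarith
  calc decay s ≤ ((1 + r) * Real.exp (s - r)) * Real.exp (-s) := by
        unfold decay
        gcongr
    _ = decay r := by
        rw [decay, mul_assoc, ← Real.exp_add]
        ring_nf

lemma inv_cosh_le_decay {r : ℝ} (hr : 0 ≤ r) : (Real.cosh r)⁻¹ ≤ 2 * decay r := by
  have h1 : Real.exp r / 2 ≤ Real.cosh r := by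
    rw [Real.cosh_eq]
    linarith [Real.exp_pos (-r)]
  calc (Real.cosh r)⁻¹ ≤ (Real.exp r / 2)⁻¹ := inv_anti₀ (by positivity) h1
    _ = 2 * (1 * Real.exp (-r)) := by rw [inv_div, Real.exp_neg]; ring
    _ ≤ 2 * decay r := by
        unfold decay
        gcongr
        linarith

lemma two_mul_div_sinh_le {r : ℝ} (hr : 0 < r) : 2 * r / Real.sinh r ≤ 4 * decay r := by
  have hs : 0 < Real.sinh r := Real.sinh_pos_iff.mpr hr
  have e1 : Real.exp (-r) * Real.exp r = 1 := by rw [← Real.exp_add]; simp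
  have h1 : (1 + r) * (Real.exp (-r)) ≤ 1 := decay_le_one r
  have h2 : Real.exp (-r) ≤ 1 := Real.exp_le_one_iff.mpr (by linarith)
  have h3 := Real.exp_pos (-r)
  rw [div_le_iff₀ hs, Real.sinh_eq, decay]
  nlinarith [mul_le_mul h1 h2 h3.le zero_le_one]

/-- Of the `k + 1` factors in the integrand, `k` are at most `1 / cosh r`; the remaining one
integrates to `2r / sinh r`. Both are bounded by `decay r`, including as `r → 0`. -/
lemma abs_coshIntegral_le {r : ℝ} (hr : 0 < r) (k : ℕ) :
    coshIntegral k (Real.cosh r) ≤ 2 ^ (k + 2) * decay r ^ (k + 1) := by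
  have hc := Real.cosh_pos r
  have hd := decay_pos hr.le
  calc coshIntegral k (Real.cosh r) ≤ (Real.cosh r)⁻¹ ^ k * coshIntegral 0 (Real.cosh r) :=
        coshIntegral_le hc k
    _ ≤ (2 * decay r) ^ k * (4 * decay r) := by
        rw [coshIntegral_zero_cosh hr]
        have h0 : 0 ≤ 2 * r / Real.sinh r :=
          div_nonneg (by linarith) (Real.sinh_pos_iff.mpr hr).le
        have := inv_cosh_le_decay hr.le
        have := two_mul_div_sinh_le hr
        gcongr
    _ = _ := by ring

/-! ### Derivatives of the Gaussian in `u = cosh r` -/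

/-- The Gaussian `e^{-r² / 4z}` as a function of `u = cosh r`. -/
def gaussianCosh (z : ℂ) (u : ℝ) : ℂ := Complex.exp (-(Real.arcosh u : ℂ) ^ 2 / (4 * z))

lemma hasDerivAt_arcosh_sq {u : ℝ} (hu : 1 < u) :
    HasDerivAt (fun u => Real.arcosh u ^ 2) (coshIntegral 0 u) u := by
  refine ((Real.hasDerivAt_arcosh hu).pow 2).congr_deriv ?_
  have h := coshIntegral_zero_cosh (Real.arcosh_pos hu)
  rw [Real.cosh_arcosh hu.le, Real.sinh_arcosh hu.le] at h
  rw [h]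
  push_cast
  ring

lemma contDiffAt_gaussianCosh (z : ℂ) {u : ℝ} (hu : 1 < u) (n : ℕ) :
    ContDiffAt ℝ n (gaussianCosh z) u := by
  have h := Complex.ofRealCLM.contDiff.contDiffAt.comp u
    (Real.contDiffAt_arcosh (n := n) (mem_Ioi.mpr hu))
  have h' : ContDiffAt ℝ n (fun u : ℝ => (Real.arcosh u : ℂ)) u := h
  unfold gaussianCosh
  exact ((h'.pow 2).neg.div_const _).cexp

lemma hasDerivAt_gaussianCosh (z : ℂ) {u : ℝ} (hu : 1 < u) :
    HasDerivAt (gaussianCosh z) (-(1 / (4 * z)) * ((coshIntegral 0 u : ℂ) * gaussianCosh z u)) u := by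
  have h := ((hasDerivAt_arcosh_sq hu).ofReal_comp.neg.div_const (4 * z)).cexp
  have h2 : HasDerivAt (gaussianCosh z) _ u := h.congr_of_eventuallyEq
    (Eventually.of_forall fun x => by simp [gaussianCosh])
  refine h2.congr_deriv ?_
  simp only [gaussianCosh, Complex.ofReal_pow, Pi.neg_apply]
  ring

lemma iteratedDeriv_coshIntegral (k : ℕ) : ∀ u : ℝ, 0 < u →
    iteratedDeriv k (fun u => (coshIntegral 0 u : ℂ)) u = ((-1) ^ k * k.factorial * coshIntegral k u : ℝ) := by
  induction k with
  | zero => intro u _; simp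
  | succ k ih =>
    intro u hu
    have hev : iteratedDeriv k (fun u => (coshIntegral 0 u : ℂ)) =ᶠ[𝓝 u]
        fun u => ((-1) ^ k * k.factorial * coshIntegral k u : ℝ) := by
      filter_upwards [Ioi_mem_nhds hu] with x hx
      exact ih x hx
    rw [iteratedDeriv_succ, hev.deriv_eq,
      ((hasDerivAt_coshIntegral k hu).const_mul ((-1) ^ k * k.factorial : ℝ)).ofReal_comp.deriv]
    congr 1
    rw [Nat.factorial_succ, pow_succ]
    push_cast
    ring

lemma contDiffAt_coshIntegral {u : ℝ} (hu : 1 < u) (n : ℕ) :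
    ContDiffAt ℝ n (fun u => (coshIntegral 0 u : ℂ)) u := by
  have hev : (fun u => (coshIntegral 0 u : ℂ)) =ᶠ[𝓝 u]
      fun u => ((2 * Real.arcosh u / √(u ^ 2 - 1) : ℝ) : ℂ) := by
    filter_upwards [Ioi_mem_nhds hu] with x hx
    have hx' : 1 < x := hx
    have h := coshIntegral_zero_cosh (Real.arcosh_pos hx')
    rw [Real.cosh_arcosh hx'.le, Real.sinh_arcosh hx'.le] at h
    rw [h]
  refine ContDiffAt.congr_of_eventuallyEq ?_ hev
  have hpos : 0 < u ^ 2 - 1 := by nlinarith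
  have h1 : ContDiffAt ℝ n (fun u : ℝ => 2 * Real.arcosh u / √(u ^ 2 - 1)) u := by
    refine ContDiffAt.div (contDiffAt_const.mul (Real.contDiffAt_arcosh (mem_Ioi.mpr hu))) ?_
      (Real.sqrt_pos.mpr hpos).ne'
    exact ContDiffAt.sqrt (by fun_prop) hpos.ne'
  exact Complex.ofRealCLM.contDiff.contDiffAt.comp u h1

lemma hasDerivAt_iteratedDeriv_gaussianCosh (z : ℂ) (k : ℕ) {u : ℝ} (hu : 1 < u) :
    HasDerivAt (iteratedDeriv k (gaussianCosh z)) (iteratedDeriv (k + 1) (gaussianCosh z) u) u := by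
  rw [iteratedDeriv_succ]
  refine DifferentiableAt.hasDerivAt ?_
  have h : ContDiffOn ℝ (k + 1 : ℕ) (gaussianCosh z) (Ioi 1) := fun x hx =>
    (contDiffAt_gaussianCosh z hx (k + 1)).contDiffWithinAt
  have h1 := (h.differentiableOn_iteratedDerivWithin (m := k) (by exact_mod_cast k.lt_succ_self)
    isOpen_Ioi.uniqueDiffOn).differentiableAt (Ioi_mem_nhds hu)
  refine h1.congr_of_eventuallyEq ?_
  filter_upwards [Ioi_mem_nhds hu] with x hx
  exact (iteratedDerivWithin_of_isOpen isOpen_Ioi hx).symm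

/-- Leibniz' rule for the equation `G' = -(1 / 4z) J G`, where `J = coshIntegral 0` has explicit
derivatives. -/
lemma iteratedDeriv_succ_gaussianCosh (z : ℂ) (k : ℕ) {u : ℝ} (hu : 1 < u) :
    iteratedDeriv (k + 1) (gaussianCosh z) u = -(1 / (4 * z)) * ∑ i ∈ Finset.range (k + 1),
      k.choose i * (((-1) ^ i * i.factorial * coshIntegral i u : ℝ) : ℂ) *
        iteratedDeriv (k - i) (gaussianCosh z) u := by
  have hev : deriv (gaussianCosh z) =ᶠ[𝓝 u]
      fun u => -(1 / (4 * z)) * ((fun u => (coshIntegral 0 u : ℂ)) * gaussianCosh z) u := by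
    filter_upwards [Ioi_mem_nhds hu] with x hx
    exact (hasDerivAt_gaussianCosh z hx).deriv
  rw [iteratedDeriv_succ', hev.iteratedDeriv_eq, iteratedDeriv_const_mul_field,
    iteratedDeriv_mul (contDiffAt_coshIntegral hu k) (contDiffAt_gaussianCosh z hu k)]
  congr 1
  refine Finset.sum_congr rfl fun i _ => ?_
  rw [iteratedDeriv_coshIntegral i u (by linarith)]

/-- The growth in `a = |z|⁻¹` of the derivative of order `k` of the Gaussian. -/
def growth (k : ℕ) (a : ℝ) : ℝ := if k = 0 then 1 else a + a ^ k

lemma growth_nonneg (k : ℕ) {a : ℝ} (ha : 0 ≤ a) : 0 ≤ growth k a := by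
  unfold growth
  split_ifs <;> positivity

lemma pow_le_add_pow {a : ℝ} (ha : 0 ≤ a) {j m : ℕ} (h1 : 1 ≤ j) (h2 : j ≤ m) :
    a ^ j ≤ a + a ^ m := by
  rcases le_total a 1 with h | h
  · have := pow_le_pow_of_le_one ha h h1
    have := pow_nonneg ha m
    linarith
  · have := pow_le_pow_right₀ h h2
    linarith

/-- Each step of the recursion brings one more factor `a`; the intermediate powers are dominated by
the two extreme ones, which is why `growth` keeps only these. -/
lemma mul_growth_le {a : ℝ} (ha : 0 ≤ a) {k m : ℕ} (h : k ≤ m) :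
    a * growth k a ≤ 2 * growth (m + 1) a := by
  have hp : 0 ≤ a ^ (m + 1) := pow_nonneg ha _
  rw [growth, growth, if_neg m.succ_ne_zero]
  split_ifs with hk
  · linarith
  · have h1 := pow_le_add_pow ha (j := 2) (m := m + 1) (by norm_num) (by omega)
    have h2 := pow_le_add_pow ha (j := k + 1) (m := m + 1) (by omega) (by omega)
    have h3 : a * (a + a ^ k) = a ^ 2 + a ^ (k + 1) := by ring
    linarith

/-- Only the sign of `Re (1 / z)` is used, so the bound does not degenerate as `Re z → 0`. -/
lemma norm_gaussian_le_one {z : ℂ} (hz : 0 < z.re) (x : ℝ) :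
    ‖Complex.exp (-(x : ℂ) ^ 2 / (4 * z))‖ ≤ 1 := by
  rw [Complex.norm_exp, Real.exp_le_one_iff]
  have h1 : -(x : ℂ) ^ 2 / (4 * z) = ((-(x ^ 2) / 4 : ℝ) : ℂ) * z⁻¹ := by
    push_cast
    rw [div_mul_eq_div_div, div_eq_mul_inv]
  rw [h1, Complex.re_ofReal_mul, Complex.inv_re]
  refine mul_nonpos_of_nonpos_of_nonneg (by nlinarith [sq_nonneg x])
    (div_nonneg hz.le (Complex.normSq_nonneg z))

/-- Strong induction on the recursion: in the term of index `i`, `J^{(i)}` contributes `decay r ^ (i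
+ 1)` and `G^{(k-i)}` contributes `decay r ^ (k - i)`, so every term has total power `k + 1`. -/
lemma norm_iteratedDeriv_gaussianCosh_le (k : ℕ) : ∃ C, 0 ≤ C ∧ ∀ z : ℂ, 0 < z.re → ∀ r, 0 < r →
    ‖iteratedDeriv k (gaussianCosh z) (Real.cosh r)‖ ≤ C * decay r ^ k * growth k ‖z‖⁻¹ := by
  induction k using Nat.strong_induction_on with
  | _ k ih =>
  rcases k with _ | k
  · refine ⟨1, zero_le_one, fun z hz r hr => ?_⟩
    simpa [growth, gaussianCosh, Real.arcosh_cosh hr.le] using norm_gaussian_le_one hz r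
  choose! C hC0 hC using ih
  refine ⟨∑ i ∈ Finset.range (k + 1), k.choose i * (i.factorial * 2 ^ (i + 2)) * C (k - i) * 2, ?_,
    fun z hz r hr => ?_⟩
  · exact Finset.sum_nonneg fun i _ => by
      have := hC0 (k - i) (by omega)
      positivity
  have ha : 0 ≤ ‖z‖⁻¹ := by positivity
  have hd := decay_pos hr.le
  rw [iteratedDeriv_succ_gaussianCosh z k (Real.one_lt_cosh.mpr hr.ne'), norm_mul]
  have hz4 : ‖-(1 / (4 * z))‖ ≤ ‖z‖⁻¹ := by
    rw [norm_neg, norm_div, norm_mul, norm_one, one_div, mul_inv]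
    have : ‖(4 : ℂ)‖⁻¹ ≤ 1 := by norm_num
    exact mul_le_of_le_one_left ha this
  calc _ ≤ ‖z‖⁻¹ * ∑ i ∈ Finset.range (k + 1), ‖k.choose i *
        (((-1) ^ i * i.factorial * coshIntegral i (Real.cosh r) : ℝ) : ℂ) *
        iteratedDeriv (k - i) (gaussianCosh z) (Real.cosh r)‖ := by
        gcongr
        exact norm_sum_le _ _
    _ = ∑ i ∈ Finset.range (k + 1), ‖z‖⁻¹ * ‖k.choose i *
        (((-1) ^ i * i.factorial * coshIntegral i (Real.cosh r) : ℝ) : ℂ) *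
        iteratedDeriv (k - i) (gaussianCosh z) (Real.cosh r)‖ := Finset.mul_sum _ _ _
    _ ≤ ∑ i ∈ Finset.range (k + 1), (k.choose i * (i.factorial * 2 ^ (i + 2)) * C (k - i) * 2) *
        (decay r ^ (k + 1) * growth (k + 1) ‖z‖⁻¹) := by
        refine Finset.sum_le_sum fun i hi => ?_
        have hik : i ≤ k := by simpa [Nat.lt_succ_iff] using hi
        have hCi := hC0 (k - i) (by omega)
        have hci := coshIntegral_nonneg (Real.cosh_pos r).le i
        have hgr := growth_nonneg (k - i) ha
        rw [norm_mul, norm_mul, Complex.norm_natCast, Complex.norm_real, Real.norm_eq_abs, abs_mul,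
          abs_mul, abs_pow, abs_neg, abs_one, one_pow, one_mul, Nat.abs_cast, abs_of_nonneg hci]
        calc _ ≤ ‖z‖⁻¹ * (k.choose i * (i.factorial * (2 ^ (i + 2) * decay r ^ (i + 1))) *
              (C (k - i) * decay r ^ (k - i) * growth (k - i) ‖z‖⁻¹)) := by
              gcongr
              · exact abs_coshIntegral_le hr i
              · exact hC (k - i) (by omega) z hz r hr
          _ = k.choose i * (i.factorial * 2 ^ (i + 2)) * C (k - i) *
              (decay r ^ (i + 1) * decay r ^ (k - i)) * (‖z‖⁻¹ * growth (k - i) ‖z‖⁻¹) := by ring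
          _ ≤ k.choose i * (i.factorial * 2 ^ (i + 2)) * C (k - i) *
              (decay r ^ (i + 1) * decay r ^ (k - i)) * (2 * growth (k + 1) ‖z‖⁻¹) := by
              gcongr _ * ?_
              exact mul_growth_le ha (Nat.sub_le k i)
          _ = _ := by
              rw [← pow_add, show i + 1 + (k - i) = k + 1 by omega]
              ring
    _ = _ := by rw [← Finset.sum_mul, mul_assoc]

/-- As `decay` is decreasing, the bound at `cosh r` controls the whole half line beyond it, over
which the half-integral runs. -/
lemma norm_iteratedDeriv_gaussianCosh_le_of_le (k : ℕ) : ∃ C, 0 ≤ C ∧ ∀ z : ℂ, 0 < z.re →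
    ∀ r, 0 < r → ∀ v, Real.cosh r ≤ v →
    ‖iteratedDeriv k (gaussianCosh z) v‖ ≤ C * decay r ^ k * growth k ‖z‖⁻¹ := by
  obtain ⟨C, hC0, hC⟩ := norm_iteratedDeriv_gaussianCosh_le k
  refine ⟨C, hC0, fun z hz r hr v hv => ?_⟩
  have hv1 : 1 ≤ v := (Real.one_le_cosh r).trans hv
  have hrv : r ≤ Real.arcosh v := by
    rw [← Real.arcosh_cosh hr.le, Real.arcosh_le_arcosh (Real.cosh_pos r) (by linarith)]
    exact hv
  have h := hC z hz (Real.arcosh v) (hr.trans_le hrv)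
  rw [Real.cosh_arcosh hv1] at h
  have h1 := decay_antitone hr.le hrv
  have h2 := (decay_pos (hr.le.trans hrv)).le
  have h3 := growth_nonneg k (a := ‖z‖⁻¹) (by positivity)
  exact h.trans (by gcongr)

/-- The exponent `3/4` must exceed `1/2`, for integrability against `w^{-1/2}` at infinity, and be
less than `1`, to absorb the factor `1 + r`. -/
lemma decay_le_cosh_rpow {r : ℝ} (hr : 0 ≤ r) : decay r ≤ 4 * Real.cosh r ^ (-(3 / 4) : ℝ) := by
  have h1 : 1 + r ≤ 4 * Real.exp (r / 4) := by linarith [Real.add_one_le_exp (r / 4)]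
  have h2 : Real.cosh r ≤ Real.exp r := by
    rw [← Real.cosh_add_sinh]
    linarith [Real.sinh_nonneg_iff.mpr hr]
  have h3 : Real.exp r ^ (-(3 / 4) : ℝ) ≤ Real.cosh r ^ (-(3 / 4) : ℝ) :=
    Real.rpow_le_rpow_of_nonpos (Real.cosh_pos r) h2 (by norm_num)
  calc decay r ≤ (4 * Real.exp (r / 4)) * Real.exp (-r) := by
        unfold decay
        gcongr
    _ = 4 * Real.exp r ^ (-(3 / 4) : ℝ) := by
        rw [mul_assoc, ← Real.exp_add, ← Real.exp_mul]
        ring_nf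
    _ ≤ _ := by gcongr

lemma norm_iteratedDeriv_gaussianCosh_le_rpow (k : ℕ) {z : ℂ} (hz : 0 < z.re) :
    ∃ C, 0 ≤ C ∧ ∀ v, 1 < v →
      ‖iteratedDeriv (k + 1) (gaussianCosh z) v‖ ≤ C * v ^ (-(3 / 4) : ℝ) := by
  obtain ⟨C, hC0, hC⟩ := norm_iteratedDeriv_gaussianCosh_le (k + 1)
  have h3 := growth_nonneg (k + 1) (a := ‖z‖⁻¹) (by positivity)
  refine ⟨C * growth (k + 1) ‖z‖⁻¹ * 4, by positivity, fun v hv => ?_⟩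
  have hr := Real.arcosh_pos hv
  have h := hC z hz (Real.arcosh v) hr
  rw [Real.cosh_arcosh hv.le] at h
  have hd := decay_le_cosh_rpow hr.le
  rw [Real.cosh_arcosh hv.le] at hd
  have hd0 := (decay_pos hr.le).le
  have hpow : decay (Real.arcosh v) ^ (k + 1) ≤ decay (Real.arcosh v) :=
    pow_le_of_le_one hd0 (decay_le_one _) k.succ_ne_zero
  calc _ ≤ C * decay (Real.arcosh v) ^ (k + 1) * growth (k + 1) ‖z‖⁻¹ := h
    _ ≤ C * (4 * v ^ (-(3 / 4) : ℝ)) * growth (k + 1) ‖z‖⁻¹ := by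
        gcongr
        exact hpow.trans hd
    _ = _ := by ring

/-! ### Half-integrals of the derivatives -/

lemma integrableOn_abel_weight :
    IntegrableOn (fun w : ℝ => (1 + w) ^ (-(3 / 4) : ℝ) * w ^ (-(1 / 2) : ℝ)) (Ioi 0) := by
  have hm : Measurable fun w : ℝ => (1 + w) ^ (-(3 / 4) : ℝ) * w ^ (-(1 / 2) : ℝ) := by fun_prop
  rw [← Ioc_union_Ioi_eq_Ioi zero_le_one, integrableOn_union]
  constructor
  · have h : IntegrableOn (fun w : ℝ => w ^ (-(1 / 2) : ℝ)) (Ioc 0 1) :=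
      (intervalIntegrable_iff_integrableOn_Ioc_of_le zero_le_one).mp
        (intervalIntegral.intervalIntegrable_rpow' (by norm_num))
    refine Integrable.mono' h hm.aestronglyMeasurable ?_
    refine (ae_restrict_iff' measurableSet_Ioc).mpr (Eventually.of_forall fun w hw => ?_)
    have hw0 := hw.1
    rw [Real.norm_of_nonneg (by positivity)]
    exact mul_le_of_le_one_left (by positivity)
      (Real.rpow_le_one_of_one_le_of_nonpos (by linarith) (by norm_num))
  · refine Integrable.mono' (integrableOn_Ioi_rpow_of_lt (a := -(5 / 4)) (by norm_num) one_pos)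
      hm.aestronglyMeasurable ?_
    refine (ae_restrict_iff' measurableSet_Ioi).mpr (Eventually.of_forall fun w hw => ?_)
    have hw0 : 0 < w := one_pos.trans hw
    rw [Real.norm_of_nonneg (by positivity)]
    calc _ ≤ w ^ (-(3 / 4) : ℝ) * w ^ (-(1 / 2) : ℝ) := by
          refine mul_le_mul_of_nonneg_right ?_ (by positivity)
          exact Real.rpow_le_rpow_of_nonpos hw0 (by linarith) (by norm_num)
      _ = w ^ (-(5 / 4) : ℝ) := by
          rw [← Real.rpow_add hw0]
          norm_num

/-- The integrand of the half-integral of the derivative of order `k + 1` of the Gaussian. -/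
def abelFun (k : ℕ) (z : ℂ) (u w : ℝ) : ℂ :=
  iteratedDeriv (k + 1) (gaussianCosh z) (u + w) * ((w ^ (-(1 / 2) : ℝ) : ℝ) : ℂ)

/-- The half-integral of the derivative of order `k + 1` of the Gaussian. -/
def abelTransform (k : ℕ) (z : ℂ) (u : ℝ) : ℂ := ∫ w in Ioi (0 : ℝ), abelFun k z u w

/-- Replacing `u + w` by `1 + w` makes the majorant independent of `u`, as differentiation under the
integral requires. -/
lemma norm_abelFun_le (k : ℕ) {z : ℂ} (hz : 0 < z.re) : ∃ C, 0 ≤ C ∧ ∀ u, 1 < u → ∀ w, 0 < w →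
    ‖abelFun k z u w‖ ≤ C * ((1 + w) ^ (-(3 / 4) : ℝ) * w ^ (-(1 / 2) : ℝ)) := by
  obtain ⟨C, hC0, hC⟩ := norm_iteratedDeriv_gaussianCosh_le_rpow k hz
  refine ⟨C, hC0, fun u hu w hw => ?_⟩
  rw [abelFun, norm_mul, Complex.norm_real, Real.norm_of_nonneg (by positivity), ← mul_assoc]
  refine mul_le_mul_of_nonneg_right ((hC (u + w) (by linarith)).trans ?_) (by positivity)
  refine mul_le_mul_of_nonneg_left ?_ hC0
  exact Real.rpow_le_rpow_of_nonpos (by linarith) (by linarith) (by norm_num)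

lemma aestronglyMeasurable_abelFun (k : ℕ) (z : ℂ) {u : ℝ} (hu : 1 < u) :
    AEStronglyMeasurable (abelFun k z u) (volume.restrict (Ioi 0)) := by
  refine ContinuousOn.aestronglyMeasurable (fun w hw => ?_) measurableSet_Ioi
  have hw' : 0 < w := hw
  have h1 : ContinuousAt (iteratedDeriv (k + 1) (gaussianCosh z)) (u + w) :=
    (hasDerivAt_iteratedDeriv_gaussianCosh z (k + 1) (by linarith)).continuousAt
  have h2 : ContinuousAt (fun w : ℝ => iteratedDeriv (k + 1) (gaussianCosh z) (u + w)) w :=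
    ContinuousAt.comp (f := fun w : ℝ => u + w) h1 (by fun_prop)
  have h3 : ContinuousAt (fun w : ℝ => ((w ^ (-(1 / 2) : ℝ) : ℝ) : ℂ)) w :=
    Complex.continuous_ofReal.continuousAt.comp
      (Real.continuousAt_rpow_const w _ (Or.inl hw'.ne'))
  exact (h2.mul h3).continuousWithinAt

lemma integrableOn_abelFun (k : ℕ) {z : ℂ} (hz : 0 < z.re) {u : ℝ} (hu : 1 < u) :
    IntegrableOn (abelFun k z u) (Ioi 0) := by
  obtain ⟨C, -, hC⟩ := norm_abelFun_le k hz
  exact Integrable.mono' (integrableOn_abel_weight.const_mul C) (aestronglyMeasurable_abelFun k z hu)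
    ((ae_restrict_iff' measurableSet_Ioi).mpr (Eventually.of_forall fun w hw => hC u hu w hw))

lemma hasDerivAt_abelTransform (k : ℕ) {z : ℂ} (hz : 0 < z.re) {u : ℝ} (hu : 1 < u) :
    HasDerivAt (abelTransform k z) (abelTransform (k + 1) z u) u := by
  obtain ⟨C, -, hC⟩ := norm_abelFun_le (k + 1) hz
  refine (hasDerivAt_integral_of_dominated_loc_of_deriv_le (𝕜 := ℝ)
    (F := fun u w => abelFun k z u w) (F' := fun u w => abelFun (k + 1) z u w)
    (bound := fun w => C * ((1 + w) ^ (-(3 / 4) : ℝ) * w ^ (-(1 / 2) : ℝ)))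
    (Ioi_mem_nhds hu) ?_ (integrableOn_abelFun k hz hu)
    (aestronglyMeasurable_abelFun (k + 1) z hu) ?_ (integrableOn_abel_weight.const_mul C) ?_).2
  · filter_upwards [Ioi_mem_nhds hu] with x hx
    exact aestronglyMeasurable_abelFun k z hx
  · exact (ae_restrict_iff' measurableSet_Ioi).mpr
      (Eventually.of_forall fun w hw x hx => hC x hx w hw)
  · refine (ae_restrict_iff' measurableSet_Ioi).mpr (Eventually.of_forall fun w hw x hx => ?_)
    have hw' : 0 < w := hw
    have hx' : 1 < x := hx
    exact ((hasDerivAt_iteratedDeriv_gaussianCosh z (k + 1) (by linarith : 1 < x + w)).comp_add_const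
      x w).mul_const _

/-! ### Formulas for the kernel in all dimensions -/

/-- The dimension shift `d → d + 2`, in the variable `u = cosh r`. -/
lemma kernel_add_two_of_eq {n : ℕ} {z : ℂ} (hz : 0 < z.re) {F F' : ℝ → ℂ}
    (hF : ∀ u, 1 < u → HasDerivAt F (F' u) u)
    (h : ∀ r, 0 < r → kernel n z r = F (Real.cosh r)) {r : ℝ} (hr : 0 < r) :
    kernel (n + 2) z r = -(n + 2) * F' (Real.cosh r) := by
  have hs : (Real.sinh r : ℂ) ≠ 0 :=
    Complex.ofReal_ne_zero.mpr (Real.sinh_pos_iff.mpr hr).ne'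
  have h1 : HasDerivAt (fun r => F (Real.cosh r)) (Real.sinh r • F' (Real.cosh r)) r :=
    (hF _ (Real.one_lt_cosh.mpr hr.ne')).scomp r (Real.hasDerivAt_cosh r)
  have h2 : HasDerivAt (kernel n z) (Real.sinh r • F' (Real.cosh r)) r := by
    refine h1.congr_of_eventuallyEq ?_
    filter_upwards [Ioi_mem_nhds hr] with x hx
    exact h x hx
  -- Two expressions of the same `r`-derivative; the common factor `sinh r ≠ 0` cancels.
  have h3 := (hasDerivAt_kernel n hz r).unique h2
  have hn : (n + 2 : ℂ) ≠ 0 := by exact_mod_cast (n + 1).succ_ne_zero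
  rw [Complex.real_smul] at h3
  field_simp at h3
  linear_combination -h3

/-- By the chain rule this is the `x`-derivative of `e^{-x²/4z}`, the factor left by the sine
transform in dimensions two and three. -/
lemma iteratedDeriv_one_gaussianCosh (z : ℂ) {x : ℝ} (hx : 0 < x) :
    iteratedDeriv 1 (gaussianCosh z) (Real.cosh x) * Real.sinh x =
      -(x / (2 * z) * Complex.exp (-(x : ℂ) ^ 2 / (4 * z))) := by
  have hs : (Real.sinh x : ℂ) ≠ 0 :=
    Complex.ofReal_ne_zero.mpr (Real.sinh_pos_iff.mpr hx).ne'
  rw [iteratedDeriv_one, (hasDerivAt_gaussianCosh z (Real.one_lt_cosh.mpr hx.ne')).deriv,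
    coshIntegral_zero_cosh hx, gaussianCosh, Real.arcosh_cosh hx.le]
  rcases eq_or_ne z 0 with rfl | hz
  · simp
  push_cast at hs ⊢
  field_simp
  norm_num

lemma kernel_odd_eq (m : ℕ) : ∃ c : ℂ, ∀ z : ℂ, 0 < z.re → ∀ r, 0 < r →
    kernel (2 * m + 1) z r = c * (Real.pi / z) ^ (1 / 2 : ℂ) *
      iteratedDeriv (m + 1) (gaussianCosh z) (Real.cosh r) := by
  induction m with
  | zero =>
    refine ⟨-1, fun z hz r hr => ?_⟩
    have hs : (Real.sinh r : ℂ) ≠ 0 :=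
      Complex.ofReal_ne_zero.mpr (Real.sinh_pos_iff.mpr hr).ne'
    have h := iteratedDeriv_one_gaussianCosh z hr
    rw [mul_zero, zero_add, kernel_one hz hr, inv_mul_eq_iff_eq_mul₀ hs]
    linear_combination ((Real.pi / z) ^ (1 / 2 : ℂ)) * h
  | succ m ih =>
    obtain ⟨c, hc⟩ := ih
    refine ⟨-((2 * m + 1 : ℕ) + 2) * c, fun z hz r hr => ?_⟩
    have h := kernel_add_two_of_eq hz
      (F := fun u => c * (Real.pi / z) ^ (1 / 2 : ℂ) * iteratedDeriv (m + 1) (gaussianCosh z) u)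
      (fun u hu => (hasDerivAt_iteratedDeriv_gaussianCosh z (m + 1) hu).const_mul _)
      (fun r hr => hc z hz r hr) hr
    rw [show 2 * (m + 1) + 1 = 2 * m + 1 + 2 by ring, h]
    ring

/-- The substitution `w = cosh x - cosh r` turns `gapWeight r x` into `(w / 2)^{-1/2}`, and `sinh x
dx` into `dw`. -/
lemma kernel_zero_eq {z : ℂ} (hz : 0 < z.re) {r : ℝ} (hr : 0 < r) :
    kernel 0 z r = -(((2⁻¹ : ℝ) ^ (-(1 / 2) : ℝ) : ℝ) / Real.pi) * (Real.pi / z) ^ (1 / 2 : ℂ) *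
      abelTransform 0 z (Real.cosh r) := by
  have himage : (fun x => Real.cosh x - Real.cosh r) '' Ioi r = Ioi 0 := by
    ext w
    constructor
    · rintro ⟨x, hx, rfl⟩
      have hx' : r < x := hx
      have : Real.cosh r < Real.cosh x := by
        rw [Real.cosh_lt_cosh, abs_of_pos hr, abs_of_pos (hr.trans hx')]
        exact hx'
      exact sub_pos.mpr this
    · intro hw
      have hw' : 0 < w := hw
      have h1 := Real.one_le_cosh r
      refine ⟨Real.arcosh (Real.cosh r + w), ?_, ?_⟩
      · rw [mem_Ioi]
        nth_rewrite 1 [← Real.arcosh_cosh hr.le]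
        rw [Real.arcosh_lt_arcosh (by linarith) (by linarith)]
        linarith
      · simp only
        rw [Real.cosh_arcosh (by linarith)]
        ring
  rw [kernel_zero hz hr, abelTransform, ← himage, integral_image_eq_integral_abs_deriv_smul
    measurableSet_Ioi (f' := Real.sinh), ← integral_const_mul, ← integral_const_mul]
  · refine setIntegral_congr_fun measurableSet_Ioi fun x hx => ?_
    have hx' : r < x := hx
    have hx0 : 0 < x := hr.trans hx'
    have hlt : Real.cosh r < Real.cosh x := by
      rw [Real.cosh_lt_cosh, abs_of_pos hr, abs_of_pos hx0]
      exact hx'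
    have hs := Real.sinh_pos_iff.mpr hx0
    have h := iteratedDeriv_one_gaussianCosh z hx0
    simp only [abelFun, zero_add]
    rw [add_sub_cancel, abs_of_pos hs, Complex.real_smul, gapWeight_eq,
      abs_of_pos (sub_pos.mpr hlt), div_eq_mul_inv (Real.cosh x - Real.cosh r) 2,
      Real.mul_rpow (sub_pos.mpr hlt).le (by norm_num), Complex.ofReal_mul]
    generalize ((2⁻¹ : ℝ) ^ (-(1 / 2) : ℝ) : ℝ) = A
    generalize ((Real.cosh x - Real.cosh r) ^ (-(1 / 2) : ℝ) : ℝ) = B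
    rw [div_eq_mul_inv (A : ℂ)]
    linear_combination ((Real.pi : ℂ)⁻¹ * A * B * (Real.pi / z) ^ (1 / 2 : ℂ)) * h
  · intro x _
    exact ((Real.hasDerivAt_cosh x).sub_const _).hasDerivWithinAt
  · intro x hx y hy hxy
    have hx' : r < x := hx
    have hy' : r < y := hy
    exact Real.cosh_injOn (hr.trans hx').le (hr.trans hy').le (by simpa using hxy)

lemma kernel_even_eq (m : ℕ) : ∃ c : ℂ, ∀ z : ℂ, 0 < z.re → ∀ r, 0 < r →
    kernel (2 * m) z r = c * (Real.pi / z) ^ (1 / 2 : ℂ) * abelTransform m z (Real.cosh r) := by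
  induction m with
  | zero => exact ⟨_, fun z hz r hr => kernel_zero_eq hz hr⟩
  | succ m ih =>
    obtain ⟨c, hc⟩ := ih
    refine ⟨-((2 * m : ℕ) + 2) * c, fun z hz r hr => ?_⟩
    have h := kernel_add_two_of_eq hz
      (F := fun u => c * (Real.pi / z) ^ (1 / 2 : ℂ) * abelTransform m z u)
      (fun u hu => (hasDerivAt_abelTransform m hz hu).const_mul _)
      (fun r hr => hc z hz r hr) hr
    rw [show 2 * (m + 1) = 2 * m + 2 by ring, h]
    ring

/-! ### Estimate of the half-integral -/

lemma norm_setIntegral_near_le {k : ℕ} {z : ℂ} {u h M : ℝ} (hh : 0 < h)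
    (hM : ∀ v, u ≤ v → ‖iteratedDeriv (k + 1) (gaussianCosh z) v‖ ≤ M) :
    ‖∫ w in Ioc 0 h, abelFun k z u w‖ ≤ 2 * M * √h := by
  have hint : IntegrableOn (fun w : ℝ => M * w ^ (-(1 / 2) : ℝ)) (Ioc 0 h) :=
    ((intervalIntegrable_iff_integrableOn_Ioc_of_le hh.le).mp
      (intervalIntegral.intervalIntegrable_rpow' (by norm_num))).const_mul M
  refine (norm_integral_le_of_norm_le hint ?_).trans (le_of_eq ?_)
  · refine (ae_restrict_iff' measurableSet_Ioc).mpr (Eventually.of_forall fun w hw => ?_)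
    have hw0 := hw.1
    rw [abelFun, norm_mul, Complex.norm_real, Real.norm_of_nonneg (by positivity)]
    exact mul_le_mul_of_nonneg_right (hM _ (by linarith)) (by positivity)
  · rw [integral_const_mul, ← intervalIntegral.integral_of_le hh.le,
      integral_rpow (Or.inl (by norm_num)), Real.sqrt_eq_rpow,
      show (-(1 / 2) + 1 : ℝ) = 1 / 2 by norm_num, Real.zero_rpow (by norm_num)]
    ring

/-- Away from `w = 0` an integration by parts moves one derivative onto `w^{-1/2}`, so the bound of
order `k` suffices. The boundary term and the remaining integral each contribute `M / √h`. -/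
lemma norm_setIntegral_far_le {k : ℕ} {z : ℂ} (hz : 0 < z.re) {u h M : ℝ} (hu : 1 < u) (hh : 0 < h)
    (hM : ∀ v, u ≤ v → ‖iteratedDeriv k (gaussianCosh z) v‖ ≤ M) :
    ‖∫ w in Ioi h, abelFun k z u w‖ ≤ 2 * M * (√h)⁻¹ := by
  have hM0 : 0 ≤ M := (norm_nonneg _).trans (hM u le_rfl)
  have hab : IntegrableOn (abelFun k z u) (Ioi h) :=
    (integrableOn_abelFun k hz hu).mono_set (Ioi_subset_Ioi hh.le)
  set B : ℝ → ℂ := fun w => iteratedDeriv k (gaussianCosh z) (u + w) *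
    ((-(1 / 2) * w ^ (-(1 / 2) - 1 : ℝ) : ℝ) : ℂ) with hB
  have hderiv : ∀ w, 0 < w → HasDerivAt (fun w : ℝ => iteratedDeriv k (gaussianCosh z) (u + w) *
      ((w ^ (-(1 / 2) : ℝ) : ℝ) : ℂ)) (abelFun k z u w + B w) w := by
    intro w hw
    have h1 := (hasDerivAt_iteratedDeriv_gaussianCosh z k (by linarith : 1 < u + w)).comp_const_add
      u w
    exact h1.mul (Real.hasDerivAt_rpow_const (p := -(1 / 2)) (Or.inl hw.ne')).ofReal_comp
  have hrpow : IntegrableOn (fun w : ℝ => M * ((1 / 2) * w ^ (-(3 / 2) : ℝ))) (Ioi h) :=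
    ((integrableOn_Ioi_rpow_of_lt (by norm_num) hh).const_mul _).const_mul _
  have hBle : ∀ w ∈ Ioi h, ‖B w‖ ≤ M * ((1 / 2) * w ^ (-(3 / 2) : ℝ)) := by
    intro w hw
    have hw0 : 0 < w := hh.trans hw
    have hexp : (-(1 / 2) - 1 : ℝ) = -(3 / 2) := by norm_num
    simp only [hB]
    rw [norm_mul, Complex.norm_real, hexp, norm_mul, Real.norm_of_nonneg
      (by positivity : (0 : ℝ) ≤ w ^ (-(3 / 2) : ℝ))]
    norm_num
    refine mul_le_mul_of_nonneg_right (hM _ (by linarith)) ?_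
    have := Real.rpow_nonneg hw0.le (-(3 / 2))
    positivity
  have hBm : AEStronglyMeasurable B (volume.restrict (Ioi h)) := by
    refine ContinuousOn.aestronglyMeasurable (fun w hw => ?_) measurableSet_Ioi
    have hw0 : 0 < w := hh.trans hw
    have h1 := ((hasDerivAt_iteratedDeriv_gaussianCosh z k
      (by linarith : 1 < u + w)).comp_const_add u w).continuousAt
    have h3 : ContinuousAt (fun w : ℝ => ((-(1 / 2) * w ^ (-(1 / 2) - 1 : ℝ) : ℝ) : ℂ)) w :=
      Complex.continuous_ofReal.continuousAt.comp
        ((Real.continuousAt_rpow_const w _ (Or.inl hw0.ne')).const_mul _)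
    exact (h1.mul h3).continuousWithinAt
  have hBi : IntegrableOn B (Ioi h) := Integrable.mono' hrpow hBm
    ((ae_restrict_iff' measurableSet_Ioi).mpr (Eventually.of_forall hBle))
  have hlim : Tendsto (fun w : ℝ => iteratedDeriv k (gaussianCosh z) (u + w) *
      ((w ^ (-(1 / 2) : ℝ) : ℝ) : ℂ)) atTop (𝓝 0) := by
    have h0 : Tendsto (fun w : ℝ => M * w ^ (-(1 / 2) : ℝ)) atTop (𝓝 0) := by
      simpa using (tendsto_rpow_neg_atTop (by norm_num : (0 : ℝ) < 1 / 2)).const_mul M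
    refine squeeze_zero_norm' ?_ h0
    filter_upwards [eventually_gt_atTop 0] with w hw
    rw [norm_mul, Complex.norm_real, Real.norm_of_nonneg (by positivity)]
    exact mul_le_mul_of_nonneg_right (hM _ (by linarith)) (by positivity)
  have hFTC := integral_Ioi_of_hasDerivAt_of_tendsto
    (hderiv h hh).continuousAt.continuousWithinAt (fun w hw => hderiv w (hh.trans hw))
    (hab.add hBi) hlim
  rw [integral_add hab hBi, zero_sub] at hFTC
  rw [eq_sub_of_add_eq hFTC]
  have hsq : h ^ (-(1 / 2) : ℝ) = (√h)⁻¹ := by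
    rw [Real.rpow_neg hh.le, Real.sqrt_eq_rpow]
  have h1 : ‖-(iteratedDeriv k (gaussianCosh z) (u + h) * ((h ^ (-(1 / 2) : ℝ) : ℝ) : ℂ))‖ ≤
      M * (√h)⁻¹ := by
    rw [norm_neg, norm_mul, Complex.norm_real, Real.norm_of_nonneg (by positivity), hsq]
    exact mul_le_mul_of_nonneg_right (hM _ (by linarith)) (by positivity)
  have h2 : ‖∫ w in Ioi h, B w‖ ≤ M * (√h)⁻¹ := by
    refine (norm_integral_le_of_norm_le hrpow
      ((ae_restrict_iff' measurableSet_Ioi).mpr (Eventually.of_forall hBle))).trans (le_of_eq ?_)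
    rw [integral_const_mul, integral_const_mul, integral_Ioi_rpow_of_lt (by norm_num) hh,
      show (-(3 / 2) + 1 : ℝ) = -(1 / 2) by norm_num, hsq]
    ring
  calc _ ≤ _ := norm_sub_le _ _
    _ ≤ _ := by linarith

/-- The free cut `h` interpolates between the orders `k` and `k + 1`. -/
lemma norm_abelTransform_le {k : ℕ} {z : ℂ} (hz : 0 < z.re) {u h M M' : ℝ} (hu : 1 < u) (hh : 0 < h)
    (hM : ∀ v, u ≤ v → ‖iteratedDeriv k (gaussianCosh z) v‖ ≤ M)
    (hM' : ∀ v, u ≤ v → ‖iteratedDeriv (k + 1) (gaussianCosh z) v‖ ≤ M') :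
    ‖abelTransform k z u‖ ≤ 2 * M' * √h + 2 * M * (√h)⁻¹ := by
  have hint := integrableOn_abelFun k hz hu
  rw [abelTransform, ← Ioc_union_Ioi_eq_Ioi hh.le, setIntegral_union (Ioc_disjoint_Ioi le_rfl)
    measurableSet_Ioi (hint.mono_set Ioc_subset_Ioi_self) (hint.mono_set (Ioi_subset_Ioi hh.le))]
  exact (norm_add_le _ _).trans
    (add_le_add (norm_setIntegral_near_le hh hM') (norm_setIntegral_far_le hz hu hh hM))

/-! ### The kernel estimate -/

lemma norm_pi_div_cpow_half (z : ℂ) :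
    ‖((Real.pi : ℂ) / z) ^ (1 / 2 : ℂ)‖ = √Real.pi * √‖z‖⁻¹ := by
  have h : (1 / 2 : ℂ) = ((1 / 2 : ℝ) : ℂ) := by push_cast; rfl
  rw [h, Complex.norm_cpow_real, norm_div, Complex.norm_real, Real.norm_of_nonneg Real.pi_pos.le,
    ← Real.sqrt_eq_rpow, div_eq_mul_inv, Real.sqrt_mul Real.pi_pos.le]

/-- The spatial factor `e^{-ρr} (1 + r)^{ρ+1}` of the kernel estimate. -/
def spatialBound (n : ℕ) (r : ℝ) : ℝ :=
  Real.exp (-(rho (n + 2) * r)) * (1 + r) ^ (rho (n + 2) + 1)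

lemma spatialBound_nonneg (n : ℕ) {r : ℝ} (hr : 0 ≤ r) : 0 ≤ spatialBound n r := by
  unfold spatialBound
  positivity

lemma decay_pow (r : ℝ) (m : ℕ) : decay r ^ m = Real.exp (-(m * r)) * (1 + r) ^ m := by
  rw [decay, mul_pow, ← Real.exp_nat_mul]
  ring_nf

lemma pow_le_one_add_rpow {r p : ℝ} (hr : 0 ≤ r) {m : ℕ} (h : (m : ℝ) ≤ p) :
    (1 + r) ^ m ≤ (1 + r) ^ p := by
  rw [← Real.rpow_natCast]
  exact Real.rpow_le_rpow_of_exponent_le (by linarith) h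

lemma decay_pow_le_spatialBound {r : ℝ} (hr : 0 ≤ r) (m : ℕ) :
    decay r ^ (m + 1) ≤ spatialBound (2 * m + 1) r := by
  have hρ : rho (2 * m + 1 + 2) = ((m + 1 : ℕ) : ℝ) := by
    simp only [rho]
    push_cast
    ring
  rw [decay_pow, spatialBound, hρ]
  refine mul_le_mul_of_nonneg_left (pow_le_one_add_rpow hr ?_) (Real.exp_pos _).le
  linarith

lemma rho_even (m : ℕ) : rho (2 * m + 2) = m + 1 / 2 := by
  simp only [rho]
  push_cast
  ring

/-- Here `√(cosh r) ≤ e^{r/2}` lowers the exponential rate from `m + 1` to `ρ = m + 1/2`; the power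
`m + 1` of `1 + r` is still at most `ρ + 1`. -/
lemma decay_pow_succ_mul_sqrt_cosh_le {r : ℝ} (hr : 0 ≤ r) (m : ℕ) :
    decay r ^ (m + 1) * √(Real.cosh r) ≤ spatialBound (2 * m) r := by
  have h1 : √(Real.cosh r) ≤ Real.exp (r / 2) := by
    rw [Real.sqrt_le_left (Real.exp_pos _).le, ← Real.exp_nat_mul,
      show ((2 : ℕ) : ℝ) * (r / 2) = r by push_cast; ring, ← Real.cosh_add_sinh]
    linarith [Real.sinh_nonneg_iff.mpr hr]
  rw [decay_pow, spatialBound, rho_even]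
  calc _ ≤ Real.exp (-((m + 1 : ℕ) * r)) * (1 + r) ^ (m + 1) * Real.exp (r / 2) := by gcongr
    _ = Real.exp (-(((m : ℝ) + 1 / 2) * r)) * (1 + r) ^ (m + 1) := by
        rw [mul_right_comm, ← Real.exp_add]
        push_cast
        ring_nf
    _ ≤ _ := by
        refine mul_le_mul_of_nonneg_left (pow_le_one_add_rpow hr ?_) (Real.exp_pos _).le
        push_cast
        linarith

/-- Here `1 / √(cosh r) ≤ 2 e^{-r/2}` raises the exponential rate from `m` to `ρ = m + 1/2`. -/
lemma decay_pow_mul_inv_sqrt_cosh_le {r : ℝ} (hr : 0 ≤ r) (m : ℕ) :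
    decay r ^ m * (√(Real.cosh r))⁻¹ ≤ 2 * spatialBound (2 * m) r := by
  have h1 : Real.exp (r / 2) / 2 ≤ √(Real.cosh r) := by
    refine Real.le_sqrt_of_sq_le ?_
    rw [div_pow, ← Real.exp_nat_mul, show ((2 : ℕ) : ℝ) * (r / 2) = r by push_cast; ring,
      Real.cosh_eq]
    linarith [Real.exp_pos r, Real.exp_pos (-r)]
  have h2 : (√(Real.cosh r))⁻¹ ≤ 2 * Real.exp (-(r / 2)) := by
    calc _ ≤ (Real.exp (r / 2) / 2)⁻¹ := inv_anti₀ (by positivity) h1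
      _ = _ := by rw [inv_div, Real.exp_neg]; rfl
  rw [decay_pow, spatialBound, rho_even]
  calc _ ≤ Real.exp (-(m * r)) * (1 + r) ^ m * (2 * Real.exp (-(r / 2))) := by gcongr
    _ = 2 * (Real.exp (-(((m : ℝ) + 1 / 2) * r)) * (1 + r) ^ m) := by
        rw [show -(((m : ℝ) + 1 / 2) * r) = -(m * r) + -(r / 2) by ring, Real.exp_add]
        ring
    _ ≤ _ := by
        refine mul_le_mul_of_nonneg_left (mul_le_mul_of_nonneg_left (pow_le_one_add_rpow hr ?_)
          (Real.exp_pos _).le) two_pos.le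
        linarith

lemma rpow_le_add_rpow {a p q : ℝ} (ha : 0 < a) (h1 : 1 ≤ p) (h2 : p ≤ q) :
    a ^ p ≤ a + a ^ q := by
  rcases le_total a 1 with h | h
  · have h3 := Real.rpow_le_rpow_of_exponent_ge ha h h1
    rw [Real.rpow_one] at h3
    have := Real.rpow_nonneg ha.le q
    linarith
  · have := Real.rpow_le_rpow_of_exponent_le h h2
    linarith

lemma norm_kernel_odd_le (m : ℕ) : ∃ C, 0 ≤ C ∧ ∀ z : ℂ, 0 < z.re → ∀ r, 0 < r →
    ‖kernel (2 * m + 1) z r‖ ≤ C * (‖z‖⁻¹ + ‖z‖⁻¹ ^ (((2 * m + 1 : ℕ) + 2 : ℝ) / 2)) *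
      spatialBound (2 * m + 1) r := by
  obtain ⟨c, hc⟩ := kernel_odd_eq m
  obtain ⟨C, hC0, hC⟩ := norm_iteratedDeriv_gaussianCosh_le (m + 1)
  refine ⟨‖c‖ * √Real.pi * C * 2, by positivity, fun z hz r hr => ?_⟩
  have hz0 : z ≠ 0 := by
    rintro rfl
    simp at hz
  set a := ‖z‖⁻¹ with ha
  have ha0 : 0 < a := by positivity
  -- The prefactor `(π / z)^{1/2}` supplies `√a`; it gives `a^{3/2}`, an exponent between `1` and `d
  -- / 2`, and exactly `a^{d/2}`.
  have hgrowth : √a * growth (m + 1) a ≤ 2 * (a + a ^ (((2 * m + 1 : ℕ) + 2 : ℝ) / 2)) := by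
    have hm : (0 : ℝ) ≤ m := m.cast_nonneg
    have e1 : √a * a = a ^ (3 / 2 : ℝ) := by
      rw [Real.sqrt_eq_rpow, ← Real.rpow_add_one ha0.ne']
      norm_num
    have e2 : √a * a ^ (m + 1) = a ^ (((2 * m + 1 : ℕ) + 2 : ℝ) / 2) := by
      rw [Real.sqrt_eq_rpow, ← Real.rpow_natCast, ← Real.rpow_add ha0]
      congr 1
      push_cast
      ring
    rw [growth, if_neg m.succ_ne_zero, mul_add, e1, e2]
    have h1 := rpow_le_add_rpow ha0 (p := 3 / 2) (q := ((2 * m + 1 : ℕ) + 2 : ℝ) / 2) (by norm_num)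
      (by push_cast; linarith)
    linarith
  have hsb := decay_pow_le_spatialBound hr.le m
  have hsb0 := spatialBound_nonneg (2 * m + 1) hr.le
  have hg0 := growth_nonneg (m + 1) ha0.le
  rw [hc z hz r hr, norm_mul, norm_mul, norm_pi_div_cpow_half]
  calc _ ≤ ‖c‖ * (√Real.pi * √a) * (C * spatialBound (2 * m + 1) r * growth (m + 1) a) := by
        gcongr
        exact (hC z hz r hr).trans (by gcongr)
    _ = ‖c‖ * √Real.pi * C * (√a * growth (m + 1) a) * spatialBound (2 * m + 1) r := by ring
    _ ≤ ‖c‖ * √Real.pi * C * (2 * (a + a ^ (((2 * m + 1 : ℕ) + 2 : ℝ) / 2))) *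
        spatialBound (2 * m + 1) r := by gcongr
    _ = _ := by ring

lemma norm_kernel_even_le (m : ℕ) : ∃ C, 0 ≤ C ∧ ∀ z : ℂ, 0 < z.re → ∀ r, 0 < r →
    ‖kernel (2 * m) z r‖ ≤ C * (‖z‖⁻¹ + ‖z‖⁻¹ ^ (((2 * m : ℕ) + 2 : ℝ) / 2)) *
      spatialBound (2 * m) r := by
  obtain ⟨c, hc⟩ := kernel_even_eq m
  obtain ⟨C, hC0, hC⟩ := norm_iteratedDeriv_gaussianCosh_le_of_le m
  obtain ⟨C', hC'0, hC'⟩ := norm_iteratedDeriv_gaussianCosh_le_of_le (m + 1)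
  refine ⟨‖c‖ * √Real.pi * (2 * C' + 8 * C), by positivity, fun z hz r hr => ?_⟩
  have hz0 : z ≠ 0 := by
    rintro rfl
    simp at hz
  set a := ‖z‖⁻¹ with ha
  have ha0 : 0 < a := by positivity
  have hcosh := Real.cosh_pos r
  have hexp : a ^ (((2 * m : ℕ) + 2 : ℝ) / 2) = a ^ (m + 1) := by
    rw [← Real.rpow_natCast]
    congr 1
    push_cast
    ring
  have hgr : growth (m + 1) a = a + a ^ (m + 1) := by rw [growth, if_neg m.succ_ne_zero]
  have hg0 := growth_nonneg m ha0.le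
  have hg1 := growth_nonneg (m + 1) ha0.le
  have hd0 := (decay_pos hr.le).le
  have hsb0 := spatialBound_nonneg (2 * m) hr.le
  -- The two bounds differ by factors of order `a` and `decay r`, so they balance up to powers of `1
  -- + r` for `h` of order `cosh r / a`. With the prefactor `√a`, the near part carries `√(cosh r)`
  -- and the far part `a / √(cosh r)`.
  have hA := norm_abelTransform_le hz (h := Real.cosh r / a) (Real.one_lt_cosh.mpr hr.ne')
    (by positivity) (fun v hv => hC z hz r hr v hv) (fun v hv => hC' z hz r hr v hv)
  rw [Real.sqrt_div hcosh.le] at hA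
  have hsa : 0 < √a := Real.sqrt_pos.mpr ha0
  have hsc : 0 < √(Real.cosh r) := Real.sqrt_pos.mpr hcosh
  have hsq : √a * √a = a := Real.mul_self_sqrt ha0.le
  rw [hexp, ← hgr, hc z hz r hr, norm_mul, norm_mul, norm_pi_div_cpow_half]
  calc _ ≤ ‖c‖ * (√Real.pi * √a) * (2 * (C' * decay r ^ (m + 1) * growth (m + 1) a) *
        (√(Real.cosh r) / √a) + 2 * (C * decay r ^ m * growth m a) *
        (√(Real.cosh r) / √a)⁻¹) := by gcongr
    _ = ‖c‖ * √Real.pi * (2 * C' * (decay r ^ (m + 1) * √(Real.cosh r)) * growth (m + 1) a +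
        2 * C * (decay r ^ m * (√(Real.cosh r))⁻¹) * ((√a * √a) * growth m a)) := by
        field_simp
    _ ≤ ‖c‖ * √Real.pi * (2 * C' * spatialBound (2 * m) r * growth (m + 1) a +
        2 * C * (2 * spatialBound (2 * m) r) * (2 * growth (m + 1) a)) := by
        rw [hsq]
        have h1 := decay_pow_succ_mul_sqrt_cosh_le hr.le m
        have h2 := decay_pow_mul_inv_sqrt_cosh_le hr.le m
        have h3 := mul_growth_le ha0.le (le_refl m)
        gcongr
    _ = _ := by ring

lemma norm_kernel_le (n : ℕ) : ∃ C, 0 ≤ C ∧ ∀ z : ℂ, 0 < z.re → ∀ r, 0 ≤ r →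
    ‖kernel n z r‖ ≤ C * (‖z‖⁻¹ + ‖z‖⁻¹ ^ ((n + 2 : ℝ) / 2)) * spatialBound n r := by
  have hpos : ∃ C, 0 ≤ C ∧ ∀ z : ℂ, 0 < z.re → ∀ r, 0 < r →
      ‖kernel n z r‖ ≤ C * (‖z‖⁻¹ + ‖z‖⁻¹ ^ ((n + 2 : ℝ) / 2)) * spatialBound n r := by
    rcases Nat.even_or_odd' n with ⟨m, rfl | rfl⟩
    · exact norm_kernel_even_le m
    · exact norm_kernel_odd_le m
  obtain ⟨C, hC0, hC⟩ := hpos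
  refine ⟨C, hC0, fun z hz r hr => ?_⟩
  rcases hr.eq_or_lt with rfl | hr
  -- At `r = 0` the variable `u` reaches the endpoint `1`, where the derivatives were not estimated;
  -- both sides are continuous in `r`.
  · have h1 : Tendsto (fun r => ‖kernel n z r‖) (𝓝[>] 0) (𝓝 ‖kernel n z 0‖) :=
      ((continuous_kernel n hz).norm.tendsto 0).mono_left nhdsWithin_le_nhds
    have hcont : Continuous (spatialBound n) := by
      have := rho_nonneg n
      unfold spatialBound
      refine Continuous.mul (by fun_prop) ?_
      exact (by fun_prop : Continuous fun r : ℝ => 1 + r).rpow_const fun _ => Or.inr (by linarith)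
    have h2 : Tendsto (fun r => C * (‖z‖⁻¹ + ‖z‖⁻¹ ^ ((n + 2 : ℝ) / 2)) * spatialBound n r)
        (𝓝[>] 0) (𝓝 (C * (‖z‖⁻¹ + ‖z‖⁻¹ ^ ((n + 2 : ℝ) / 2)) * spatialBound n 0)) :=
      ((hcont.const_mul _).tendsto 0).mono_left nhdsWithin_le_nhds
    exact le_of_tendsto_of_tendsto h1 h2 (by
      filter_upwards [self_mem_nhdsWithin] with x hx
      exact hC z hz x hx)
  · exact hC z hz r hr

end Hyp

end

/-! ### The theorem -/

theorem lemma3p2 (d : ℕ) (hd : 2 ≤ d) (κ : ℂ) (hκ : κ ≠ 0) :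
    ∃ C : ℝ, 0 < C ∧ ∀ ε : ℝ, 0 < ε → ∀ r : ℝ, 0 ≤ r → ∀ t : ℝ,
      MeasureTheory.Integrable (fun lam : ℝ => Hyp.kernelIntegrand d κ ε t r lam) ∧
      (t ≠ 0 →
        ‖∫ lam : ℝ, Hyp.kernelIntegrand d κ ε t r lam‖ ≤
          C * (|t| ^ (-((d : ℝ) / 2)) + |t| ^ (-1 : ℝ)) *
            Real.exp (-(Hyp.rho d * r)) * (1 + r) ^ (Hyp.rho d + 1)) := by
  obtain ⟨n, rfl⟩ : ∃ n, d = n + 2 := ⟨d - 2, by omega⟩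
  obtain ⟨C, hC0, hC⟩ := Hyp.norm_kernel_le n
  have hκ' : 0 < ‖κ‖ := norm_pos_iff.mpr hκ
  -- `C` may be zero, whereas the constant has to be positive.
  refine ⟨(‖κ‖ ^ 2)⁻¹ * (C + 1), by positivity, fun ε hε r hr t => ?_⟩
  set z : ℂ := Complex.I * t + (ε : ℂ) ^ 2 with hz
  have hre : z.re = ε ^ 2 := by
    rw [hz, ← Complex.ofReal_pow, Complex.add_re, Complex.ofReal_re]
    simp
  have him : z.im = t := by
    rw [hz, ← Complex.ofReal_pow, Complex.add_im, Complex.ofReal_im]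
    simp
  have hre0 : 0 < z.re := by
    rw [hre]
    positivity
  simp_rw [Hyp.kernelIntegrand_eq]
  refine ⟨(Hyp.integrable_kernelFun n hre0 r).const_mul _, fun ht => ?_⟩
  have ht' : 0 < |t| := abs_pos.mpr ht
  -- This comparison removes `ε` from the bound.
  have htz : |t| ≤ ‖z‖ := by
    rw [← him]
    exact Complex.abs_im_le_norm z
  have hz0 : 0 < ‖z‖ := ht'.trans_le htz
  have hinv : ‖z‖⁻¹ ≤ |t|⁻¹ := inv_anti₀ ht' htz
  have hsb := Hyp.spatialBound_nonneg n hr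
  have e1 : |t| ^ (-1 : ℝ) = |t|⁻¹ := Real.rpow_neg_one _
  have e2 : |t| ^ (-(((n + 2 : ℕ) : ℝ) / 2)) = |t|⁻¹ ^ ((n + 2 : ℝ) / 2) := by
    rw [Real.rpow_neg ht'.le, Real.inv_rpow ht'.le]
    push_cast
    rfl
  rw [MeasureTheory.integral_const_mul, norm_mul, Complex.norm_real,
    Real.norm_of_nonneg (by positivity), e1, e2]
  calc (‖κ‖ ^ 2)⁻¹ * ‖∫ l, Hyp.kernelFun n z r l‖
      ≤ (‖κ‖ ^ 2)⁻¹ * (C * (‖z‖⁻¹ + ‖z‖⁻¹ ^ ((n + 2 : ℝ) / 2)) * Hyp.spatialBound n r) := by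
        gcongr
        exact hC z hre0 r hr
    _ ≤ (‖κ‖ ^ 2)⁻¹ * ((C + 1) * (|t|⁻¹ + |t|⁻¹ ^ ((n + 2 : ℝ) / 2)) * Hyp.spatialBound n r) := by
        gcongr
        linarith
    _ = _ := by
        rw [Hyp.spatialBound]
        ring
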